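/- Let $(M,g)$ be a compact Riemannian manifold, let $L\to M$ be a Hermitian line bundle, and let $\nabla$ be a Hermitian connection on $L$. Let $G$ be a finite group acting on $L$ by smooth bundle maps that are unitary on the fibers and preserve $\nabla$, such that the induced action on $M$ is by isometries of $g$. For $j=1,2$ let $\Gamma_j\le G$ be a subgroup acting freely on $M$. Let $M_j=\Gamma_j\backslash M$ with the induced metric $g_j$, let $L_j=\Gamma_j\backslash L$ be the quotient Hermitian line bundle over $M_j$, let $\nabla_j$ be the connection on $L_j$ induced by $\nabla$, and let $\omega_j$ be the real $2$-form on $M_j$ such that $-i\omega_j$ is the curvature of $\nabla_j$. Assume that $\Gamma_1$ and $\Gamma_2$ are almost conjugate in $G$, i.e. there is a bijection $\Gamma_1\to\Gamma_2$ carrying each element to an element conjugate to it in $G$. Then $(M_1,\omega_1)$ and $(M_2,\omega_2)$ are quantum equivalent with respect to $\nabla_1$ and $\nabla_2$: for every integer $k\neq 0$, with $\hbar=1/k$, the operators $$\widehat H_k^{\,j}=-\frac{\hbar^2}{2}\Bigl(-\Delta_j-\tfrac16 R_j\Bigr),\qquad j=1,2,$$ are isospectral. Here $R_j$ is the scalar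 curvature of $g_j$ and $\Delta_j=-\operatorname{trace}(\nabla^2)$ is the Laplacian on sections of $L_j^{\otimes k}$ defined by $g_j$ and the connection induced by $\nabla_j$ (with $L_j^{\otimes k}=(L_j^*)^{\otimes |k|}$ for $k<0$). Isospectral means that the closures of $\widehat H_k^{\,1}$ and $\widehat H_k^{\,2}$, as unbounded operators on $L^2(M_1,L_1^{\otimes k})$ and $L^2(M_2,L_2^{\otimes k})$ with domains $C^\infty(M_j,L_j^{\otimes k})$ before closing, have the same spectrum, and that for each $\lambda\in\mathbb C$ the eigenspaces of $\widehat H_k^{\,1}$ and $\widehat H_k^{\,2}$ for $\lambda$ in $C^\infty(M_1,L_1^{\otimes k})$ and $C^\infty(M_2,L_2^{\otimes k})$ have the same dimension. -/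

import Mathlib

open Bundle MulAction MeasureTheory
open scoped Manifold ContDiff ENNReal

noncomputable section

set_option linter.unusedSectionVars false

namespace QuantumMagnetic

/-! ### Tensor powers of a complex line -/

section LinePower

/-- The tensor power `V^{⊗k}`, `k ∈ ℤ`, of a complex line `V` (with `V^{⊗(-1)}` the dual line).
An element `t` of `V^{⊗k}` is encoded by its coefficients: it is the function `f` on `V` with
`t = f v • v^{⊗k}` for every nonzero `v`, that is, a function which is homogeneous of degree `-k`
on `V ∖ {0}` (the value at `0` is normalized to be `0`). -/
def LinePow (k : ℤ) (V : Type*) [AddCommGroup V] [Module ℂ V] : Submodule ℂ (V → ℂ) where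
  carrier := {f | f 0 = 0 ∧ ∀ (a : ℂ) (v : V), a ≠ 0 → f (a • v) = a ^ (-k) * f v}
  add_mem' := by
    rintro f h ⟨hf0, hf⟩ ⟨hh0, hh⟩
    refine ⟨by simp [hf0, hh0], fun a v ha => ?_⟩
    simp only [Pi.add_apply, hf a v ha, hh a v ha, mul_add]
  zero_mem' := ⟨rfl, fun a v _ => by simp⟩
  smul_mem' := by
    rintro c f ⟨hf0, hf⟩
    refine ⟨by simp [hf0], fun a v ha => ?_⟩
    simp only [Pi.smul_apply, hf a v ha, smul_eq_mul]
    ring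

variable {V : Type*} [NormedAddCommGroup V] [InnerProductSpace ℂ V]

open Classical in
/-- For a nonzero vector `u` of the Hermitian line `V`, the element `c • u^{⊗k}` of `V^{⊗k}`. -/
def LinePow.ofValue (k : ℤ) (u : V) (c : ℂ) : LinePow k V :=
  ⟨fun v => if v = 0 then 0 else (inner ℂ u v / (‖u‖ : ℂ) ^ 2) ^ (-k) * c, by
    refine ⟨by simp, fun a v ha => ?_⟩
    by_cases hv : v = 0
    · simp [hv]
    · simp only [smul_eq_zero, ha, hv, or_self, if_false, inner_smul_right, mul_div_assoc,
        mul_zpow]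
      ring⟩

/-- The norm on `V^{⊗k}` induced by the Hermitian norm of the line `V`: `‖c • u^{⊗k}‖ = |c|` for
every unit vector `u` (so that the supremum is over a single value). -/
def LinePow.fiberNorm {k : ℤ} (f : LinePow k V) : ℝ≥0∞ :=
  ⨆ (u : V) (_ : ‖u‖ = 1), ‖f.1 u‖ₑ

end LinePower

/-! ### Riemannian geometry in charts -/

section Riemannian

variable {n : ℕ} {N : Type*} [TopologicalSpace N] [ChartedSpace (EuclideanSpace ℝ (Fin n)) N]

variable (n N) in
/-- A field of bilinear forms on the tangent spaces (a Riemannian metric, or a two-form). -/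
abbrev FormField : Type _ :=
  ∀ x : N, TangentSpace (𝓡 n) x →L[ℝ] TangentSpace (𝓡 n) x →L[ℝ] ℝ

/-- The `j`-th coordinate vector field `∂_j` of the preferred chart at `p`, near `p`. -/
def coordField (p : N) (j : Fin n) (x : N) : TangentSpace (𝓡 n) x :=
  mfderiv 𝓘(ℝ, EuclideanSpace ℝ (Fin n)) (𝓡 n) (extChartAt (𝓡 n) p).symm
    (extChartAt (𝓡 n) p x) (EuclideanSpace.single j (1 : ℝ))

/-- The partial derivative `∂_j f` at `x`, in the preferred chart at `p`. -/
def coordDeriv (p : N) (j : Fin n) (f : N → ℝ) (x : N) : ℝ :=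
  mvfderiv (𝓡 n) f x (coordField p j x)

/-- The matrix `g_{ij}` of the metric in the preferred chart at `p`. -/
def gram (g : FormField n N) (p x : N) : Matrix (Fin n) (Fin n) ℝ :=
  Matrix.of fun i j => g x (coordField p i x) (coordField p j x)

/-- The Christoffel symbol `Γ^l_{ij}` of the Levi-Civita connection in the preferred chart
at `p`. -/
def christoffel (g : FormField n N) (p : N) (l i j : Fin n) (x : N) : ℝ :=
  (1 / 2 : ℝ) * ∑ m, (gram g p x)⁻¹ l m *
    (coordDeriv p i (fun y => gram g p y j m) x + coordDeriv p j (fun y => gram g p y i m) x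
      - coordDeriv p m (fun y => gram g p y i j) x)

/-- The Ricci tensor `Ric_{ij}` at `p`, in the preferred chart at `p`. -/
def ricci (g : FormField n N) (p : N) (i j : Fin n) : ℝ :=
  ∑ l, (coordDeriv p l (christoffel g p l i j) p - coordDeriv p j (christoffel g p l i l) p
    + ∑ m, (christoffel g p l l m p * christoffel g p m i j p
      - christoffel g p l j m p * christoffel g p m i l p))

/-- The scalar curvature `R = g^{ij} Ric_{ij}`. -/
def scalarCurvature (g : FormField n N) (p : N) : ℝ :=
  ∑ i, ∑ j, (gram g p p)⁻¹ i j * ricci g p i j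

/-- The Riemannian volume measure on the Borel sets: in the domain of each preferred chart it is
`√(det g_{ij})` times Lebesgue measure. These local measures agree on overlaps, and the
supremum glues them. -/
def riemannianVolume (g : FormField n N) : @Measure N (borel N) :=
  letI : MeasurableSpace N := borel N
  ⨆ p : N, Measure.map (extChartAt (𝓡 n) p).symm
    (((volume : Measure (EuclideanSpace ℝ (Fin n))).restrict
        (extChartAt (𝓡 n) p).target).withDensity
      fun y => ENNReal.ofReal (Real.sqrt (gram g p ((extChartAt (𝓡 n) p).symm y)).det))

end Riemannian

/-! ### Hermitian line bundles, connections, and the quantum Hamiltonian -/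

section LineBundle

variable {n : ℕ} {N : Type*} [TopologicalSpace N] [ChartedSpace (EuclideanSpace ℝ (Fin n)) N]
  {L : N → Type*} [∀ x, NormedAddCommGroup (L x)] [∀ x, InnerProductSpace ℂ (L x)]
  [TopologicalSpace (TotalSpace ℂ L)]

variable (n L) in
/-- The type of the operator `σ ↦ ∇σ` underlying a connection on `L`: the value of
`∇_X σ` at `x` is `∇ σ x X`. -/
abbrev ConnField : Type _ :=
  (∀ x : N, L x) → ∀ x : N, TangentSpace (𝓡 n) x →L[ℝ] L x

variable (n L) in
/-- The Hermitian structure of `L` is smooth: inner products of smooth sections are smooth. -/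
def IsSmoothHermitian [FiberBundle ℂ L] : Prop :=
  ∀ (p : N) (σ τ : ∀ x : N, L x),
    ContMDiffAt (𝓡 n) ((𝓡 n).prod 𝓘(ℝ, ℂ)) ∞ (fun x => TotalSpace.mk' ℂ x (σ x)) p →
    ContMDiffAt (𝓡 n) ((𝓡 n).prod 𝓘(ℝ, ℂ)) ∞ (fun x => TotalSpace.mk' ℂ x (τ x)) p →
    ContMDiffAt (𝓡 n) 𝓘(ℝ, ℂ) ∞ (fun x => inner ℂ (σ x) (τ x)) p

/-- A Hermitian connection: a smooth covariant derivative which is complex linear and satisfies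
`X⟨σ, τ⟩ = ⟨∇_X σ, τ⟩ + ⟨σ, ∇_X τ⟩`. -/
structure IsHermitianConnection [FiberBundle ℂ L] [IsManifold (𝓡 n) ∞ N] [VectorBundle ℝ ℂ L]
    (conn : CovariantDerivative (𝓡 n) ℂ L) : Prop where
  smooth : conn.ContMDiffCovariantDerivative ∞
  complex_linear : ∀ (p : N) (σ : ∀ x : N, L x),
    MDifferentiableAt (𝓡 n) ((𝓡 n).prod 𝓘(ℝ, ℂ)) (fun x => TotalSpace.mk' ℂ x (σ x)) p →
    ∀ X : TangentSpace (𝓡 n) p,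
      conn (fun x => Complex.I • σ x) p X = Complex.I • conn σ p X
  hermitian : ∀ (p : N) (σ τ : ∀ x : N, L x),
    MDifferentiableAt (𝓡 n) ((𝓡 n).prod 𝓘(ℝ, ℂ)) (fun x => TotalSpace.mk' ℂ x (σ x)) p →
    MDifferentiableAt (𝓡 n) ((𝓡 n).prod 𝓘(ℝ, ℂ)) (fun x => TotalSpace.mk' ℂ x (τ x)) p →
    ∀ X : TangentSpace (𝓡 n) p,
      mvfderiv (𝓡 n) (fun x => (inner ℂ (σ x) (τ x) : ℂ)) p X
        = inner ℂ (conn σ p X) (τ p) + inner ℂ (σ p) (conn τ p X)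

variable [FiberBundle ℂ L]

/-- The connection `∇` has curvature `-i om`: in the coordinate fields of the preferred chart at any
point `p`, whose brackets vanish,
`∇_{∂_i} ∇_{∂_j} σ - ∇_{∂_j} ∇_{∂_i} σ = -i om(∂_i, ∂_j) σ` at `p`, for every section `σ` which is
smooth near `p`. -/
def HasMagneticCurvature (conn : ConnField n L) (om : FormField n N) : Prop :=
  ∀ (p : N) (σ : ∀ x : N, L x) (i j : Fin n),
    ContMDiffAt (𝓡 n) ((𝓡 n).prod 𝓘(ℝ, ℂ)) ∞ (fun x => TotalSpace.mk' ℂ x (σ x)) p →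
    conn (fun x => conn σ x (coordField p j x)) p (coordField p i p)
        - conn (fun x => conn σ x (coordField p i x)) p (coordField p j p)
      = (-(Complex.I * (om p (coordField p i p) (coordField p j p) : ℂ))) • σ p

variable (L) in
/-- The smooth nowhere vanishing section of `L` on the domain of the preferred local
trivialization at `p` which corresponds to the constant `1`. -/
def frame (p x : N) : L x := (trivializationAt ℂ L p).symm x 1

variable (L) in
/-- Sections (not necessarily smooth) of `L^{⊗k}`. -/
abbrev PowSection (k : ℤ) : Type _ := ∀ x : N, LinePow k (L x)

/-- The connection on `L^{⊗k}` induced by `∇`: for a local nowhere vanishing section `e` of `L`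
with `∇_X e = θ(X) e` one has `∇_X (f e^{⊗k}) = (X f + k θ(X) f) e^{⊗k}`. Here `e` is the preferred
local frame at `p`, and `f` is `x ↦ (s x) (e x)`. -/
def powConn (conn : ConnField n L) {k : ℤ} (s : PowSection L k) (p : N)
    (X : TangentSpace (𝓡 n) p) : LinePow k (L p) :=
  LinePow.ofValue k (frame L p p)
    (mvfderiv (𝓡 n) (fun x => (s x).1 (frame L p x)) p X
      + k * (inner ℂ (frame L p p) (conn (frame L p) p X) / (‖frame L p p‖ : ℂ) ^ 2)
        * (s p).1 (frame L p p))

/-- The Laplacian `Δ = -trace(∇²)` on sections of `L^{⊗k}`, where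
`(∇² s)(X, Y) = ∇_X ∇_Y s - ∇_{∇_X Y} s` with the Levi-Civita connection on vector fields. -/
def bundleLaplacian (g : FormField n N) (conn : ConnField n L) {k : ℤ} (s : PowSection L k) :
    PowSection L k := fun p =>
  -∑ i, ∑ j, (((gram g p p)⁻¹ i j : ℝ) : ℂ) •
    (powConn conn (fun x => powConn conn s x (coordField p j x)) p (coordField p i p)
      - ∑ l, ((christoffel g p l i j p : ℝ) : ℂ) • powConn conn s p (coordField p l p))

/-- The quantum Hamiltonian `-(ħ²/2)(-Δ - R/6)` on sections of `L^{⊗k}`, with `ħ = 1/k`. -/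
def hamiltonian (g : FormField n N) (conn : ConnField n L) {k : ℤ} (s : PowSection L k) :
    PowSection L k := fun p =>
  (-((1 / (k : ℂ)) ^ 2 / 2)) •
    (-bundleLaplacian g conn s p - ((scalarCurvature g p : ℂ) / 6) • s p)

variable (n L) in
/-- The space `C^∞(N, L^{⊗k})` of smooth sections of `L^{⊗k}`: the coefficient with respect to
`e^{⊗k}` is smooth, for each preferred local frame `e` of `L`. -/
def smoothSections (k : ℤ) : Submodule ℂ (PowSection L k) where
  carrier := {s | ∀ p : N, ContMDiffOn (𝓡 n) 𝓘(ℝ, ℂ) ∞ (fun x => (s x).1 (frame L p x))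
    (trivializationAt ℂ L p).baseSet}
  add_mem' := fun hs ht p => (hs p).add (ht p)
  zero_mem' := fun _ => contMDiffOn_const
  smul_mem' := fun c _ hs p =>
    (c • ContinuousLinearMap.id ℝ ℂ).contMDiff.comp_contMDiffOn (hs p)

/-- The eigenspace of the Hamiltonian in `C^∞(N, L^{⊗k})` for the eigenvalue `c`.
(The eigensections already form a subspace, so that taking the span adds nothing.) -/
def eigenspace (g : FormField n N) (conn : ConnField n L) (k : ℤ) (c : ℂ) :
    Submodule ℂ (PowSection L k) :=
  Submodule.span ℂ {s | s ∈ smoothSections n L k ∧ hamiltonian g conn s = c • s}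

/-- The `L²` norm of a section of `L^{⊗k}` with respect to the Riemannian volume. -/
def l2Norm (g : FormField n N) {k : ℤ} (u : PowSection L k) : ℝ≥0∞ :=
  letI : MeasurableSpace N := borel N
  (∫⁻ x, LinePow.fiberNorm (u x) ^ 2 ∂riemannianVolume g) ^ (1 / 2 : ℝ)

/-- Square integrable sections of `L^{⊗k}`: measurable (in local frames) and of finite norm. -/
structure IsL2 (g : FormField n N) {k : ℤ} (u : PowSection L k) : Prop where
  aemeasurable : letI : MeasurableSpace N := borel N
    ∀ p : N, AEMeasurable (fun x => (u x).1 (frame L p x))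
      ((riemannianVolume g).restrict (trivializationAt ℂ L p).baseSet)
  finite : l2Norm g u < ⊤

/-- The Hamiltonian as an unbounded operator `Ĥ_k` on `L²(N, L^{⊗k})`, namely the closure of its
restriction to `C^∞(N, L^{⊗k})`: `u` is in the domain and `Ĥ_k u = h`. -/
structure IsHamiltonianPair (g : FormField n N) (conn : ConnField n L) {k : ℤ}
    (u h : PowSection L k) : Prop where
  left : IsL2 g u
  right : IsL2 g h
  approx : ∃ s : ℕ → PowSection L k, (∀ m, s m ∈ smoothSections n L k) ∧
    Filter.Tendsto (fun m => l2Norm g (s m - u)) Filter.atTop (nhds 0) ∧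
    Filter.Tendsto (fun m => l2Norm g (hamiltonian g conn (s m) - h)) Filter.atTop (nhds 0)

/-- The resolvent set of `Ĥ_k` on `L²(N, L^{⊗k})`: the set of `c` for which `Ĥ_k - c` is a bijection
from its domain onto `L²` (where sections that agree almost everywhere are identified) with
bounded inverse. -/
def resolventSet (g : FormField n N) (conn : ConnField n L) (k : ℤ) : Set ℂ :=
  {c | ∃ C : NNReal, ∀ h : PowSection L k, IsL2 g h →
    ∃ u : PowSection L k, IsHamiltonianPair g conn u (h + c • u) ∧ l2Norm g u ≤ C * l2Norm g h ∧
      ∀ u' : PowSection L k, IsHamiltonianPair g conn u' (h + c • u') → l2Norm g (u' - u) = 0}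

/-- The spectrum of the unbounded operator `Ĥ_k` on `L²(N, L^{⊗k})`. -/
def spectrumL2 (g : FormField n N) (conn : ConnField n L) (k : ℤ) : Set ℂ :=
  (resolventSet g conn k)ᶜ

end LineBundle

universe u v

/-- Quantum equivalence of `(N₁, om₁)` and `(N₂, om₂)` with respect to connections on Hermitian line
bundles `L₁`, `L₂` with curvatures `-i om₁`, `-i om₂`: for every integer `k ≠ 0` the quantum Hamiltonians
`-(ħ²/2)(-Δ - R/6)`, `ħ = 1/k`, on `L₁^{⊗k}` and on `L₂^{⊗k}` have the same spectrum, as unbounded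
operators on `L²`, and all eigenvalues have the same multiplicities. -/
structure QuantumEquivalent {n : ℕ}
    {N₁ : Type u} [TopologicalSpace N₁] [ChartedSpace (EuclideanSpace ℝ (Fin n)) N₁]
    {L₁ : N₁ → Type v} [∀ x, NormedAddCommGroup (L₁ x)] [∀ x, InnerProductSpace ℂ (L₁ x)]
    [TopologicalSpace (TotalSpace ℂ L₁)] [FiberBundle ℂ L₁]
    {N₂ : Type u} [TopologicalSpace N₂] [ChartedSpace (EuclideanSpace ℝ (Fin n)) N₂]
    {L₂ : N₂ → Type v} [∀ x, NormedAddCommGroup (L₂ x)] [∀ x, InnerProductSpace ℂ (L₂ x)]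
    [TopologicalSpace (TotalSpace ℂ L₂)] [FiberBundle ℂ L₂]
    (g₁ om₁ : FormField n N₁) (conn₁ : ConnField n L₁)
    (g₂ om₂ : FormField n N₂) (conn₂ : ConnField n L₂) : Prop where
  curvature₁ : HasMagneticCurvature conn₁ om₁
  curvature₂ : HasMagneticCurvature conn₂ om₂
  spectrum_eq : ∀ k : ℤ, k ≠ 0 → spectrumL2 g₁ conn₁ k = spectrumL2 g₂ conn₂ k
  multiplicity_eq : ∀ k : ℤ, k ≠ 0 → ∀ c : ℂ,
    Module.rank ℂ (eigenspace g₁ conn₁ k c) = Module.rank ℂ (eigenspace g₂ conn₂ k c)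

/-! ### Group actions and quotients -/

section Quotient

variable {n : ℕ} {M : Type*} [TopologicalSpace M] [ChartedSpace (EuclideanSpace ℝ (Fin n)) M]
  {L : M → Type*} [∀ x, NormedAddCommGroup (L x)] [∀ x, InnerProductSpace ℂ (L x)]
  [TopologicalSpace (TotalSpace ℂ L)] [FiberBundle ℂ L]

/-- Two subgroups are almost conjugate if there is a bijection between them which carries each
element to a conjugate element. -/
def AlmostConjugate {G : Type*} [Group G] (Γ₁ Γ₂ : Subgroup G) : Prop :=
  ∃ e : Γ₁ ≃ Γ₂, ∀ γ : Γ₁, IsConj (γ : G) (e γ : G)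

variable (n) in
/-- An action of a group `G` on the Hermitian line bundle `L` by smooth bundle maps which cover the
given action on `M` and are unitary on the fibers. -/
structure BundleAction (G : Type*) [Group G] [MulAction G M] (L : M → Type*)
    [∀ x, NormedAddCommGroup (L x)] [∀ x, InnerProductSpace ℂ (L x)]
    [TopologicalSpace (TotalSpace ℂ L)] [FiberBundle ℂ L] where
  act : ∀ (a : G) (x : M), L x ≃ₗᵢ[ℂ] L (a • x)
  one_act : ∀ (x : M) (v : L x),
    (⟨(1 : G) • x, act 1 x v⟩ : TotalSpace ℂ L) = ⟨x, v⟩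
  mul_act : ∀ (a b : G) (x : M) (v : L x),
    (⟨(a * b) • x, act (a * b) x v⟩ : TotalSpace ℂ L) = ⟨a • b • x, act a (b • x) (act b x v)⟩
  contMDiff_act : ∀ a : G, ContMDiff ((𝓡 n).prod 𝓘(ℝ, ℂ)) ((𝓡 n).prod 𝓘(ℝ, ℂ)) ∞
    (fun w : TotalSpace ℂ L => (⟨a • w.proj, act a w.proj w.2⟩ : TotalSpace ℂ L))

/-- The group `G` acts on the Riemannian manifold `(M, g)` by (smooth) isometries. -/
def ActsByIsometries (G : Type*) [Group G] [MulAction G M] (g : FormField n M) : Prop :=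
  ∀ a : G, ContMDiff (𝓡 n) (𝓡 n) ∞ (fun x : M => a • x) ∧
    ∀ (x : M) (X Y : TangentSpace (𝓡 n) x),
      g (a • x) (mfderiv (𝓡 n) (𝓡 n) (fun x : M => a • x) x X)
        (mfderiv (𝓡 n) (𝓡 n) (fun x : M => a • x) x Y) = g x X Y

instance continuousConstSMul_subgroup {G : Type*} [Group G] [MulAction G M]
    [ContinuousConstSMul G M] (Γ : Subgroup G) : ContinuousConstSMul Γ M :=
  ⟨fun γ => continuous_const_smul (γ : G)⟩

/-- Transport along an equality of base points. -/
def castFiber {x y : M} (h : x = y) : L x ≃ₗᵢ[ℂ] L y :=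
  h ▸ LinearIsometryEquiv.refl ℂ (L x)

theorem mk_castFiber {x y : M} (h : x = y) (v : L x) :
    (⟨y, castFiber h v⟩ : TotalSpace ℂ L) = ⟨x, v⟩ := by
  subst h; rfl

namespace BundleAction

section Basic

variable {G : Type*} [Group G] [MulAction G M] (ρ : BundleAction n G L)

/-- The action of `G` on `L` preserves the connection: if `τ` is the translate of the section `σ`
by `a`, that is `τ (a • y) = a (σ y)`, then `∇_{da X} τ = a (∇_X σ)`. -/
def Preserves (conn : ConnField n L) : Prop :=
  ∀ (a : G) (σ τ : ∀ x : M, L x), (∀ y, τ (a • y) = ρ.act a y (σ y)) →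
    ∀ x : M,
    MDifferentiableAt (𝓡 n) ((𝓡 n).prod 𝓘(ℝ, ℂ)) (fun y => TotalSpace.mk' ℂ y (σ y)) x →
    ∀ X : TangentSpace (𝓡 n) x,
      conn τ (a • x) (mfderiv (𝓡 n) (𝓡 n) (fun y : M => a • y) x X) = ρ.act a x (conn σ x X)

/-- The restriction of the action to a subgroup. -/
def restrict (Γ : Subgroup G) : BundleAction n Γ L where
  act γ x := ρ.act (γ : G) x
  one_act := ρ.one_act
  mul_act γ δ := ρ.mul_act (γ : G) (δ : G)
  contMDiff_act γ := ρ.contMDiff_act (γ : G)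

/-- The action on the total space of `L`. -/
def total (a : G) (w : TotalSpace ℂ L) : TotalSpace ℂ L := ⟨a • w.proj, ρ.act a w.proj w.2⟩

theorem total_one (w : TotalSpace ℂ L) : ρ.total 1 w = w := ρ.one_act w.proj w.2

theorem total_mul (a b : G) (w : TotalSpace ℂ L) :
    ρ.total (a * b) w = ρ.total a (ρ.total b w) := ρ.mul_act a b w.proj w.2

theorem continuous_total (a : G) : Continuous (ρ.total a) := (ρ.contMDiff_act a).continuous

end Basic

variable {Γ : Type*} [Group Γ] [MulAction Γ M] (ρ : BundleAction n Γ L)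

/-- The fiber over `q ∈ Γ \ M` of the quotient bundle `Γ \ L`. For a free action each `Γ`-orbit in
`L` over `q` meets the fiber of `L` over the chosen representative `q.out` in exactly one vector,
and the orbit is represented by this vector. -/
def QuotFiber (_ρ : BundleAction n Γ L) (q : orbitRel.Quotient Γ M) : Type _ := L q.out

instance (q : orbitRel.Quotient Γ M) : NormedAddCommGroup (ρ.QuotFiber q) :=
  inferInstanceAs (NormedAddCommGroup (L q.out))

instance (q : orbitRel.Quotient Γ M) : InnerProductSpace ℂ (ρ.QuotFiber q) :=
  inferInstanceAs (InnerProductSpace ℂ (L q.out))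

theorem exists_smul_eq_out (Γ : Type*) [Group Γ] [MulAction Γ M] (x : M) :
    ∃ γ : Γ, γ • x = (Quotient.mk (orbitRel Γ M) x).out :=
  (orbitRel_apply).1 (Quotient.mk_out (s := orbitRel Γ M) x)

/-- The isometry `L_x → (Γ \ L)_{[x]}` which sends a vector to its orbit. -/
def toQuot (x : M) : L x ≃ₗᵢ[ℂ] ρ.QuotFiber (Quotient.mk (orbitRel Γ M) x) :=
  (ρ.act (exists_smul_eq_out Γ x).choose x).trans
    (castFiber (exists_smul_eq_out Γ x).choose_spec)

/-- The canonical projection `L → Γ \ L`. -/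
def proj (w : TotalSpace ℂ L) : TotalSpace ℂ ρ.QuotFiber :=
  ⟨Quotient.mk (orbitRel Γ M) w.proj, ρ.toQuot w.proj w.2⟩

/-- The representative, over the chosen representative of the base point, of a point
of `Γ \ L`. -/
def rep (w : TotalSpace ℂ ρ.QuotFiber) : TotalSpace ℂ L := ⟨w.proj.out, w.2⟩

theorem rep_proj (w : TotalSpace ℂ L) :
    ρ.rep (ρ.proj w) = ρ.total (exists_smul_eq_out Γ w.proj).choose w :=
  mk_castFiber _ _

theorem rep_injective : Function.Injective ρ.rep := by
  rintro ⟨q, v⟩ ⟨q', v'⟩ h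
  have hq : q = q' := Quotient.out_injective (congrArg TotalSpace.proj h)
  subst hq
  have : v = v' := TotalSpace.mk_injective (F := ℂ) (E := L) q.out h
  rw [this]

/-- The points of `Γ \ L` are the `Γ`-orbits in `L`. -/
theorem proj_eq_iff [IsCancelSMul Γ M] (w w' : TotalSpace ℂ L) :
    ρ.proj w = ρ.proj w' ↔ ∃ γ : Γ, ρ.total γ w = w' := by
  constructor
  · intro h
    have h' := congrArg ρ.rep h
    rw [rep_proj, rep_proj] at h'
    refine ⟨(exists_smul_eq_out Γ w'.proj).choose⁻¹ * (exists_smul_eq_out Γ w.proj).choose, ?_⟩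
    rw [total_mul, h', ← total_mul, inv_mul_cancel, total_one]
  · rintro ⟨γ, rfl⟩
    apply ρ.rep_injective
    rw [rep_proj, rep_proj, ← total_mul]
    congr 1
    apply IsCancelSMul.right_cancel _ _ w.proj
    rw [mul_smul]
    refine (exists_smul_eq_out Γ w.proj).choose_spec.trans ?_
    refine Eq.trans ?_ (exists_smul_eq_out Γ (γ • w.proj)).choose_spec.symm
    congr 1
    exact Quotient.sound (s := orbitRel Γ M) ⟨γ⁻¹, inv_smul_smul γ w.proj⟩

theorem proj_rep [IsCancelSMul Γ M] (w : TotalSpace ℂ ρ.QuotFiber) : ρ.proj (ρ.rep w) = w := by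
  apply ρ.rep_injective
  rw [rep_proj]
  have h : (exists_smul_eq_out Γ (ρ.rep w).proj).choose = 1 := by
    apply IsCancelSMul.right_cancel _ _ (ρ.rep w).proj
    rw [one_smul]
    refine (exists_smul_eq_out Γ (ρ.rep w).proj).choose_spec.trans ?_
    exact congrArg Quotient.out (Quotient.out_eq w.proj)
  rw [h, total_one]

theorem proj_surjective [IsCancelSMul Γ M] : Function.Surjective ρ.proj :=
  fun w => ⟨ρ.rep w, ρ.proj_rep w⟩

open Classical in
/-- The vector in `L_y` whose orbit is the given point of `Γ \ L` over `[y]`. -/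
def lift (y : M) (w : TotalSpace ℂ ρ.QuotFiber) : TotalSpace ℂ L :=
  ρ.total (if h : ∃ γ : Γ, γ • w.proj.out = y then h.choose else 1) (ρ.rep w)

theorem lift_spec {y : M} {w : TotalSpace ℂ ρ.QuotFiber}
    (h : Quotient.mk (orbitRel Γ M) y = w.proj) :
    ∃ γ : Γ, γ • w.proj.out = y ∧ ρ.lift y w = ρ.total γ (ρ.rep w) := by
  have h' : ∃ γ : Γ, γ • w.proj.out = y := by
    rw [← Quotient.out_eq w.proj] at h
    exact orbitRel_apply.1 (Quotient.exact h)
  refine ⟨h'.choose, h'.choose_spec, ?_⟩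
  simp only [lift, h', dif_pos]

theorem lift_base {y : M} {w : TotalSpace ℂ ρ.QuotFiber}
    (h : Quotient.mk (orbitRel Γ M) y = w.proj) : (ρ.lift y w).proj = y := by
  obtain ⟨γ, hγ, h'⟩ := ρ.lift_spec h
  rw [h']
  exact hγ

theorem proj_lift [IsCancelSMul Γ M] {y : M} {w : TotalSpace ℂ ρ.QuotFiber}
    (h : Quotient.mk (orbitRel Γ M) y = w.proj) : ρ.proj (ρ.lift y w) = w := by
  obtain ⟨γ, hγ, h'⟩ := ρ.lift_spec h
  rw [h', ← (ρ.proj_eq_iff (ρ.rep w) _).2 ⟨γ, rfl⟩, proj_rep]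

theorem lift_proj [IsCancelSMul Γ M] (w : TotalSpace ℂ L) : ρ.lift w.proj (ρ.proj w) = w := by
  have h : Quotient.mk (orbitRel Γ M) w.proj = (ρ.proj w).proj := rfl
  obtain ⟨γ, hγ⟩ := (ρ.proj_eq_iff _ _).1 (ρ.proj_lift h)
  have h1 := congrArg TotalSpace.proj hγ
  have h2 : γ = 1 := by
    apply IsCancelSMul.right_cancel _ _ w.proj
    rw [one_smul]
    refine Eq.trans ?_ h1
    change γ • w.proj = γ • (ρ.lift w.proj (ρ.proj w)).proj
    rw [ρ.lift_base h]
  rw [h2, total_one] at hγ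
  exact hγ

section Bundle

variable [T2Space M] [LocallyCompactSpace M] [ContinuousConstSMul Γ M]
  [ProperlyDiscontinuousSMul Γ M] [IsCancelSMul Γ M] [VectorBundle ℂ ℂ L]

theorem isLocalHomeomorph_mk (Γ M : Type*) [Group Γ] [TopologicalSpace M] [MulAction Γ M]
    [T2Space M] [LocallyCompactSpace M] [ContinuousConstSMul Γ M]
    [ProperlyDiscontinuousSMul Γ M] [IsCancelSMul Γ M] :
    IsLocalHomeomorph (Quotient.mk (orbitRel Γ M)) :=
  isQuotientCoveringMap_quotientMk_of_properlyDiscontinuousSMul.isCoveringMap.isLocalHomeomorph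

/-- A local section near `[x₀]`, with value `x₀` at `[x₀]`, of the projection `M → Γ \ M`. -/
def localSection (Γ : Type*) [Group Γ] [MulAction Γ M] [ContinuousConstSMul Γ M]
    [ProperlyDiscontinuousSMul Γ M] [IsCancelSMul Γ M] (x₀ : M) :
    OpenPartialHomeomorph (orbitRel.Quotient Γ M) M :=
  (isLocalHomeomorph_mk Γ M).localInverseAt x₀

theorem mk_localSection {x₀ : M} {q : orbitRel.Quotient Γ M}
    (hq : q ∈ (localSection Γ x₀).source) :
    Quotient.mk (orbitRel Γ M) (localSection Γ x₀ q) = q :=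
  (isLocalHomeomorph_mk Γ M).apply_localInverseAt_of_mem hq

/-- The local trivialization of `Γ \ L` near `[x₀]` obtained from the preferred one of `L` at `x₀`,
through a local section of `M → Γ \ M`. -/
def pretrivialization (x₀ : M) : Pretrivialization ℂ (π ℂ ρ.QuotFiber) where
  toFun w := (w.proj, (trivializationAt ℂ L x₀ (ρ.lift (localSection Γ x₀ w.proj) w)).2)
  invFun y := ρ.proj ((trivializationAt ℂ L x₀).toPartialEquiv.symm (localSection Γ x₀ y.1, y.2))
  baseSet := (localSection Γ x₀).source ∩
    localSection Γ x₀ ⁻¹' (trivializationAt ℂ L x₀).baseSet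
  source := π ℂ ρ.QuotFiber ⁻¹' ((localSection Γ x₀).source ∩
    localSection Γ x₀ ⁻¹' (trivializationAt ℂ L x₀).baseSet)
  target := ((localSection Γ x₀).source ∩
    localSection Γ x₀ ⁻¹' (trivializationAt ℂ L x₀).baseSet) ×ˢ Set.univ
  map_source' w hw := ⟨hw, trivial⟩
  map_target' := by
    rintro ⟨q, z⟩ ⟨hq, -⟩
    have h1 : ((trivializationAt ℂ L x₀).toPartialEquiv.symm
        (localSection Γ x₀ q, z)).proj = localSection Γ x₀ q :=
      (trivializationAt ℂ L x₀).proj_symm_apply' hq.2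
    have h2 : (ρ.proj ((trivializationAt ℂ L x₀).toPartialEquiv.symm
        (localSection Γ x₀ q, z))).proj = q := by
      change Quotient.mk (orbitRel Γ M) _ = q
      rw [h1, mk_localSection hq.1]
    rw [Set.mem_preimage, h2]
    exact hq
  left_inv' := by
    intro w hw
    have hb := mk_localSection hw.1
    have h1 := ρ.lift_base hb
    have h2 : ρ.lift (localSection Γ x₀ w.proj) w ∈ (trivializationAt ℂ L x₀).source := by
      rw [Trivialization.mem_source, h1]
      exact hw.2
    have h3 : ((localSection Γ x₀ w.proj,
        (trivializationAt ℂ L x₀ (ρ.lift (localSection Γ x₀ w.proj) w)).2) : M × ℂ)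
        = trivializationAt ℂ L x₀ (ρ.lift (localSection Γ x₀ w.proj) w) :=
      Prod.ext (by rw [Trivialization.coe_fst _ h2, h1]) rfl
    change ρ.proj ((trivializationAt ℂ L x₀).toPartialEquiv.symm (localSection Γ x₀ w.proj,
        (trivializationAt ℂ L x₀ (ρ.lift (localSection Γ x₀ w.proj) w)).2)) = w
    rw [h3]
    refine Eq.trans (congrArg ρ.proj ?_) (ρ.proj_lift hb)
    exact (trivializationAt ℂ L x₀).toPartialEquiv.left_inv h2
  right_inv' := by
    rintro ⟨q, z⟩ ⟨hq, -⟩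
    have h1 : ((trivializationAt ℂ L x₀).toPartialEquiv.symm
        (localSection Γ x₀ q, z)).proj = localSection Γ x₀ q :=
      (trivializationAt ℂ L x₀).proj_symm_apply' hq.2
    have h2 : (ρ.proj ((trivializationAt ℂ L x₀).toPartialEquiv.symm
        (localSection Γ x₀ q, z))).proj = q := by
      change Quotient.mk (orbitRel Γ M) _ = q
      rw [h1, mk_localSection hq.1]
    refine Prod.ext h2 ?_
    change (trivializationAt ℂ L x₀ (ρ.lift (localSection Γ x₀ (ρ.proj
      ((trivializationAt ℂ L x₀).toPartialEquiv.symm (localSection Γ x₀ q, z))).proj) _)).2 = z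
    rw [h2]
    have h4 := ρ.lift_proj ((trivializationAt ℂ L x₀).toPartialEquiv.symm
      (localSection Γ x₀ q, z))
    rw [h1] at h4
    rw [h4]
    exact congrArg Prod.snd ((trivializationAt ℂ L x₀).toPartialEquiv.right_inv
      ((trivializationAt ℂ L x₀).mem_target (x := (localSection Γ x₀ q, z)) |>.2 hq.2))
  open_target := ((localSection Γ x₀).isOpen_inter_preimage
    (trivializationAt ℂ L x₀).open_baseSet).prod isOpen_univ
  open_baseSet := (localSection Γ x₀).isOpen_inter_preimage
    (trivializationAt ℂ L x₀).open_baseSet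
  source_eq := rfl
  target_eq := rfl
  proj_toFun _ _ := rfl

/-- Two local sections of `M → Γ \ M` differ locally by a fixed element of `Γ`. -/
theorem exists_localSection_smul (x₁ x₂ : M) {q : orbitRel.Quotient Γ M}
    (h₁ : q ∈ (localSection Γ x₁).source) (h₂ : q ∈ (localSection Γ x₂).source) :
    ∃ δ : Γ, ∀ᶠ q' in nhds q, δ • localSection Γ x₂ q' = localSection Γ x₁ q' := by
  obtain ⟨δ, hδ⟩ : ∃ δ : Γ, δ • localSection Γ x₂ q = localSection Γ x₁ q :=
    orbitRel_apply.1 (Quotient.exact ((mk_localSection h₁).trans (mk_localSection h₂).symm))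
  refine ⟨δ, ?_⟩
  have c₁ := (localSection Γ x₁).continuousAt h₁
  have c₂ : ContinuousAt (fun q' => δ • localSection Γ x₂ q') q :=
    ((localSection Γ x₂).continuousAt h₂).const_smul δ
  have hT : (localSection Γ x₁).target ∈ nhds (localSection Γ x₁ q) :=
    (localSection Γ x₁).open_target.mem_nhds ((localSection Γ x₁).map_source h₁)
  have e₂ := c₂.eventually (by rw [hδ]; exact hT :
    (localSection Γ x₁).target ∈ nhds (δ • localSection Γ x₂ q))
  filter_upwards [e₂, (localSection Γ x₁).open_source.mem_nhds h₁,
    (localSection Γ x₂).open_source.mem_nhds h₂] with q' k₂ k₃ k₄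
  refine (isLocalHomeomorph_mk Γ M).injOn_localInverseAt_target k₂
    ((localSection Γ x₁).map_source k₃) ?_
  rw [mk_localSection k₃]
  refine Eq.trans ?_ (mk_localSection k₄)
  exact Quotient.sound (s := orbitRel Γ M) ⟨δ, rfl⟩

theorem mem_baseSet (q : orbitRel.Quotient Γ M) : q ∈ (ρ.pretrivialization q.out).baseSet := by
  have h := (isLocalHomeomorph_mk Γ M).apply_self_mem_localInverseAt_source (x := q.out)
  have h' := (isLocalHomeomorph_mk Γ M).localInverseAt_apply_self (x := q.out)
  rw [Quotient.out_eq] at h h'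
  refine ⟨h, ?_⟩
  change (isLocalHomeomorph_mk Γ M).localInverseAt q.out q ∈
    (trivializationAt ℂ L q.out).baseSet
  rw [h']
  exact FiberBundle.mem_baseSet_trivializationAt' q.out

/-- The local trivializations of the quotient bundle `Γ \ L`. -/
def prebundle : FiberPrebundle ℂ ρ.QuotFiber where
  pretrivializationAtlas := Set.range ρ.pretrivialization
  pretrivializationAt q := ρ.pretrivialization q.out
  mem_base_pretrivializationAt := ρ.mem_baseSet
  pretrivialization_mem_atlas q := ⟨_, rfl⟩
  continuous_trivChange := by
    rintro _ ⟨x₁, rfl⟩ _ ⟨x₂, rfl⟩ ⟨q, z⟩ ⟨⟨hq, -⟩, hq'⟩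
    have h1 : ∀ q' ∈ (localSection Γ x₂).source ∩
        localSection Γ x₂ ⁻¹' (trivializationAt ℂ L x₂).baseSet, ∀ z' : ℂ,
        ((trivializationAt ℂ L x₂).toPartialEquiv.symm (localSection Γ x₂ q', z')).proj
          = localSection Γ x₂ q' := fun q' h z' =>
      (trivializationAt ℂ L x₂).proj_symm_apply' h.2
    have h2 : ∀ q' ∈ (localSection Γ x₂).source ∩
        localSection Γ x₂ ⁻¹' (trivializationAt ℂ L x₂).baseSet, ∀ z' : ℂ,
        (ρ.proj ((trivializationAt ℂ L x₂).toPartialEquiv.symm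
          (localSection Γ x₂ q', z'))).proj = q' := fun q' h z' => by
      change Quotient.mk (orbitRel Γ M) _ = q'
      rw [h1 q' h z', mk_localSection h.1]
    replace hq' : q ∈ (localSection Γ x₁).source ∩
        localSection Γ x₁ ⁻¹' (trivializationAt ℂ L x₁).baseSet := by
      have := hq'
      change (ρ.proj ((trivializationAt ℂ L x₂).toPartialEquiv.symm
          (localSection Γ x₂ q, z))).proj ∈ (localSection Γ x₁).source ∩
        localSection Γ x₁ ⁻¹' (trivializationAt ℂ L x₁).baseSet at this
      rwa [h2 q hq z] at this
    obtain ⟨δ, hδ⟩ := exists_localSection_smul x₁ x₂ hq'.1 hq.1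
    have hS : (localSection Γ x₂).source ∩
        localSection Γ x₂ ⁻¹' (trivializationAt ℂ L x₂).baseSet ∈ nhds q :=
      ((localSection Γ x₂).isOpen_inter_preimage
        (trivializationAt ℂ L x₂).open_baseSet).mem_nhds hq
    have heq : (fun y : orbitRel.Quotient Γ M × ℂ => (y.1, (trivializationAt ℂ L x₁ (ρ.total δ
        ((trivializationAt ℂ L x₂).toPartialEquiv.symm (localSection Γ x₂ y.1, y.2)))).2))
        =ᶠ[nhds (q, z)] (ρ.pretrivialization x₁ ∘
          (ρ.pretrivialization x₂).toPartialEquiv.symm) := by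
      filter_upwards [continuous_fst.continuousAt.eventually hδ,
        continuous_fst.continuousAt.eventually hS] with y hy hyS
      refine Prod.ext (h2 y.1 hyS y.2).symm ?_
      change _ = (trivializationAt ℂ L x₁ (ρ.lift (localSection Γ x₁ (ρ.proj
        ((trivializationAt ℂ L x₂).toPartialEquiv.symm (localSection Γ x₂ y.1, y.2))).proj) _)).2
      rw [h2 y.1 hyS y.2, ← hy]
      have h3 := ρ.lift_proj (ρ.total δ ((trivializationAt ℂ L x₂).toPartialEquiv.symm
        (localSection Γ x₂ y.1, y.2)))
      rw [← (ρ.proj_eq_iff _ _).2 ⟨δ, rfl⟩] at h3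
      have h4 : (ρ.total δ ((trivializationAt ℂ L x₂).toPartialEquiv.symm
          (localSection Γ x₂ y.1, y.2))).proj = δ • localSection Γ x₂ y.1 :=
        congrArg (δ • ·) (h1 y.1 hyS y.2)
      rw [h4] at h3
      exact congrArg (fun w => (trivializationAt ℂ L x₁ w).2) h3.symm
    refine ((ContinuousAt.congr ?_ heq) : ContinuousAt _ (q, z)).continuousWithinAt
    refine continuousAt_fst.prodMk (continuous_snd.continuousAt.comp ?_)
    have c1 : ContinuousAt (fun y : orbitRel.Quotient Γ M × ℂ => (localSection Γ x₂ y.1, y.2))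
        (q, z) :=
      (((localSection Γ x₂).continuousAt hq.1).comp continuousAt_fst).prodMk continuousAt_snd
    have c2 : ContinuousAt (trivializationAt ℂ L x₂).toOpenPartialHomeomorph.symm
        (localSection Γ x₂ q, z) :=
      (trivializationAt ℂ L x₂).toOpenPartialHomeomorph.symm.continuousAt
        ((trivializationAt ℂ L x₂).mem_target (x := (localSection Γ x₂ q, z)) |>.2 hq.2)
    have c3 : ContinuousAt (fun y : orbitRel.Quotient Γ M × ℂ => ρ.total δ
        ((trivializationAt ℂ L x₂).toPartialEquiv.symm (localSection Γ x₂ y.1, y.2))) (q, z) :=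
      (ρ.continuous_total δ).continuousAt.comp
        (ContinuousAt.comp (x := (q, z)) (g := (trivializationAt ℂ L x₂).toPartialEquiv.symm)
          c2 c1)
    have h5 : ρ.total δ ((trivializationAt ℂ L x₂).toPartialEquiv.symm
        (localSection Γ x₂ q, z)) ∈ (trivializationAt ℂ L x₁).source := by
      rw [Trivialization.mem_source]
      change δ • ((trivializationAt ℂ L x₂).toPartialEquiv.symm
        (localSection Γ x₂ q, z)).proj ∈ _
      rw [h1 q hq z, hδ.self_of_nhds]
      exact hq'.2
    exact ContinuousAt.comp (x := (q, z)) (g := trivializationAt ℂ L x₁)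
      ((trivializationAt ℂ L x₁).toOpenPartialHomeomorph.continuousAt h5) c3
  totalSpaceMk_isInducing q := by
    obtain ⟨hq, hq'⟩ : q ∈ (localSection Γ q.out).source ∩
        localSection Γ q.out ⁻¹' (trivializationAt ℂ L q.out).baseSet := ρ.mem_baseSet q
    obtain ⟨γ, hγ⟩ : ∃ γ : Γ, γ • q.out = localSection Γ q.out q :=
      orbitRel_apply.1 (Quotient.exact ((mk_localSection hq).trans (Quotient.out_eq q).symm))
    have hb : γ • q.out ∈ (trivializationAt ℂ L q.out).baseSet := by rw [hγ]; exact hq'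
    have key : (ρ.pretrivialization q.out ∘ TotalSpace.mk q) = (Prod.mk q) ∘
        ((trivializationAt ℂ L q.out).continuousLinearEquivAt ℂ (γ • q.out) hb) ∘
        (ρ.act γ q.out) := by
      funext v
      refine Prod.ext rfl ?_
      change (trivializationAt ℂ L q.out (ρ.lift (localSection Γ q.out q) ⟨q, v⟩)).2
        = (trivializationAt ℂ L q.out (ρ.total γ (ρ.rep ⟨q, v⟩))).2
      obtain ⟨γ', h, h'⟩ := ρ.lift_spec (w := ⟨q, v⟩) (mk_localSection hq)
      have : γ' = γ := IsCancelSMul.right_cancel γ' γ q.out (h.trans hγ.symm)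
      rw [h', this]
    rw [key]
    exact (isEmbedding_prodMkRight q).isInducing.comp
      ((((trivializationAt ℂ L q.out).continuousLinearEquivAt ℂ (γ • q.out)
        hb).toHomeomorph.isInducing).comp (ρ.act γ q.out).toHomeomorph.isInducing)

instance : TopologicalSpace (TotalSpace ℂ ρ.QuotFiber) := ρ.prebundle.totalSpaceTopology

instance : FiberBundle ℂ ρ.QuotFiber := ρ.prebundle.toFiberBundle

end Bundle

/-- The pullback to `M` of a section of `Γ \ L`. -/
def pull (σ : ∀ q, ρ.QuotFiber q) (x : M) : L x :=
  (ρ.toQuot x).symm (σ (Quotient.mk (orbitRel Γ M) x))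

section Induced

variable [T2Space M] [LocallyCompactSpace M] [ContinuousConstSMul Γ M]
  [ProperlyDiscontinuousSMul Γ M] [IsCancelSMul Γ M]

variable (n Γ) in
/-- The inverse of the differential of the projection `M → Γ \ M` at the chosen representative
of `q`. -/
def tangentLift (q : orbitRel.Quotient Γ M) :
    TangentSpace (𝓡 n) q →L[ℝ] TangentSpace (𝓡 n) q.out :=
  cast (congrArg (fun q' : orbitRel.Quotient Γ M =>
      (TangentSpace (𝓡 n) q' →L[ℝ] TangentSpace (𝓡 n) q.out)) (Quotient.out_eq q))
    (mfderiv (𝓡 n) (𝓡 n) (Quotient.mk (orbitRel Γ M)) q.out).inverse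

variable (Γ) in
/-- The metric on `Γ \ M` for which the projection `M → Γ \ M` is a local isometry. -/
def quotMetric (g : FormField n M) : FormField n (orbitRel.Quotient Γ M) := fun q =>
  (ContinuousLinearMap.precomp ℝ (tangentLift n Γ q)).comp ((g q.out).comp (tangentLift n Γ q))

theorem quotMetric_apply (g : FormField n M) (q : orbitRel.Quotient Γ M)
    (X Y : TangentSpace (𝓡 n) q) :
    quotMetric Γ g q X Y = g q.out (tangentLift n Γ q X) (tangentLift n Γ q Y) := rfl

/-- The connection on `Γ \ L` induced by a `Γ`-invariant connection on `L`: covariant derivatives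
of sections of `Γ \ L` are computed by pulling back to `M`. -/
def quotConn (conn : ConnField n L) : ConnField n ρ.QuotFiber := fun σ q =>
  (conn (ρ.pull σ) q.out).comp (tangentLift n Γ q)

end Induced

end BundleAction
end Quotient

end QuantumMagnetic

end

open QuantumMagnetic

open Bundle MulAction MeasureTheory
open scoped Manifold ContDiff ENNReal

noncomputable section

set_option linter.unusedSectionVars false

namespace QuantumMagnetic

set_option maxSynthPendingDepth 3

/-! ### Almost conjugate subgroups and representations -/

section AlmostConjugate

/-! The proof is a transplantation argument. Pulling back along `M → Γⱼ \ M` identifies the sections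
of `Lⱼ^{⊗k}` with the `Γⱼ`-invariant sections of `L^{⊗k}`, and `G` acts linearly on all sections of
`L^{⊗k}`. Let `eⱼ` be the average of the elements of `Γⱼ` in the group algebra `ℂ[G]`. It is an
idempotent which projects every representation onto its `Γⱼ`-invariants. Almost conjugacy says
exactly what is needed for every trace functional on `ℂ[G]` to take the same value at `e₁` and `e₂`.
By Maschke and Wedderburn `ℂ[G]` is a product of matrix algebras, so `e₁` and `e₂` have equal rank
in each block and are equivalent: `e₁ = s t` and `e₂ = t s` with `e₂ t = t`, `e₁ s = s`. Thus `t`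
and `s` act as mutually inverse maps between the `Γ₁`-invariants and the `Γ₂`-invariants of any
representation (`AlmostConjugate.exists_transplantation`).

Applied to sections of `L^{⊗k}`, this gives inverse operators between the sections over the two
quotients. They are finite combinations of isometries of `L`, hence preserve smoothness and
measurability, are bounded for the `L²` norms, and commute with the Hamiltonians. An invertible
bounded intertwiner carries the graph of one closed operator to that of the other, so the resolvent
sets and the dimensions of the eigenspaces agree (`IsIntertwiner.resolventSet_subset`,
`IsIntertwiner.rank_eigenspace_le`). Neither ellipticity nor self-adjointness is needed.

The analytic work is naturality. The Hamiltonian at a point is defined through the chart and frame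
preferred at that point, so its compatibility with isometries is a tensor calculation: the
transformation laws of the Christoffel symbols, the curvature, and the connection form under a
change of frame (`localHamiltonian_of_pullback`). One notion, `IsBundleLocalIsometry`, covers the
identity of `M`, an element of `G`, and the projection to a quotient; `pullPow_hamiltonian` says
that the Hamiltonian commutes with each of these pullbacks. Volumes are compared only up to a finite
constant, obtained from a finite atlas by compactness. This suffices because the definition of the
resolvent set sees the `L²` norm only up to equivalence. -/

/-- Idempotent matrices over a field of characteristic zero with the same trace are
equivalent. -/
theorem exists_equivalence_of_idempotent_of_trace_eq {ι : Type*} [Fintype ι] [DecidableEq ι]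
    {p q : Matrix ι ι ℂ} (hp : p * p = p) (hq : q * q = q) (h : p.trace = q.trace) :
    ∃ t s : Matrix ι ι ℂ, s * t = p ∧ t * s = q ∧ q * t = t ∧ p * s = s := by
  set f : Matrix ι ι ℂ ≃ₐ[ℂ] ((ι → ℂ) →ₗ[ℂ] (ι → ℂ)) := Matrix.toLinAlgEquiv' with hf
  have hP : IsIdempotentElem (f p) := by
    rw [IsIdempotentElem, ← map_mul, hp]
  have hQ : IsIdempotentElem (f q) := by
    rw [IsIdempotentElem, ← map_mul, hq]
  have hP' := LinearMap.IsIdempotentElem.isProj_range _ hP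
  have hQ' := LinearMap.IsIdempotentElem.isProj_range _ hQ
  have htr : ∀ m : Matrix ι ι ℂ, LinearMap.trace ℂ _ (f m) = m.trace := fun m => by
    rw [hf]
    exact Matrix.trace_toLin'_eq m
  -- The trace of a projection is the dimension of its range; characteristic zero turns an equality
  -- in `ℂ` into one in `ℕ`.
  have hrank : Module.finrank ℂ (LinearMap.range (f p)) = Module.finrank ℂ (LinearMap.range (f q)) := by
    have h1 := hP'.trace
    have h2 := hQ'.trace
    rw [htr] at h1 h2
    rw [h1, h2] at h
    exact_mod_cast h
  -- Project to the range of `p`, identify it with the range of `q` by `φ`, and include; `s'` is the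
  -- same with `φ⁻¹`.
  let φ := LinearEquiv.ofFinrankEq _ _ hrank
  let t' : (ι → ℂ) →ₗ[ℂ] (ι → ℂ) :=
    (LinearMap.range (f q)).subtype ∘ₗ φ.toLinearMap ∘ₗ (f p).rangeRestrict
  let s' : (ι → ℂ) →ₗ[ℂ] (ι → ℂ) :=
    (LinearMap.range (f p)).subtype ∘ₗ φ.symm.toLinearMap ∘ₗ (f q).rangeRestrict
  have hp1 : ∀ v : LinearMap.range (f p), (f p).rangeRestrict v = v := fun v =>
    Subtype.ext (hP'.map_id v v.2)
  have hq1 : ∀ v : LinearMap.range (f q), (f q).rangeRestrict v = v := fun v =>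
    Subtype.ext (hQ'.map_id v v.2)
  refine ⟨f.symm t', f.symm s', ?_, ?_, ?_, ?_⟩ <;> apply f.injective <;>
    simp only [map_mul, AlgEquiv.apply_symm_apply] <;> refine LinearMap.ext fun v => ?_
  all_goals rw [Module.End.mul_apply]
  · simp [t', s', hq1]
  · simp [t', s', hp1]
  · exact hQ'.map_id _ (φ _).2
  · exact hP'.map_id _ (φ.symm _).2

/-- In a finite-dimensional semisimple complex algebra, idempotents on which all traces agree are
equivalent. -/
theorem exists_equivalence_of_idempotent {A : Type*} [Ring A] [Algebra ℂ A] [IsSemisimpleRing A]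
    [FiniteDimensional ℂ A] {p q : A} (hp : p * p = p) (hq : q * q = q)
    (h : ∀ φ : A →ₗ[ℂ] ℂ, (∀ x y, φ (x * y) = φ (y * x)) → φ p = φ q) :
    ∃ t s : A, s * t = p ∧ t * s = q ∧ q * t = t ∧ p * s = s := by
  obtain ⟨m, d, -, ⟨f⟩⟩ := IsSemisimpleRing.exists_algEquiv_pi_matrix_of_isAlgClosed ℂ A
  have key : ∀ i, ∃ t s : Matrix (Fin (d i)) (Fin (d i)) ℂ,
      s * t = f p i ∧ t * s = f q i ∧ f q i * t = t ∧ f p i * s = s := by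
    intro i
    apply exists_equivalence_of_idempotent_of_trace_eq
    · rw [← Pi.mul_apply, ← map_mul, hp]
    · rw [← Pi.mul_apply, ← map_mul, hq]
    -- The trace of the `i`-th Wedderburn block is a trace functional on the whole algebra.
    · refine h (Matrix.traceLinearMap _ ℂ ℂ ∘ₗ LinearMap.proj i ∘ₗ f.toLinearMap) fun x y => ?_
      simpa using Matrix.trace_mul_comm _ _
  choose t s h1 h2 h3 h4 using key
  refine ⟨f.symm t, f.symm s, ?_, ?_, ?_, ?_⟩ <;> apply f.injective <;>
    simp only [map_mul, AlgEquiv.apply_symm_apply] <;> ext1 i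
  exacts [h1 i, h2 i, h3 i, h4 i]

variable {G : Type*} [Group G]

/-- The projection in the group algebra onto the invariants of a subgroup. -/
def averageElement (Γ : Subgroup G) [Fintype Γ] : MonoidAlgebra ℂ G :=
  (Fintype.card Γ : ℂ)⁻¹ • ∑ γ : Γ, MonoidAlgebra.of ℂ G (γ : G)

/-- Left multiplication by `γ` permutes the terms of the sum. -/
theorem of_mul_averageElement (Γ : Subgroup G) [Fintype Γ] (γ : Γ) :
    MonoidAlgebra.of ℂ G (γ : G) * averageElement Γ = averageElement Γ := by
  rw [averageElement, mul_smul_comm, Finset.mul_sum]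
  congr 1
  refine Fintype.sum_equiv (Equiv.mulLeft γ) _ _ fun δ => ?_
  rw [← map_mul]
  rfl

theorem averageElement_mul_self (Γ : Subgroup G) [Fintype Γ] :
    averageElement Γ * averageElement Γ = averageElement Γ := by
  conv_lhs => enter [1]; rw [averageElement]
  rw [smul_mul_assoc, Finset.sum_mul]
  simp_rw [of_mul_averageElement]
  rw [Finset.sum_const, Finset.card_univ, ← Nat.cast_smul_eq_nsmul ℂ, smul_smul,
    inv_mul_cancel₀ (by exact_mod_cast Fintype.card_ne_zero), one_smul]

/-- A trace functional restricts to a class function on `G`, so the two sums agree term by term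
along the bijection, which also equates the orders of the subgroups. -/
theorem AlmostConjugate.apply_averageElement {Γ₁ Γ₂ : Subgroup G} [Fintype Γ₁] [Fintype Γ₂]
    (h : AlmostConjugate Γ₁ Γ₂) (φ : MonoidAlgebra ℂ G →ₗ[ℂ] ℂ)
    (hφ : ∀ x y, φ (x * y) = φ (y * x)) :
    φ (averageElement Γ₁) = φ (averageElement Γ₂) := by
  obtain ⟨e, he⟩ := h
  rw [averageElement, averageElement, map_smul, map_smul, Fintype.card_congr e, map_sum, map_sum]
  congr 1
  refine Fintype.sum_equiv e _ _ fun γ => ?_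
  obtain ⟨c, hc⟩ := isConj_iff.1 (he γ)
  rw [← hc, map_mul (MonoidAlgebra.of ℂ G), hφ, ← map_mul, ← mul_assoc, inv_mul_cancel, one_mul]

/-- For almost conjugate subgroups `Γ₁` and `Γ₂` of a finite group `G`, there are elements of the
group algebra which give mutually inverse isomorphisms between the `Γ₁`-invariants and the
`Γ₂`-invariants of every complex representation of `G`. -/
theorem AlmostConjugate.exists_transplantation [Finite G] {Γ₁ Γ₂ : Subgroup G}
    (h : AlmostConjugate Γ₁ Γ₂) :
    ∃ t s : MonoidAlgebra ℂ G, ∀ {W : Type*} [AddCommGroup W] [Module ℂ W]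
      (R : Representation ℂ G W),
      (∀ w (γ : Γ₂), R γ (R.asAlgebraHom t w) = R.asAlgebraHom t w) ∧
      (∀ w (γ : Γ₁), R γ (R.asAlgebraHom s w) = R.asAlgebraHom s w) ∧
      (∀ w, (∀ γ : Γ₁, R γ w = w) → R.asAlgebraHom s (R.asAlgebraHom t w) = w) ∧
      (∀ w, (∀ γ : Γ₂, R γ w = w) → R.asAlgebraHom t (R.asAlgebraHom s w) = w) := by
  have : Fintype Γ₁ := Fintype.ofFinite _
  have : Fintype Γ₂ := Fintype.ofFinite _
  have : FiniteDimensional ℂ (MonoidAlgebra ℂ G) := inferInstance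
  -- The hypothesis of Maschke's theorem, which makes the group algebra semisimple.
  have : NeZero (Nat.card G : ℂ) := ⟨by exact_mod_cast Nat.card_pos.ne'⟩
  obtain ⟨t, s, h1, h2, h3, h4⟩ := exists_equivalence_of_idempotent (averageElement_mul_self Γ₁)
    (averageElement_mul_self Γ₂) h.apply_averageElement
  -- The elements `t` and `s` are fixed before the representation is chosen, so the section spaces
  -- may be infinite-dimensional.
  refine ⟨t, s, fun {W} _ _ R => ?_⟩
  have inv : ∀ (Γ : Subgroup G) [Fintype Γ] (x : MonoidAlgebra ℂ G), averageElement Γ * x = x →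
      ∀ w (γ : Γ), R γ (R.asAlgebraHom x w) = R.asAlgebraHom x w := by
    intro Γ _ x hx w γ
    rw [← R.asAlgebraHom_of, ← Module.End.mul_apply, ← map_mul, ← hx, ← mul_assoc,
      of_mul_averageElement]
  have fix : ∀ (Γ : Subgroup G) [Fintype Γ] w, (∀ γ : Γ, R γ w = w) →
      R.asAlgebraHom (averageElement Γ) w = w := by
    intro Γ _ w hw
    rw [averageElement, map_smul, map_sum, LinearMap.smul_apply, LinearMap.sum_apply]
    simp_rw [R.asAlgebraHom_of, hw]
    rw [Finset.sum_const, Finset.card_univ, ← Nat.cast_smul_eq_nsmul ℂ, smul_smul,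
      inv_mul_cancel₀ (by exact_mod_cast Fintype.card_ne_zero), one_smul]
  refine ⟨inv Γ₂ t h3, inv Γ₁ s h4, fun w hw => ?_, fun w hw => ?_⟩
  · rw [← Module.End.mul_apply, ← map_mul, h1, fix Γ₁ w hw]
  · rw [← Module.End.mul_apply, ← map_mul, h2, fix Γ₂ w hw]

end AlmostConjugate

/-! ### Change of variables in Riemannian geometry on a vector space -/

section EuclideanGeometry

open Filter Topology

variable {E : Type*} [NormedAddCommGroup E] [NormedSpace ℝ E]

/-- A symmetric positive definite bilinear form. -/
structure IsMetricForm (B : E →L[ℝ] E →L[ℝ] ℝ) : Prop where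
  symm : ∀ (u v : E), B u v = B v u
  pos : ∀ (u : E), u ≠ 0 → 0 < B u u

theorem IsMetricForm.bilinearComp {B : E →L[ℝ] E →L[ℝ] ℝ} (hB : IsMetricForm B) {P : E →L[ℝ] E}
    (hP : Function.Injective P) : IsMetricForm (B.bilinearComp P P) where
  symm _ _ := hB.symm _ _
  pos _ hu := hB.pos _ fun h => hu (hP (h.trans (map_zero P).symm))

theorem IsMetricForm.ext {B : E →L[ℝ] E →L[ℝ] ℝ} (hB : IsMetricForm B) {u v : E}
    (h : ∀ w, B u w = B v w) : u = v := by
  by_contra hne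
  have h1 := hB.pos (u - v) (sub_ne_zero.2 hne)
  have h2 : B (u - v) (u - v) = 0 := by
    rw [map_sub B, sub_apply, h, sub_self]
  exact h1.ne' h2

/-- Nondegeneracy makes `E → E*` injective, and both spaces have the same finite dimension. This
allows the index of the Koszul expression to be raised without a basis. -/
theorem IsMetricForm.isInvertible [FiniteDimensional ℝ E] {B : E →L[ℝ] E →L[ℝ] ℝ}
    (hB : IsMetricForm B) : B.IsInvertible := by
  have hinj : Function.Injective B.toLinearMap := fun u v h =>
    hB.ext fun w => DFunLike.congr_fun h w
  have hdim : Module.finrank ℝ E = Module.finrank ℝ (E →L[ℝ] ℝ) := by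
    rw [← (LinearMap.toContinuousLinearMap (𝕜 := ℝ) (E := E) (F' := ℝ)).finrank_eq]
    exact (Subspace.dual_finrank_eq).symm
  exact ⟨(LinearEquiv.ofInjectiveOfFinrankEq B.toLinearMap hinj hdim).toContinuousLinearEquiv,
    by ext; rfl⟩

/-- The Koszul expression `½ (D_u g(v, w) + D_v g(u, w) - D_w g(u, v))`. -/
def koszul (G : E → E →L[ℝ] E →L[ℝ] ℝ) (y : E) : E →L[ℝ] E →L[ℝ] E →L[ℝ] ℝ :=
  (1 / 2 : ℝ) • (fderiv ℝ G y + (fderiv ℝ G y).flip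
    - ((ContinuousLinearMap.flipₗᵢ ℝ E E ℝ).toContinuousLinearEquiv.toContinuousLinearMap).comp
        (fderiv ℝ G y).flip)

theorem koszul_apply (G : E → E →L[ℝ] E →L[ℝ] ℝ) (y u v w : E) :
    koszul G y u v w
      = 1 / 2 * (fderiv ℝ G y u v w + fderiv ℝ G y v u w - fderiv ℝ G y w u v) := rfl

/-- The bilinear form of the Christoffel symbols. -/
def christoffelForm (G : E → E →L[ℝ] E →L[ℝ] ℝ) (y : E) : E →L[ℝ] E →L[ℝ] E :=
  (ContinuousLinearMap.compL ℝ E (E →L[ℝ] ℝ) E (G y).inverse).comp (koszul G y)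

theorem apply_christoffelForm [FiniteDimensional ℝ E] {G : E → E →L[ℝ] E →L[ℝ] ℝ} {y : E}
    (hG : IsMetricForm (G y)) (u v w : E) :
    G y (christoffelForm G y u v) w = koszul G y u v w :=
  DFunLike.congr_fun (hG.isInvertible.self_apply_inverse (koszul G y u v)) w

theorem contDiffAt_christoffelForm [FiniteDimensional ℝ E] {G : E → E →L[ℝ] E →L[ℝ] ℝ} {y : E}
    (hG : IsMetricForm (G y)) {m m' : ℕ∞} (h : ContDiffAt ℝ m' G y) (hm : m + 1 ≤ m') :
    ContDiffAt ℝ m (christoffelForm G) y := by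
  have hm' : (m : WithTop ℕ∞) + 1 ≤ m' := by exact_mod_cast hm
  have : CompleteSpace E := FiniteDimensional.complete ℝ E
  have h1 : ContDiffAt ℝ m (fderiv ℝ G) y := h.fderiv_right hm'
  have h2 : ContDiffAt ℝ m (fun y => (fderiv ℝ G y).flip) y :=
    (ContinuousLinearMap.flipₗᵢ ℝ E E (E →L[ℝ] ℝ)).toContinuousLinearEquiv.contDiff.contDiffAt.comp
      y h1
  have h3 : ContDiffAt ℝ m (fun y => (G y).inverse) y :=
    ContDiffAt.comp y hG.isInvertible.contDiffAt_map_inverse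
      (h.of_le (le_self_add.trans hm'))
  have h4 : ContDiffAt ℝ m (koszul G) y :=
    ((h1.add h2).sub (contDiffAt_const.clm_comp h2)).const_smul (1 / 2 : ℝ)
  exact ((ContinuousLinearMap.compL ℝ E (E →L[ℝ] ℝ) E).contDiff.contDiffAt.comp y h3).clm_comp h4

/-- Torsion-freeness: derivatives of a symmetric form are symmetric, hence so is the Koszul
expression in its first two slots. The metric must be symmetric near `y`, not only at `y`, since it
is differentiated. -/
theorem christoffelForm_symm {G : E → E →L[ℝ] E →L[ℝ] ℝ} {y : E}
    (hG : ∀ᶠ z in 𝓝 y, IsMetricForm (G z)) (hd : DifferentiableAt ℝ G y) (u v : E) :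
    christoffelForm G y u v = christoffelForm G y v u := by
  have key : ∀ a b c, fderiv ℝ G y a b c = fderiv ℝ G y a c b := by
    intro a b c
    have h : ∀ b c, fderiv ℝ (fun z => G z b c) y a = fderiv ℝ G y a b c := fun b c => by
      rw [((hd.hasFDerivAt.clm_apply (hasFDerivAt_const b y)).clm_apply
        (hasFDerivAt_const c y)).fderiv]
      simp
    rw [← h, ← h]
    refine congrArg (fun L : E →L[ℝ] ℝ => L a) (Filter.EventuallyEq.fderiv_eq ?_)
    filter_upwards [hG] with z hz
    exact hz.symm b c
  have : koszul G y u v = koszul G y v u := by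
    ext w
    rw [koszul_apply, koszul_apply, key w u v]
    ring
  change (G y).inverse (koszul G y u v) = (G y).inverse (koszul G y v u)
  rw [this]

/-- The curvature `R(w, v) u`. -/
def curvatureForm (G : E → E →L[ℝ] E →L[ℝ] ℝ) (y u v : E) : E →L[ℝ] E :=
  ((fderiv ℝ (christoffelForm G) y).flip u).flip v
    - (fderiv ℝ (christoffelForm G) y v u)
    + (christoffelForm G y).flip (christoffelForm G y u v)
    - (christoffelForm G y v).comp (christoffelForm G y u)

theorem curvatureForm_apply (G : E → E →L[ℝ] E →L[ℝ] ℝ) (y u v w : E) :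
    curvatureForm G y u v w = fderiv ℝ (christoffelForm G) y w u v
      - fderiv ℝ (christoffelForm G) y v u w
      + christoffelForm G y w (christoffelForm G y u v)
      - christoffelForm G y v (christoffelForm G y u w) := rfl

/-! ### Transformation laws under a local diffeomorphism. -/

section ChangeOfVariables

variable [FiniteDimensional ℝ E] {G₁ G₂ : E → E →L[ℝ] E →L[ℝ] ℝ} {φ : E → E} {y : E}

/-- The product rule for `g₁ = g₂(φ)(dφ ·, dφ ·)`, with one term for each of the three factors. -/
theorem fderiv_bilinearComp_fderiv
    (h : ∀ᶠ z in 𝓝 y, G₁ z = (G₂ (φ z)).bilinearComp (fderiv ℝ φ z) (fderiv ℝ φ z))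
    (hφ : ContDiffAt ℝ 2 φ y) (hG₂ : DifferentiableAt ℝ G₂ (φ y)) (u v w : E) :
    fderiv ℝ G₁ y u v w = fderiv ℝ G₂ (φ y) (fderiv ℝ φ y u) (fderiv ℝ φ y v) (fderiv ℝ φ y w)
      + G₂ (φ y) (fderiv ℝ (fderiv ℝ φ) y u v) (fderiv ℝ φ y w)
      + G₂ (φ y) (fderiv ℝ φ y v) (fderiv ℝ (fderiv ℝ φ) y u w) := by
  have hφ' : DifferentiableAt ℝ φ y := hφ.differentiableAt (by norm_num)
  have hP : HasFDerivAt (fderiv ℝ φ) (fderiv ℝ (fderiv ℝ φ) y) y :=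
    ((hφ.fderiv_right (m := 1) (by norm_num)).differentiableAt (by norm_num)).hasFDerivAt
  have hGφ : HasFDerivAt (fun z => G₂ (φ z)) ((fderiv ℝ G₂ (φ y)).comp (fderiv ℝ φ y)) y :=
    hG₂.hasFDerivAt.comp y hφ'.hasFDerivAt
  have hd : DifferentiableAt ℝ G₁ y := by
    have : DifferentiableAt ℝ
        (fun z => (G₂ (φ z)).bilinearComp (fderiv ℝ φ z) (fderiv ℝ φ z)) y := by
      -- Writing the pullback by compositions of continuous linear maps makes the rules for
      -- differentiating compositions available.
      have e : (fun z => (G₂ (φ z)).bilinearComp (fderiv ℝ φ z) (fderiv ℝ φ z))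
        = fun z => (((ContinuousLinearMap.compL ℝ E E ℝ).flip (fderiv ℝ φ z)).comp
          ((G₂ (φ z)).comp (fderiv ℝ φ z))) := by
        funext z; ext a b; rfl
      rw [e]
      exact ((ContinuousLinearMap.differentiableAt _).comp y hP.differentiableAt).clm_comp
        (hGφ.differentiableAt.clm_comp hP.differentiableAt)
    exact this.congr_of_eventuallyEq h
  have h1 : fderiv ℝ (fun z => G₁ z v w) y u = fderiv ℝ G₁ y u v w := by
    rw [((hd.hasFDerivAt.clm_apply (hasFDerivAt_const v y)).clm_apply
      (hasFDerivAt_const w y)).fderiv]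
    simp
  have h2 : (fun z => G₁ z v w) =ᶠ[𝓝 y] fun z => G₂ (φ z) (fderiv ℝ φ z v) (fderiv ℝ φ z w) := by
    filter_upwards [h] with z hz
    rw [hz]; rfl
  rw [← h1, h2.fderiv_eq, ((hGφ.clm_apply (hP.clm_apply (hasFDerivAt_const v y))).clm_apply
      (hP.clm_apply (hasFDerivAt_const w y))).fderiv]
  simp
  ring

/-- Pair both sides with `dφ w` and expand the Koszul expression of `G₁` by the product rule. Of the
six terms containing `D²φ` four cancel in pairs, by symmetry of `D²φ` and of the metric; the other
two give the inhomogeneous term. -/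
theorem fderiv_christoffelForm_of_pullback
    (h : ∀ᶠ z in 𝓝 y, G₁ z = (G₂ (φ z)).bilinearComp (fderiv ℝ φ z) (fderiv ℝ φ z))
    (hφ : ContDiffAt ℝ 2 φ y) (hP : Function.Injective (fderiv ℝ φ y))
    (hG₂ : DifferentiableAt ℝ G₂ (φ y)) (hm : IsMetricForm (G₂ (φ y))) (u v : E) :
    fderiv ℝ φ y (christoffelForm G₁ y u v)
      = christoffelForm G₂ (φ y) (fderiv ℝ φ y u) (fderiv ℝ φ y v)
        + fderiv ℝ (fderiv ℝ φ) y u v := by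
  have hS : ∀ a b, fderiv ℝ (fderiv ℝ φ) y a b = fderiv ℝ (fderiv ℝ φ) y b a := fun a b =>
    hφ.isSymmSndFDerivAt (by simp) a b
  have hm₁ : IsMetricForm (G₁ y) := by
    rw [h.self_of_nhds]; exact hm.bilinearComp hP
  have hsurj : Function.Surjective (fderiv ℝ φ y) :=
    LinearMap.injective_iff_surjective.1 hP
  apply hm.ext
  intro w'
  obtain ⟨w, rfl⟩ := hsurj w'
  have e1 : G₂ (φ y) (fderiv ℝ φ y (christoffelForm G₁ y u v)) (fderiv ℝ φ y w)
      = koszul G₁ y u v w := by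
    rw [← apply_christoffelForm hm₁, h.self_of_nhds]; rfl
  rw [e1, map_add, add_apply, apply_christoffelForm hm, koszul_apply,
    koszul_apply, fderiv_bilinearComp_fderiv h hφ hG₂, fderiv_bilinearComp_fderiv h hφ hG₂,
    fderiv_bilinearComp_fderiv h hφ hG₂, hS v u, hS w u, hS w v,
    hm.symm _ (fderiv ℝ (fderiv ℝ φ) y u w)]
  ring

/-- Differentiate the transformation law of the Christoffel form and antisymmetrize. The symmetric
third derivative of `φ` drops out, and the terms with second derivatives cancel against those
produced by the quadratic part of the curvature. -/
theorem fderiv_curvatureForm_of_pullback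
    (h : ∀ᶠ z in 𝓝 y, G₁ z = (G₂ (φ z)).bilinearComp (fderiv ℝ φ z) (fderiv ℝ φ z))
    (hφ : ContDiffAt ℝ 4 φ y) (hP : ∀ᶠ z in 𝓝 y, Function.Injective (fderiv ℝ φ z))
    (hG₂ : ContDiffAt ℝ 2 G₂ (φ y)) (hm : ∀ᶠ z in 𝓝 (φ y), IsMetricForm (G₂ z))
    (hC₁ : DifferentiableAt ℝ (christoffelForm G₁) y) (u v w : E) :
    fderiv ℝ φ y (curvatureForm G₁ y u v w)
      = curvatureForm G₂ (φ y) (fderiv ℝ φ y u) (fderiv ℝ φ y v) (fderiv ℝ φ y w) := by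
  have hφ' : DifferentiableAt ℝ φ y := hφ.differentiableAt (by norm_num)
  have hφ3 : ContDiffAt ℝ 3 (fderiv ℝ φ) y := hφ.fderiv_right (by norm_num)
  have hφ2 : ContDiffAt ℝ 2 (fderiv ℝ (fderiv ℝ φ)) y := hφ3.fderiv_right (by norm_num)
  have hPd := (hφ3.differentiableAt (by norm_num)).hasFDerivAt
  have hSd := (hφ2.differentiableAt (by norm_num)).hasFDerivAt
  have hS : ∀ a b, fderiv ℝ (fderiv ℝ φ) y a b = fderiv ℝ (fderiv ℝ φ) y b a := fun a b =>
    hφ.isSymmSndFDerivAt (by simp; norm_num) a b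
  have hT : ∀ a b c, fderiv ℝ (fderiv ℝ (fderiv ℝ φ)) y a b c
      = fderiv ℝ (fderiv ℝ (fderiv ℝ φ)) y b a c := fun a b c =>
    DFunLike.congr_fun (hφ3.isSymmSndFDerivAt (by simp; norm_num) a b) c
  have hS' : ∀ᶠ z in 𝓝 y, ∀ a b, fderiv ℝ (fderiv ℝ φ) z a b = fderiv ℝ (fderiv ℝ φ) z b a := by
    filter_upwards [hφ.eventually (by simp)] with z hz a b
    exact hz.isSymmSndFDerivAt (by simp; norm_num) a b
  have hT' : ∀ a b c, fderiv ℝ (fderiv ℝ (fderiv ℝ φ)) y a b c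
      = fderiv ℝ (fderiv ℝ (fderiv ℝ φ)) y a c b := by
    intro a b c
    have e : ∀ b c, fderiv ℝ (fun z => fderiv ℝ (fderiv ℝ φ) z b c) y a
        = fderiv ℝ (fderiv ℝ (fderiv ℝ φ)) y a b c := fun b c => by
      rw [((hSd.clm_apply (hasFDerivAt_const b y)).clm_apply (hasFDerivAt_const c y)).fderiv]
      simp
    rw [← e, ← e]
    refine congrArg (fun L : E →L[ℝ] E => L a) (Filter.EventuallyEq.fderiv_eq ?_)
    filter_upwards [hS'] with z hz
    exact hz b c
  have hm0 := hm.self_of_nhds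
  have hP0 := hP.self_of_nhds
  have hC : ∀ a b, fderiv ℝ φ y (christoffelForm G₁ y a b)
      = christoffelForm G₂ (φ y) (fderiv ℝ φ y a) (fderiv ℝ φ y b)
        + fderiv ℝ (fderiv ℝ φ) y a b :=
    fderiv_christoffelForm_of_pullback h (hφ.of_le (by norm_num)) hP0
      (hG₂.differentiableAt (by norm_num)) hm0
  -- The law is needed on a neighbourhood because it is differentiated next.
  have hC' : ∀ᶠ z in 𝓝 y, ∀ a b, fderiv ℝ φ z (christoffelForm G₁ z a b)
      = christoffelForm G₂ (φ z) (fderiv ℝ φ z a) (fderiv ℝ φ z b)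
        + fderiv ℝ (fderiv ℝ φ) z a b := by
    filter_upwards [h.eventually_nhds, hφ.eventually (by simp), hP,
      hφ'.continuousAt.eventually (hG₂.eventually (by simp)),
      hφ'.continuousAt.eventually hm] with z h1 h2 h3 h4 h5
    exact fderiv_christoffelForm_of_pullback h1 (h2.of_le (by norm_num)) h3
      (h4.differentiableAt (by norm_num)) h5
  have hC₂ : HasFDerivAt (christoffelForm G₂) (fderiv ℝ (christoffelForm G₂) (φ y)) (φ y) :=
    ((contDiffAt_christoffelForm (m := 1) (m' := 2) hm0 hG₂ (by norm_num)).differentiableAt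
      (by norm_num)).hasFDerivAt
  have hCφ : HasFDerivAt (fun z => christoffelForm G₂ (φ z))
      ((fderiv ℝ (christoffelForm G₂) (φ y)).comp (fderiv ℝ φ y)) y :=
    hC₂.comp y hφ'.hasFDerivAt
  have hD : ∀ a b c, fderiv ℝ (fderiv ℝ φ) y c (christoffelForm G₁ y a b)
        + fderiv ℝ φ y (fderiv ℝ (christoffelForm G₁) y c a b)
      = fderiv ℝ (christoffelForm G₂) (φ y) (fderiv ℝ φ y c) (fderiv ℝ φ y a) (fderiv ℝ φ y b)
        + christoffelForm G₂ (φ y) (fderiv ℝ (fderiv ℝ φ) y c a) (fderiv ℝ φ y b)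
        + christoffelForm G₂ (φ y) (fderiv ℝ φ y a) (fderiv ℝ (fderiv ℝ φ) y c b)
        + fderiv ℝ (fderiv ℝ (fderiv ℝ φ)) y c a b := by
    intro a b c
    have e1 := hPd.clm_apply ((hC₁.hasFDerivAt.clm_apply (hasFDerivAt_const a y)).clm_apply
      (hasFDerivAt_const b y))
    have e2 := ((hCφ.clm_apply (hPd.clm_apply (hasFDerivAt_const a y))).clm_apply
      (hPd.clm_apply (hasFDerivAt_const b y))).add
      ((hSd.clm_apply (hasFDerivAt_const a y)).clm_apply (hasFDerivAt_const b y))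
    have e3 : (fun z => fderiv ℝ φ z (christoffelForm G₁ z a b)) =ᶠ[𝓝 y]
        ((fun z => christoffelForm G₂ (φ z) (fderiv ℝ φ z a) (fderiv ℝ φ z b))
        + fun z => fderiv ℝ (fderiv ℝ φ) z a b) := by
      filter_upwards [hC'] with z hz
      exact hz a b
    have e4 := DFunLike.congr_fun (e1.unique (e2.congr_of_eventuallyEq e3)) c
    simp only [add_apply, ContinuousLinearMap.comp_apply,
      ContinuousLinearMap.flip_apply, zero_apply, map_zero, zero_add] at e4
    rw [add_comm, e4]
    abel
  have hsymm : ∀ a b, christoffelForm G₂ (φ y) a b = christoffelForm G₂ (φ y) b a :=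
    christoffelForm_symm hm (hG₂.differentiableAt (by norm_num))
  -- The two derivative terms of the curvature. The symmetries of `D²φ` and `D³φ` put the third
  -- derivatives in one order, so that they cancel on subtraction.
  have d1 := hD u v w
  have d2 := hD u w v
  rw [hS w u] at d1
  rw [hS v u, hT v u w, hT' u v w, ← hT w u v] at d2
  have d1' := eq_sub_of_add_eq' d1
  have d2' := eq_sub_of_add_eq' d2
  rw [curvatureForm_apply, curvatureForm_apply, map_sub, map_add, map_sub, d1', d2', hC w, hC v,
    hC u v, hC u w, map_add, map_add, hS v w, hsymm _ (fderiv ℝ φ y v),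
    hsymm (fderiv ℝ φ y w) (fderiv ℝ (fderiv ℝ φ) y u v)]
  abel_nf

end ChangeOfVariables

end EuclideanGeometry

/-! ### The Hamiltonian in coordinates -/

section Coordinates

open Filter Topology

variable {n : ℕ}

local notation "E" => EuclideanSpace ℝ (Fin n)
/-- The `j`-th standard basis vector. -/
abbrev stdVec (j : Fin n) : EuclideanSpace ℝ (Fin n) := EuclideanSpace.single j (1 : ℝ)

local notation "e" => stdVec

theorem sum_coord_smul_single (v : E) : v = ∑ l, v l • e l := by
  conv_lhs => rw [← (EuclideanSpace.basisFun (Fin n) ℝ).sum_repr v]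
  simp

/-- The matrix of a bilinear form in the standard basis. -/
def formMatrix (B : E →L[ℝ] E →L[ℝ] ℝ) : Matrix (Fin n) (Fin n) ℝ :=
  Matrix.of fun i j => B (e i) (e j)

/-- The Christoffel symbols of a metric given in coordinates. -/
def localChristoffel (G : E → E →L[ℝ] E →L[ℝ] ℝ) (l i j : Fin n) (y : E) : ℝ :=
  (1 / 2 : ℝ) * ∑ m, (formMatrix (G y))⁻¹ l m *
    (fderiv ℝ (fun z => formMatrix (G z) j m) y (e i)
      + fderiv ℝ (fun z => formMatrix (G z) i m) y (e j)
      - fderiv ℝ (fun z => formMatrix (G z) i j) y (e m))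

/-- The Ricci tensor of a metric given in coordinates. -/
def localRicci (G : E → E →L[ℝ] E →L[ℝ] ℝ) (i j : Fin n) (y : E) : ℝ :=
  ∑ l, (fderiv ℝ (localChristoffel G l i j) y (e l) - fderiv ℝ (localChristoffel G l i l) y (e j)
    + ∑ m, (localChristoffel G l l m y * localChristoffel G m i j y
      - localChristoffel G l j m y * localChristoffel G m i l y))

/-- The scalar curvature of a metric given in coordinates. -/
def localScalarCurvature (G : E → E →L[ℝ] E →L[ℝ] ℝ) (y : E) : ℝ :=
  ∑ i, ∑ j, (formMatrix (G y))⁻¹ i j * localRicci G i j y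

/-- The covariant derivative `df + k f θ` of the coefficient `f` of a section of `L^{⊗k}`. -/
def localCov (k : ℤ) (θ : E → E →L[ℝ] ℂ) (f : E → ℂ) (y : E) : E →L[ℝ] ℂ :=
  fderiv ℝ f y + (k * f y) • θ y

/-- The second covariant derivative in coordinates. -/
def localHessian (k : ℤ) (G : E → E →L[ℝ] E →L[ℝ] ℝ) (θ : E → E →L[ℝ] ℂ) (f : E → ℂ)
    (i j : Fin n) (y : E) : ℂ :=
  fderiv ℝ (fun z => localCov k θ f z (e j)) y (e i) + k * θ y (e i) * localCov k θ f y (e j)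
    - ∑ l, (localChristoffel G l i j y : ℂ) * localCov k θ f y (e l)

/-- The quantum Hamiltonian in coordinates and with respect to a local frame. -/
def localHamiltonian (k : ℤ) (G : E → E →L[ℝ] E →L[ℝ] ℝ) (θ : E → E →L[ℝ] ℂ) (f : E → ℂ)
    (y : E) : ℂ :=
  (-((1 / (k : ℂ)) ^ 2 / 2)) *
    (∑ i, ∑ j, (((formMatrix (G y))⁻¹ i j : ℝ) : ℂ) * localHessian k G θ f i j y
      - ((localScalarCurvature G y : ℂ) / 6) * f y)

theorem formMatrix_mul_apply (B : E →L[ℝ] E →L[ℝ] ℝ) (u : E) (j : Fin n) :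
    B u (e j) = ∑ i, u i * formMatrix B i j := by
  conv_lhs => rw [sum_coord_smul_single u, map_sum, sum_apply]
  simp [formMatrix]

/-- A vector in the kernel of the Gram matrix is orthogonal to everything, hence zero. -/
theorem IsMetricForm.isUnit_det {B : E →L[ℝ] E →L[ℝ] ℝ} (hB : IsMetricForm B) :
    IsUnit (formMatrix B).det := by
  rw [isUnit_iff_ne_zero]
  intro h
  obtain ⟨v, hv, h0⟩ := Matrix.exists_vecMul_eq_zero_iff.2 h
  apply hv
  have : WithLp.toLp 2 v = (0 : E) := hB.ext fun w => by
    rw [sum_coord_smul_single w, map_sum, map_sum]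
    refine Finset.sum_congr rfl fun j _ => ?_
    rw [map_smul, map_smul, formMatrix_mul_apply]
    have := congrFun h0 j
    simp only [Matrix.vecMul, dotProduct, Pi.zero_apply] at this
    simp [this]
  simpa using congrArg WithLp.ofLp this

theorem IsMetricForm.formMatrix_symm {B : E →L[ℝ] E →L[ℝ] ℝ} (hB : IsMetricForm B)
    (i j : Fin n) : formMatrix B i j = formMatrix B j i := hB.symm _ _

theorem fderiv_formMatrix {G : E → E →L[ℝ] E →L[ℝ] ℝ} {y : E} (hG : DifferentiableAt ℝ G y)
    (i j : Fin n) (u : E) :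
    fderiv ℝ (fun z => formMatrix (G z) i j) y u = fderiv ℝ G y u (e i) (e j) := by
  have := ((hG.hasFDerivAt.clm_apply (hasFDerivAt_const (e i) y)).clm_apply
    (hasFDerivAt_const (e j) y)).fderiv
  change fderiv ℝ (fun z => G z (e i) (e j)) y u = _
  rw [this]
  simp

/-- By `apply_christoffelForm` the bracket in the classical formula is, up to the factor `1/2`, the
Gram matrix applied to the coordinates of the Christoffel form, and the inverse matrix undoes this.
-/
theorem localChristoffel_eq {G : E → E →L[ℝ] E →L[ℝ] ℝ} {y : E} (hm : IsMetricForm (G y))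
    (hG : DifferentiableAt ℝ G y) (l i j : Fin n) :
    localChristoffel G l i j y = christoffelForm G y (e i) (e j) l := by
  have h1 : ∀ m, 1 / 2 * (fderiv ℝ (fun z => formMatrix (G z) j m) y (e i)
      + fderiv ℝ (fun z => formMatrix (G z) i m) y (e j)
      - fderiv ℝ (fun z => formMatrix (G z) i j) y (e m))
      = ∑ k, formMatrix (G y) m k * christoffelForm G y (e i) (e j) k := fun m => by
    rw [fderiv_formMatrix hG, fderiv_formMatrix hG, fderiv_formMatrix hG, ← koszul_apply,
      ← apply_christoffelForm hm, formMatrix_mul_apply]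
    refine Finset.sum_congr rfl fun k _ => ?_
    rw [hm.formMatrix_symm k m, mul_comm]
  have h2 : localChristoffel G l i j y
      = ((formMatrix (G y))⁻¹.mulVec
          ((formMatrix (G y)).mulVec fun k => christoffelForm G y (e i) (e j) k)) l := by
    rw [localChristoffel, Finset.mul_sum]
    simp only [Matrix.mulVec, dotProduct]
    refine Finset.sum_congr rfl fun m _ => ?_
    rw [← h1 m]
    ring
  rw [h2, Matrix.mulVec_mulVec, Matrix.nonsing_inv_mul _ hm.isUnit_det, Matrix.one_mulVec]

/-- The Ricci form, as a bilinear form. -/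
def ricciForm (G : E → E →L[ℝ] E →L[ℝ] ℝ) (y : E) : E →ₗ[ℝ] E →ₗ[ℝ] ℝ :=
  LinearMap.mk₂ ℝ (fun u v => LinearMap.trace ℝ E (curvatureForm G y u v).toLinearMap)
    (fun u u' v => by
      rw [← map_add]; congr 1; ext1 w
      simp only [ContinuousLinearMap.coe_coe, LinearMap.add_apply, curvatureForm_apply, map_add,
        add_apply]; abel)
    (fun c u v => by
      rw [← map_smul]; congr 1; ext1 w
      simp only [ContinuousLinearMap.coe_coe, LinearMap.smul_apply, curvatureForm_apply, map_smul,
        smul_apply, smul_add, smul_sub])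
    (fun u v v' => by
      rw [← map_add]; congr 1; ext1 w
      simp only [ContinuousLinearMap.coe_coe, LinearMap.add_apply, curvatureForm_apply, map_add,
        add_apply]; abel)
    (fun c u v => by
      rw [← map_smul]; congr 1; ext1 w
      simp only [ContinuousLinearMap.coe_coe, LinearMap.smul_apply, curvatureForm_apply, map_smul,
        smul_apply, smul_add, smul_sub])

theorem trace_eq_sum_coord (A : E →ₗ[ℝ] E) : LinearMap.trace ℝ E A = ∑ l, A (e l) l := by
  rw [LinearMap.trace_eq_matrix_trace ℝ (EuclideanSpace.basisFun (Fin n) ℝ).toBasis,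
    Matrix.trace]
  simp [LinearMap.toMatrix_apply]

/-- The classical formula is the trace over `w` of `R(w, ∂_j) ∂_i`; expanding the inner Christoffel
vectors in the standard basis matches the quadratic terms. -/
theorem localRicci_eq {G : E → E →L[ℝ] E →L[ℝ] ℝ} {y : E} (hm : ∀ᶠ z in 𝓝 y, IsMetricForm (G z))
    (hG : ContDiffAt ℝ 2 G y) (i j : Fin n) :
    localRicci G i j y = ricciForm G y (e i) (e j) := by
  have hd := hG.differentiableAt (by norm_num)
  have hm0 := hm.self_of_nhds
  have hC : DifferentiableAt ℝ (christoffelForm G) y :=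
    (contDiffAt_christoffelForm (m := 1) (m' := 2) hm0 hG (by norm_num)).differentiableAt
      (by norm_num)
  have h1 : ∀ l i j : Fin n, ∀ w : E, fderiv ℝ (localChristoffel G l i j) y w
      = fderiv ℝ (christoffelForm G) y w (e i) (e j) l := by
    intro l i j w
    have h2 : localChristoffel G l i j =ᶠ[𝓝 y]
        fun z => EuclideanSpace.proj (𝕜 := ℝ) l (christoffelForm G z (e i) (e j)) := by
      filter_upwards [hm, hG.eventually (by simp)] with z hz hz'
      exact localChristoffel_eq hz (hz'.differentiableAt (by norm_num)) l i j
    have h3 := ((EuclideanSpace.proj (𝕜 := ℝ) l).hasFDerivAt.comp y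
      ((hC.hasFDerivAt.clm_apply (hasFDerivAt_const (e i) y)).clm_apply
        (hasFDerivAt_const (e j) y))).congr_of_eventuallyEq h2
    rw [h3.fderiv]
    simp
  have h3 : ∀ u v : E, ∀ l, christoffelForm G y u v l
      = ∑ m, v m * christoffelForm G y u (e m) l := by
    intro u v l
    conv_lhs => rw [sum_coord_smul_single v, map_sum]
    simp
  rw [ricciForm, LinearMap.mk₂_apply, trace_eq_sum_coord, localRicci]
  refine Finset.sum_congr rfl fun l _ => ?_
  rw [h1, h1]
  simp only [localChristoffel_eq hm0 hd, ContinuousLinearMap.coe_coe, curvatureForm_apply,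
    PiLp.add_apply, PiLp.sub_apply]
  rw [h3 (e l) (christoffelForm G y (e i) (e j)), h3 (e j) (christoffelForm G y (e i) (e l)),
    Finset.sum_sub_distrib]
  simp only [mul_comm]
  ring

/-- The trace of a bilinear map with respect to a metric is invariant under linear changes of
variables. -/
theorem sum_inv_formMatrix_smul {F : Type*} [AddCommGroup F] [Module ℝ F]
    {B₁ B₂ : E →L[ℝ] E →L[ℝ] ℝ} {P : E →L[ℝ] E} (hP : Function.Injective P)
    (hB₂ : IsMetricForm B₂) (h : B₁ = B₂.bilinearComp P P) (T : E →ₗ[ℝ] E →ₗ[ℝ] F) :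
    ∑ i, ∑ j, (formMatrix B₁)⁻¹ i j • T (P (e i)) (P (e j))
      = ∑ i, ∑ j, (formMatrix B₂)⁻¹ i j • T (e i) (e j) := by
  set A : Matrix (Fin n) (Fin n) ℝ := Matrix.of fun a i => P (e i) a with hA
  have hPe : ∀ i, P (e i) = ∑ a, A a i • e a := fun i => sum_coord_smul_single _
  have hAB : formMatrix B₁ = A.transpose * formMatrix B₂ * A := by
    ext i j
    rw [h, formMatrix, Matrix.of_apply, ContinuousLinearMap.bilinearComp_apply, hPe j, map_sum,
      Matrix.mul_apply]
    refine Finset.sum_congr rfl fun b _ => ?_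
    rw [map_smul, formMatrix_mul_apply, Matrix.mul_apply, smul_eq_mul, mul_comm]
    rfl
  have hB₁ : IsMetricForm B₁ := h ▸ hB₂.bilinearComp hP
  have hdet : IsUnit A.det := by
    have h1 := hB₁.isUnit_det
    rw [hAB, Matrix.det_mul] at h1
    exact isUnit_of_mul_isUnit_right h1
  -- Inverting `g₁ = Aᵀ g₂ A`: the inverse metric is contravariant, which compensates the two
  -- factors `P` in the arguments of `T`.
  have hinv : A * (formMatrix B₁)⁻¹ * A.transpose = (formMatrix B₂)⁻¹ := by
    have hdet' : IsUnit A.transpose.det := by rwa [Matrix.det_transpose]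
    rw [hAB, Matrix.mul_inv_rev, Matrix.mul_inv_rev, ← Matrix.mul_assoc,
      Matrix.mul_nonsing_inv _ hdet, Matrix.one_mul, Matrix.mul_assoc,
      Matrix.nonsing_inv_mul _ hdet', Matrix.mul_one]
  have e1 : ∀ i j, T (P (e i)) (P (e j)) = ∑ a, ∑ b, (A a i * A b j) • T (e a) (e b) := by
    intro i j
    rw [hPe i, hPe j]
    simp only [map_sum, LinearMap.sum_apply, map_smul, LinearMap.smul_apply, smul_smul,
      Finset.smul_sum]
    rw [Finset.sum_comm]
    simp only [mul_comm]
  calc ∑ i, ∑ j, (formMatrix B₁)⁻¹ i j • T (P (e i)) (P (e j))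
      = ∑ i, ∑ j, ∑ a, ∑ b, (A a i * (formMatrix B₁)⁻¹ i j * A b j) • T (e a) (e b) := by
        simp only [e1, Finset.smul_sum, smul_smul]
        refine Finset.sum_congr rfl fun i _ => Finset.sum_congr rfl fun j _ =>
          Finset.sum_congr rfl fun a _ => Finset.sum_congr rfl fun b _ => ?_
        congr 1; ring
    _ = ∑ a, ∑ b, ∑ j, ∑ i, (A a i * (formMatrix B₁)⁻¹ i j * A b j) • T (e a) (e b) := by
        rw [Finset.sum_comm]
        simp_rw [Finset.sum_comm (s := Finset.univ (α := Fin n)) (t := Finset.univ (α := Fin n))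
          (f := fun i a => ∑ b, (A a i * (formMatrix B₁)⁻¹ i _ * A b _) • T (e a) (e b))]
        rw [Finset.sum_comm]
        refine Finset.sum_congr rfl fun a _ => ?_
        simp_rw [Finset.sum_comm (s := Finset.univ (α := Fin n)) (t := Finset.univ (α := Fin n))
          (f := fun i b => (A a i * (formMatrix B₁)⁻¹ i _ * A b _) • T (e a) (e b))]
        rw [Finset.sum_comm]
    _ = ∑ a, ∑ b, (formMatrix B₂)⁻¹ a b • T (e a) (e b) := by
        refine Finset.sum_congr rfl fun a _ => Finset.sum_congr rfl fun b _ => ?_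
        rw [← hinv, Matrix.mul_apply, Finset.sum_smul]
        refine Finset.sum_congr rfl fun j _ => ?_
        rw [Matrix.mul_apply, Finset.sum_mul, Finset.sum_smul]
        rfl

end Coordinates

/-! ### Invariance of the Hamiltonian in coordinates -/

section Invariance

open Filter Topology

variable {n : ℕ}

local notation "E" => EuclideanSpace ℝ (Fin n)
local notation "e" => stdVec

/-- The curvature endomorphisms are conjugate by `dφ`, so their traces agree and the Ricci form is
pulled back; its metric trace is then invariant. -/
theorem localScalarCurvature_of_pullback {G₁ G₂ : E → E →L[ℝ] E →L[ℝ] ℝ} {φ : E → E} {y : E}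
    (h : ∀ᶠ z in 𝓝 y, G₁ z = (G₂ (φ z)).bilinearComp (fderiv ℝ φ z) (fderiv ℝ φ z))
    (hφ : ContDiffAt ℝ 4 φ y) (hP : ∀ᶠ z in 𝓝 y, Function.Injective (fderiv ℝ φ z))
    (hG₂ : ContDiffAt ℝ 2 G₂ (φ y)) (hm : ∀ᶠ z in 𝓝 (φ y), IsMetricForm (G₂ z)) :
    localScalarCurvature G₁ y = localScalarCurvature G₂ (φ y) := by
  have hφc : ContinuousAt φ y := hφ.continuousAt
  have hm₁ : ∀ᶠ z in 𝓝 y, IsMetricForm (G₁ z) := by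
    filter_upwards [h, hP, hφc.eventually hm] with z h1 h2 h3
    rw [h1]; exact h3.bilinearComp h2
  have hG₁ : ContDiffAt ℝ 2 G₁ y := by
    have hP2 : ContDiffAt ℝ 2 (fderiv ℝ φ) y := hφ.fderiv_right (by norm_num)
    have hGφ : ContDiffAt ℝ 2 (fun z => G₂ (φ z)) y := hG₂.comp y (hφ.of_le (by norm_num))
    have : ContDiffAt ℝ 2 (fun z => (((ContinuousLinearMap.compL ℝ E E ℝ).flip
        (fderiv ℝ φ z)).comp ((G₂ (φ z)).comp (fderiv ℝ φ z)))) y :=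
      ((ContinuousLinearMap.contDiff _).contDiffAt.comp y hP2).clm_comp (hGφ.clm_comp hP2)
    refine this.congr_of_eventuallyEq ?_
    filter_upwards [h] with z hz
    rw [hz]; ext a b; rfl
  have hC₁ : DifferentiableAt ℝ (christoffelForm G₁) y :=
    (contDiffAt_christoffelForm (m := 1) (m' := 2) hm₁.self_of_nhds hG₁
      (by norm_num)).differentiableAt (by norm_num)
  have hQ := fderiv_curvatureForm_of_pullback h hφ hP hG₂ hm hC₁
  have hinj := hP.self_of_nhds
  have hRic : ∀ i j, localRicci G₁ i j y
      = ricciForm G₂ (φ y) (fderiv ℝ φ y (e i)) (fderiv ℝ φ y (e j)) := by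
    intro i j
    rw [localRicci_eq hm₁ hG₁, ricciForm, ricciForm, LinearMap.mk₂_apply, LinearMap.mk₂_apply]
    -- The differential as a linear automorphism, by which the trace can be conjugated.
    let P : E ≃ₗ[ℝ] E := LinearEquiv.ofInjectiveEndo (fderiv ℝ φ y).toLinearMap hinj
    rw [← LinearMap.trace_conj' _ P]
    congr 1
    ext1 w
    obtain ⟨w, rfl⟩ := P.surjective w
    rw [LinearEquiv.conj_apply]
    simp only [LinearMap.comp_apply, LinearEquiv.coe_coe, LinearEquiv.symm_apply_apply]
    exact hQ (e i) (e j) w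
  rw [localScalarCurvature, localScalarCurvature]
  simp only [hRic, localRicci_eq hm hG₂]
  exact sum_inv_formMatrix_smul hinj hm.self_of_nhds h.self_of_nhds (ricciForm G₂ (φ y))

/-- The second covariant derivative, as a bilinear map. -/
def hessianForm (k : ℤ) (G : E → E →L[ℝ] E →L[ℝ] ℝ) (θ : E → E →L[ℝ] ℂ) (f : E → ℂ) (y : E) :
    E →ₗ[ℝ] E →ₗ[ℝ] ℂ :=
  LinearMap.mk₂ ℝ (fun u v => fderiv ℝ (localCov k θ f) y u v + k * θ y u * localCov k θ f y v
      - localCov k θ f y (christoffelForm G y u v))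
    (fun u u' v => by simp only [map_add, add_apply]; ring)
    (fun c u v => by
      simp only [map_smul, smul_apply, Complex.real_smul]; ring)
    (fun u v v' => by simp only [map_add]; ring)
    (fun c u v => by simp only [map_smul, Complex.real_smul]; ring)

theorem localHessian_eq {k : ℤ} {G : E → E →L[ℝ] E →L[ℝ] ℝ} {θ : E → E →L[ℝ] ℂ} {f : E → ℂ} {y : E}
    (hm : IsMetricForm (G y)) (hG : DifferentiableAt ℝ G y)
    (hα : DifferentiableAt ℝ (localCov k θ f) y) (i j : Fin n) :
    localHessian k G θ f i j y = hessianForm k G θ f y (e i) (e j) := by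
  rw [hessianForm, LinearMap.mk₂_apply, localHessian,
    (hα.hasFDerivAt.clm_apply (hasFDerivAt_const (e j) y)).fderiv]
  congr 1
  · simp
  · conv_rhs => rw [sum_coord_smul_single (christoffelForm G y (e i) (e j)), map_sum]
    refine Finset.sum_congr rfl fun l _ => ?_
    rw [map_smul, localChristoffel_eq hm hG, Complex.real_smul]

theorem differentiableAt_localCov {k : ℤ} {θ : E → E →L[ℝ] ℂ} {f : E → ℂ} {y : E}
    (hf : ContDiffAt ℝ 2 f y) (hθ : DifferentiableAt ℝ θ y) :
    DifferentiableAt ℝ (localCov k θ f) y :=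
  ((hf.fderiv_right (m := 1) (by norm_num)).differentiableAt (by norm_num)).add
    (((hf.differentiableAt (by norm_num)).const_mul _).smul hθ)

/-- The Hamiltonian in coordinates is compatible with changes of coordinates and of the local
frame. -/
theorem localHamiltonian_of_pullback {k : ℤ} {G₁ G₂ : E → E →L[ℝ] E →L[ℝ] ℝ}
    {θ₁ θ₂ : E → E →L[ℝ] ℂ} {f₁ f₂ c : E → ℂ} {φ : E → E} {y : E}
    (h : ∀ᶠ z in 𝓝 y, G₁ z = (G₂ (φ z)).bilinearComp (fderiv ℝ φ z) (fderiv ℝ φ z))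
    (hφ : ContDiffAt ℝ 4 φ y) (hP : ∀ᶠ z in 𝓝 y, Function.Injective (fderiv ℝ φ z))
    (hG₂ : ContDiffAt ℝ 2 G₂ (φ y)) (hm : ∀ᶠ z in 𝓝 (φ y), IsMetricForm (G₂ z))
    (hf₂ : ContDiffAt ℝ 2 f₂ (φ y)) (hθ₂ : DifferentiableAt ℝ θ₂ (φ y))
    (hf : ∀ᶠ z in 𝓝 y, f₁ z = c z * f₂ (φ z)) (hc : ∀ᶠ z in 𝓝 y, DifferentiableAt ℝ c z)
    (hc' : ∀ᶠ z in 𝓝 y, ∀ u, fderiv ℝ c z u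
      = -(k * c z * (θ₁ z u - θ₂ (φ z) (fderiv ℝ φ z u)))) :
    localHamiltonian k G₁ θ₁ f₁ y = c y * localHamiltonian k G₂ θ₂ f₂ (φ y) := by
  have hφc : ContinuousAt φ y := hφ.continuousAt
  have hφ' : DifferentiableAt ℝ φ y := hφ.differentiableAt (by norm_num)
  have hm0 := hm.self_of_nhds
  have hinj := hP.self_of_nhds
  have hPd : HasFDerivAt (fderiv ℝ φ) (fderiv ℝ (fderiv ℝ φ) y) y :=
    ((hφ.fderiv_right (m := 1) (by norm_num)).differentiableAt (by norm_num)).hasFDerivAt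
  have hGd₂ : DifferentiableAt ℝ G₂ (φ y) := hG₂.differentiableAt (by norm_num)
  have hα₂ : DifferentiableAt ℝ (localCov k θ₂ f₂) (φ y) := differentiableAt_localCov hf₂ hθ₂
  -- The condition on `dc` is the transformation law of the connection form of the `k`-th power
  -- under a change of frame. It turns the two connection forms into each other, so the covariant
  -- derivative is pulled back and multiplied by `c`.
  have hα : ∀ᶠ z in 𝓝 y, localCov k θ₁ f₁ z
      = c z • (localCov k θ₂ f₂ (φ z)).comp (fderiv ℝ φ z) := by
    filter_upwards [hf.eventually_nhds, hc, hc', hφ.eventually (by simp),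
      hφc.eventually (hf₂.eventually (by simp))] with z h1 h2 h3 h4 h5
    have h6 := (h2.hasFDerivAt.mul ((h5.differentiableAt (by norm_num)).hasFDerivAt.comp z
      (h4.differentiableAt (by norm_num)).hasFDerivAt)).congr_of_eventuallyEq h1
    ext u
    simp only [localCov, h6.fderiv, h1.self_of_nhds, Function.comp_apply, add_apply, smul_apply,
      ContinuousLinearMap.comp_apply, smul_eq_mul, h3]
    ring
  have hαd := (((hc.self_of_nhds.hasFDerivAt).smul ((hα₂.hasFDerivAt.comp y
    hφ'.hasFDerivAt).clm_comp hPd))).congr_of_eventuallyEq hα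
  have hm₁ : IsMetricForm (G₁ y) := by
    rw [h.self_of_nhds]; exact hm0.bilinearComp hinj
  have hG₁ : DifferentiableAt ℝ G₁ y := by
    have : DifferentiableAt ℝ (fun z => (((ContinuousLinearMap.compL ℝ E E ℝ).flip
        (fderiv ℝ φ z)).comp ((G₂ (φ z)).comp (fderiv ℝ φ z)))) y :=
      ((ContinuousLinearMap.differentiableAt _).comp y hPd.differentiableAt).clm_comp
        ((hGd₂.comp y hφ').clm_comp hPd.differentiableAt)
    refine this.congr_of_eventuallyEq ?_
    filter_upwards [h] with z hz
    rw [hz]; ext a b; rfl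
  -- Differentiating the factor `dφ` produces `D²φ`, which is cancelled by the inhomogeneous term in
  -- the law of the Christoffel symbols. Hence the Hessian is a tensor.
  have hH : ∀ i j, localHessian k G₁ θ₁ f₁ i j y
      = (c y • hessianForm k G₂ θ₂ f₂ (φ y)) (fderiv ℝ φ y (e i)) (fderiv ℝ φ y (e j)) := by
    intro i j
    rw [localHessian_eq hm₁ hG₁ hαd.differentiableAt, hessianForm, LinearMap.mk₂_apply,
      hα.self_of_nhds, hαd.fderiv]
    simp only [LinearMap.smul_apply, hessianForm, LinearMap.mk₂_apply, add_apply, smul_apply,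
      ContinuousLinearMap.comp_apply, ContinuousLinearMap.smulRight_apply, Function.comp_apply,
      ContinuousLinearMap.compL_apply, ContinuousLinearMap.flip_apply, smul_eq_mul,
      hc'.self_of_nhds, fderiv_christoffelForm_of_pullback h (hφ.of_le (by norm_num)) hinj hGd₂ hm0,
      map_add]
    ring
  have hsum : ∑ i, ∑ j, (((formMatrix (G₁ y))⁻¹ i j : ℝ) : ℂ) * localHessian k G₁ θ₁ f₁ i j y
      = c y * ∑ i, ∑ j, (((formMatrix (G₂ (φ y)))⁻¹ i j : ℝ) : ℂ)
        * localHessian k G₂ θ₂ f₂ i j (φ y) := by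
    simp only [hH, localHessian_eq hm0 hGd₂ hα₂]
    have := sum_inv_formMatrix_smul hinj hm0 h.self_of_nhds (c y • hessianForm k G₂ θ₂ f₂ (φ y))
    simp only [Complex.real_smul] at this
    rw [this]
    simp only [LinearMap.smul_apply, smul_eq_mul, Finset.mul_sum]
    refine Finset.sum_congr rfl fun i _ => Finset.sum_congr rfl fun j _ => ?_
    ring
  rw [localHamiltonian, localHamiltonian, hsum, hf.self_of_nhds,
    localScalarCurvature_of_pullback h hφ hP hG₂ hm]
  ring

/-- Regularity cannot be dropped, since `fderiv` is additive only where its arguments are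
differentiable. For the same reason the global Hamiltonian is treated as linear on smooth sections
only. -/
theorem localHamiltonian_add {k : ℤ} {G : E → E →L[ℝ] E →L[ℝ] ℝ} {θ : E → E →L[ℝ] ℂ}
    {f f' : E → ℂ} {y : E} (hf : ContDiffAt ℝ 2 f y) (hf' : ContDiffAt ℝ 2 f' y)
    (hθ : DifferentiableAt ℝ θ y) :
    localHamiltonian k G θ (f + f') y
      = localHamiltonian k G θ f y + localHamiltonian k G θ f' y := by
  have hα : localCov k θ (f + f') =ᶠ[𝓝 y] fun z => localCov k θ f z + localCov k θ f' z := by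
    filter_upwards [hf.eventually (by simp), hf'.eventually (by simp)] with z h1 h2
    rw [localCov, fderiv_add (h1.differentiableAt (by norm_num))
      (h2.differentiableAt (by norm_num)), localCov, localCov, Pi.add_apply, mul_add, add_smul]
    abel
  have hH : ∀ i j, localHessian k G θ (f + f') i j y
      = localHessian k G θ f i j y + localHessian k G θ f' i j y := by
    intro i j
    have h1 : (fun z => localCov k θ (f + f') z (e j)) =ᶠ[𝓝 y]
        fun z => localCov k θ f z (e j) + localCov k θ f' z (e j) := by
      filter_upwards [hα] with z hz
      rw [hz, add_apply]
    have h2 := ((differentiableAt_localCov (k := k) hf hθ).clm_apply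
      (differentiableAt_const (e j)))
    have h3 := ((differentiableAt_localCov (k := k) hf' hθ).clm_apply
      (differentiableAt_const (e j)))
    rw [localHessian, h1.fderiv_eq, fderiv_fun_add h2 h3, hα.self_of_nhds, localHessian,
      localHessian]
    simp only [add_apply, mul_add, Finset.sum_add_distrib]
    ring
  simp only [localHamiltonian, hH, mul_add, Finset.sum_add_distrib, Pi.add_apply]
  ring

theorem localHamiltonian_const_smul {k : ℤ} {G : E → E →L[ℝ] E →L[ℝ] ℝ} {θ : E → E →L[ℝ] ℂ}
    {f : E → ℂ} {y : E} (a : ℂ) (hf : ContDiffAt ℝ 2 f y) (hθ : DifferentiableAt ℝ θ y) :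
    localHamiltonian k G θ (a • f) y = a * localHamiltonian k G θ f y := by
  have hα : localCov k θ (a • f) =ᶠ[𝓝 y] fun z => a • localCov k θ f z := by
    filter_upwards [hf.eventually (by simp)] with z h1
    rw [localCov, fderiv_const_smul (h1.differentiableAt (by norm_num)), localCov,
      Pi.smul_apply, smul_add, smul_smul, smul_eq_mul]
    congr 2
    ring
  have hH : ∀ i j, localHessian k G θ (a • f) i j y = a * localHessian k G θ f i j y := by
    intro i j
    have h1 : (fun z => localCov k θ (a • f) z (e j)) =ᶠ[𝓝 y]
        fun z => a • localCov k θ f z (e j) := by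
      filter_upwards [hα] with z hz
      rw [hz, smul_apply]
    have h2 := ((differentiableAt_localCov (k := k) hf hθ).clm_apply
      (differentiableAt_const (e j)))
    rw [localHessian, h1.fderiv_eq, fderiv_fun_const_smul h2, hα.self_of_nhds, localHessian]
    simp only [smul_apply, smul_eq_mul, mul_sub, Finset.mul_sum, mul_add]
    congr 1
    · ring
    · exact Finset.sum_congr rfl fun l _ => by ring
  simp only [localHamiltonian, hH, Pi.smul_apply, smul_eq_mul]
  simp only [← mul_assoc, mul_comm _ a]
  simp only [mul_assoc, ← Finset.mul_sum]
  ring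

end Invariance

/-! ### Powers of complex lines -/

section LinePowers

namespace LinePow

variable {V W : Type*} [NormedAddCommGroup V] [InnerProductSpace ℂ V]
  [NormedAddCommGroup W] [InnerProductSpace ℂ W] {k : ℤ}

theorem apply_smul (f : LinePow k V) {a : ℂ} (ha : a ≠ 0) (v : V) :
    f.1 (a • v) = a ^ (-k) * f.1 v := f.2.2 a v ha

theorem apply_zero (f : LinePow k V) : f.1 0 = 0 := f.2.1

/-- Homogeneity determines an element from its value at one nonzero vector of the line. Identities
of sections are thereby reduced to identities of coefficients in a frame. -/
theorem ext_of_apply_eq (hV : Module.finrank ℂ V = 1) {f h : LinePow k V} {u : V} (hu : u ≠ 0)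
    (heq : f.1 u = h.1 u) : f = h := by
  refine Subtype.ext (funext fun v => ?_)
  obtain ⟨a, rfl⟩ := exists_smul_eq_of_finrank_eq_one hV hu v
  by_cases ha : a = 0
  · rw [ha, zero_smul, apply_zero, apply_zero]
  · rw [apply_smul _ ha, apply_smul _ ha, heq]

theorem ofValue_apply_self {u : V} (hu : u ≠ 0) (c : ℂ) : (ofValue k u c).1 u = c := by
  have h : (inner ℂ u u : ℂ) / (‖u‖ : ℂ) ^ 2 = 1 := by
    rw [inner_self_eq_norm_sq_to_K]
    exact div_self (pow_ne_zero _ (by simpa using hu))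
  simp only [ofValue, if_neg hu, h, one_zpow, one_mul]

/-- The pullback of an element of the power of a line along an isometry. -/
def comap (k : ℤ) (ψ : V ≃ₗᵢ[ℂ] W) : LinePow k W →ₗ[ℂ] LinePow k V where
  toFun f := ⟨fun v => f.1 (ψ v), by simp [apply_zero], fun a v ha => by
    change f.1 (ψ (a • v)) = _ * f.1 (ψ v)
    rw [map_smul, apply_smul _ ha]⟩
  map_add' _ _ := rfl
  map_smul' _ _ := rfl

theorem comap_apply (ψ : V ≃ₗᵢ[ℂ] W) (f : LinePow k W) (v : V) :
    (comap k ψ f).1 v = f.1 (ψ v) := rfl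

theorem comap_injective (ψ : V ≃ₗᵢ[ℂ] W) : Function.Injective (comap k ψ) := by
  intro f h hfh
  refine Subtype.ext (funext fun w => ?_)
  obtain ⟨v, rfl⟩ := ψ.surjective w
  exact congrFun (congrArg Subtype.val hfh) v

theorem fiberNorm_comap (ψ : V ≃ₗᵢ[ℂ] W) (f : LinePow k W) :
    fiberNorm (comap k ψ f) = fiberNorm f := by
  refine Function.Surjective.iSup_congr ψ ψ.surjective fun v => ?_
  rw [ψ.norm_map]
  rfl

/-- By homogeneity every unit vector gives the same modulus. Expressing it through a vector of
arbitrary length is what makes the norm of a section measurable in a frame that is not normalized.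
-/
theorem fiberNorm_eq (hV : Module.finrank ℂ V = 1) (f : LinePow k V) {u : V} (hu : u ≠ 0) :
    fiberNorm f = ‖f.1 u‖ₑ * ENNReal.ofReal (‖u‖ ^ k) := by
  have hu' : (‖u‖ : ℂ) ≠ 0 := by simpa using hu
  have key : ∀ v : V, ‖v‖ = 1 → ‖f.1 v‖ₑ = ‖f.1 u‖ₑ * ENNReal.ofReal (‖u‖ ^ k) := by
    intro v hv
    obtain ⟨a, rfl⟩ := exists_smul_eq_of_finrank_eq_one hV hu v
    have ha : a ≠ 0 := by
      rintro rfl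
      simp at hv
    have hn : ‖a‖ = ‖u‖⁻¹ := by
      rw [norm_smul] at hv
      exact eq_inv_of_mul_eq_one_left hv
    rw [apply_smul _ ha, enorm_mul, mul_comm]
    congr 1
    rw [← ofReal_norm, norm_zpow, hn, inv_zpow, zpow_neg, inv_inv]
  refine le_antisymm (iSup₂_le fun v hv => (key v hv).le) ?_
  have h1 : ‖((‖u‖ : ℂ)⁻¹ • u)‖ = 1 := by
    rw [norm_smul, norm_inv, Complex.norm_real, norm_norm,
      inv_mul_cancel₀ (norm_ne_zero_iff.2 hu)]
  rw [← key _ h1]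
  exact le_iSup₂ (f := fun (v : V) (_ : ‖v‖ = 1) => ‖f.1 v‖ₑ) _ h1

end LinePow

end LinePowers

/-! ### The Hamiltonian in the preferred charts -/

section Charts

open Filter Topology

variable {n : ℕ} {N : Type*} [TopologicalSpace N] [ChartedSpace (EuclideanSpace ℝ (Fin n)) N]

local notation "E" => EuclideanSpace ℝ (Fin n)
local notation "e" => stdVec

/-- The differential of the inverse of the preferred chart at `p`. -/
def paramDeriv (p : N) (y : EuclideanSpace ℝ (Fin n)) :
    EuclideanSpace ℝ (Fin n) →L[ℝ] TangentSpace (𝓡 n) ((extChartAt (𝓡 n) p).symm y) :=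
  mfderiv 𝓘(ℝ, EuclideanSpace ℝ (Fin n)) (𝓡 n) (extChartAt (𝓡 n) p).symm y

/-- The differential of the inverse of the preferred chart at `p`, as an endomorphism of the
model space. -/
def paramDerivModel (p : N) (y : EuclideanSpace ℝ (Fin n)) :
    EuclideanSpace ℝ (Fin n) →L[ℝ] EuclideanSpace ℝ (Fin n) := paramDeriv p y

/-- The value of a field of bilinear forms at a point, as a form on the model space. -/
def formAt (g : FormField n N) (x : N) :
    EuclideanSpace ℝ (Fin n) →L[ℝ] EuclideanSpace ℝ (Fin n) →L[ℝ] ℝ := g x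

/-- A field of bilinear forms, read in the preferred chart at `p`. -/
def chartForm (g : FormField n N) (p : N) (y : EuclideanSpace ℝ (Fin n)) :
    EuclideanSpace ℝ (Fin n) →L[ℝ] EuclideanSpace ℝ (Fin n) →L[ℝ] ℝ :=
  (formAt g ((extChartAt (𝓡 n) p).symm y)).bilinearComp (paramDerivModel p y)
    (paramDerivModel p y)

theorem chartForm_apply (g : FormField n N) (p : N) (y u v : EuclideanSpace ℝ (Fin n)) :
    chartForm g p y u v
      = g ((extChartAt (𝓡 n) p).symm y) (paramDeriv p y u) (paramDeriv p y v) := rfl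

theorem extChartAt_target_mem_nhds_of_mem (p : N) {y : EuclideanSpace ℝ (Fin n)}
    (hy : y ∈ (extChartAt (𝓡 n) p).target) : (extChartAt (𝓡 n) p).target ∈ 𝓝 y :=
  (isOpen_extChartAt_target p).mem_nhds hy

theorem coordField_symm (p : N) (j : Fin n) {y : EuclideanSpace ℝ (Fin n)}
    (hy : y ∈ (extChartAt (𝓡 n) p).target) :
    coordField p j ((extChartAt (𝓡 n) p).symm y) = paramDeriv p y (e j) := by
  -- The base point occurs in the type of the differential, so the equality is proved for a variable
  -- point and with values in the model space.
  have h : ∀ y', y' = y → (mfderiv 𝓘(ℝ, EuclideanSpace ℝ (Fin n)) (𝓡 n)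
      (extChartAt (𝓡 n) p).symm y' (e j) : EuclideanSpace ℝ (Fin n)) = paramDeriv p y (e j) := by
    rintro _ rfl; rfl
  exact h _ ((extChartAt (𝓡 n) p).right_inv hy)

theorem gram_symm (g : FormField n N) (p : N) {y : EuclideanSpace ℝ (Fin n)}
    (hy : y ∈ (extChartAt (𝓡 n) p).target) :
    gram g p ((extChartAt (𝓡 n) p).symm y) = formMatrix (chartForm g p y) := by
  ext i j
  rw [gram, Matrix.of_apply, coordField_symm p i hy, coordField_symm p j hy]
  rfl

/-! ### Derivatives and curvature read in a chart. -/

section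

variable [IsManifold (𝓡 n) ∞ N] {F : Type*} [NormedAddCommGroup F] [NormedSpace ℝ F]

/-- Directional derivatives in the preferred chart at `p`. No differentiability is needed. -/
theorem mvfderiv_paramDeriv (p : N) {y : EuclideanSpace ℝ (Fin n)}
    (hy : y ∈ (extChartAt (𝓡 n) p).target) (f : N → F) (u : EuclideanSpace ℝ (Fin n)) :
    mvfderiv (𝓡 n) f ((extChartAt (𝓡 n) p).symm y) (paramDeriv p y u)
      = fderiv ℝ (f ∘ (extChartAt (𝓡 n) p).symm) y u := by
  have : IsManifold (𝓡 n) 1 N := IsManifold.of_le (n := ∞) (by simp)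
  have hψ : MDifferentiableAt 𝓘(ℝ, EuclideanSpace ℝ (Fin n)) (𝓡 n) (extChartAt (𝓡 n) p).symm y :=
    (mdifferentiableOn_extChartAt_symm y hy).mdifferentiableAt
      (extChartAt_target_mem_nhds_of_mem p hy)
  by_cases hf : MDifferentiableAt (𝓡 n) 𝓘(ℝ, F) f ((extChartAt (𝓡 n) p).symm y)
  · have h := mfderiv_comp y hf hψ
    rw [mfderiv_eq_fderiv] at h
    rw [h]
    rfl
  -- If `f` is not differentiable, neither is its expression in the chart, and both derivatives take
  -- the default value `0`.
  · have hf' : ¬ DifferentiableAt ℝ (f ∘ (extChartAt (𝓡 n) p).symm) y := by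
      intro hd
      apply hf
      have hs := (extChartAt (𝓡 n) p).map_target hy
      have hκ : MDifferentiableAt (𝓡 n) 𝓘(ℝ, EuclideanSpace ℝ (Fin n)) (extChartAt (𝓡 n) p)
          ((extChartAt (𝓡 n) p).symm y) :=
        mdifferentiableAt_extChartAt (by rwa [extChartAt_source] at hs)
      have hd' : MDifferentiableAt 𝓘(ℝ, EuclideanSpace ℝ (Fin n)) 𝓘(ℝ, F)
          (f ∘ (extChartAt (𝓡 n) p).symm)
          (extChartAt (𝓡 n) p ((extChartAt (𝓡 n) p).symm y)) := by
        rw [(extChartAt (𝓡 n) p).right_inv hy]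
        exact hd.mdifferentiableAt
      refine (hd'.comp _ hκ).congr_of_eventuallyEq ?_
      filter_upwards [(isOpen_extChartAt_source p).mem_nhds hs] with x hx
      simp only [Function.comp_apply, (extChartAt (𝓡 n) p).left_inv hx]
    rw [fderiv_zero_of_not_differentiableAt hf', mvfderiv, mfderiv_zero_of_not_mdifferentiableAt hf]
    exact map_zero (NormedSpace.fromTangentSpace (f ((extChartAt (𝓡 n) p).symm y)))

theorem coordDeriv_symm (p : N) (j : Fin n) {y : EuclideanSpace ℝ (Fin n)}
    (hy : y ∈ (extChartAt (𝓡 n) p).target) (f : N → ℝ) :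
    coordDeriv p j f ((extChartAt (𝓡 n) p).symm y)
      = fderiv ℝ (f ∘ (extChartAt (𝓡 n) p).symm) y (e j) := by
  rw [coordDeriv, coordField_symm p j hy, mvfderiv_paramDeriv p hy]

theorem christoffel_symm (g : FormField n N) (p : N) (l i j : Fin n)
    {y : EuclideanSpace ℝ (Fin n)} (hy : y ∈ (extChartAt (𝓡 n) p).target) :
    christoffel g p l i j ((extChartAt (𝓡 n) p).symm y)
      = localChristoffel (chartForm g p) l i j y := by
  have h : ∀ i j m : Fin n, coordDeriv p m (fun x => gram g p x i j) ((extChartAt (𝓡 n) p).symm y)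
      = fderiv ℝ (fun z => formMatrix (chartForm g p z) i j) y (e m) := by
    intro i j m
    rw [coordDeriv_symm p m hy]
    congr 1
    apply Filter.EventuallyEq.fderiv_eq
    filter_upwards [extChartAt_target_mem_nhds_of_mem p hy] with z hz
    rw [Function.comp_apply, gram_symm g p hz]
  rw [christoffel, localChristoffel]
  simp only [h, gram_symm g p hy]

theorem ricci_eq (g : FormField n N) (p : N) (i j : Fin n) :
    ricci g p i j = localRicci (chartForm g p) i j (extChartAt (𝓡 n) p p) := by
  have hy := mem_extChartAt_target (I := 𝓡 n) p
  have hp : (extChartAt (𝓡 n) p).symm (extChartAt (𝓡 n) p p) = p := extChartAt_to_inv p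
  have h1 : ∀ l i j : Fin n, christoffel g p l i j p
      = localChristoffel (chartForm g p) l i j (extChartAt (𝓡 n) p p) := fun l i j => by
    rw [← christoffel_symm g p l i j hy, hp]
  have h2 : ∀ l i j m : Fin n, coordDeriv p m (christoffel g p l i j) p
      = fderiv ℝ (localChristoffel (chartForm g p) l i j) (extChartAt (𝓡 n) p p) (e m) := by
    intro l i j m
    have h3 := coordDeriv_symm p m hy (christoffel g p l i j)
    rw [hp] at h3
    rw [h3]
    congr 1
    apply Filter.EventuallyEq.fderiv_eq
    filter_upwards [extChartAt_target_mem_nhds_of_mem p hy] with z hz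
    exact christoffel_symm g p l i j hz
  rw [ricci, localRicci]
  simp only [h1, h2]

theorem gram_self (g : FormField n N) (p : N) :
    gram g p p = formMatrix (chartForm g p (extChartAt (𝓡 n) p p)) := by
  rw [← gram_symm g p (mem_extChartAt_target (I := 𝓡 n) p), extChartAt_to_inv]

theorem scalarCurvature_eq (g : FormField n N) (p : N) :
    scalarCurvature g p = localScalarCurvature (chartForm g p) (extChartAt (𝓡 n) p p) := by
  rw [scalarCurvature, localScalarCurvature, gram_self]
  simp only [ricci_eq]

end

/-! ### The Hamiltonian in a chart and a local frame. -/

section Hamiltonian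

variable {L : N → Type*} [∀ x, NormedAddCommGroup (L x)] [∀ x, InnerProductSpace ℂ (L x)]
  [TopologicalSpace (TotalSpace ℂ L)]

/-- The connection form `θ` of a connection with respect to a section `σ`: at points where `σ` does
not vanish, `∇_X σ = θ(X) σ`. -/
def connCoeff (conn : ConnField n L) (σ : ∀ x : N, L x) (x : N) :
    TangentSpace (𝓡 n) x →L[ℝ] ℂ :=
  ((‖σ x‖ : ℂ) ^ 2)⁻¹ • ((innerSL ℂ (σ x)).restrictScalars ℝ).comp (conn σ x)

theorem connCoeff_apply (conn : ConnField n L) (σ : ∀ x : N, L x) (x : N)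
    (X : TangentSpace (𝓡 n) x) :
    connCoeff conn σ x X = inner ℂ (σ x) (conn σ x X) / (‖σ x‖ : ℂ) ^ 2 := by
  rw [div_eq_inv_mul]; rfl

variable [FiberBundle ℂ L]

/-- The connection form with respect to the preferred frame, in the preferred chart at `p`. -/
def chartConn (conn : ConnField n L) (p : N) (y : EuclideanSpace ℝ (Fin n)) :
    EuclideanSpace ℝ (Fin n) →L[ℝ] ℂ :=
  (connCoeff conn (frame L p) ((extChartAt (𝓡 n) p).symm y)).comp (paramDeriv p y)

/-- The coefficient of a section with respect to the preferred frame, in the preferred chart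
at `p`. -/
def chartCoeff {k : ℤ} (s : PowSection L k) (p : N) (y : EuclideanSpace ℝ (Fin n)) : ℂ :=
  (s ((extChartAt (𝓡 n) p).symm y)).1 (frame L p ((extChartAt (𝓡 n) p).symm y))

/-- The Hamiltonian is computed in the preferred chart and frame at `p`, as soon as the
connection can be computed in the preferred frame at `p` near `p`. -/
theorem hamiltonian_apply_frame [IsManifold (𝓡 n) ∞ N] (g : FormField n N) (conn : ConnField n L)
    {k : ℤ} (s : PowSection L k) (p : N) (hp : frame L p p ≠ 0)
    (h : ∀ᶠ x in 𝓝 p, ∀ X, (powConn conn s x X).1 (frame L p x)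
      = mvfderiv (𝓡 n) (fun x' => (s x').1 (frame L p x')) x X
        + k * connCoeff conn (frame L p) x X * (s x).1 (frame L p x)) :
    (hamiltonian g conn s p).1 (frame L p p)
      = localHamiltonian k (chartForm g p) (chartConn conn p) (chartCoeff s p)
          (extChartAt (𝓡 n) p p) := by
  have hy := mem_extChartAt_target (I := 𝓡 n) p
  have hinv : (extChartAt (𝓡 n) p).symm (extChartAt (𝓡 n) p p) = p := extChartAt_to_inv p
  set y₀ := extChartAt (𝓡 n) p p with hy₀
  have hcont : Tendsto (extChartAt (𝓡 n) p).symm (𝓝 y₀) (𝓝 p) := by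
    have := continuousAt_extChartAt_symm (I := 𝓡 n) p
    rwa [ContinuousAt, ← hy₀, hinv] at this
  -- The definition of `powConn` at a nearby point uses the frame preferred there; the hypothesis
  -- `h` refers everything to the single frame at `p`.
  have h1 : ∀ᶠ y in 𝓝 y₀, ∀ u, (powConn conn s ((extChartAt (𝓡 n) p).symm y)
      (paramDeriv p y u)).1 (frame L p ((extChartAt (𝓡 n) p).symm y))
      = localCov k (chartConn conn p) (chartCoeff s p) y u := by
    filter_upwards [hcont.eventually h, extChartAt_target_mem_nhds_of_mem p hy] with y h2 h3 u
    rw [h2, mvfderiv_paramDeriv p h3, localCov, add_apply, smul_apply, smul_eq_mul]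
    change _ + k * chartConn conn p y u * chartCoeff s p y = _
    rw [mul_right_comm]
    rfl
  have h1' : ∀ j : Fin n, (powConn conn s p (coordField p j p)).1 (frame L p p)
      = localCov k (chartConn conn p) (chartCoeff s p) y₀ (e j) := by
    intro j
    have := h1.self_of_nhds (e j)
    rw [← coordField_symm p j hy] at this
    rw [← this, hinv]
  -- At `p` itself the defining frame is the right one, so no regularity of `s'` is required. This
  -- is applied to the first covariant derivatives of `s`.
  have h2 : ∀ (s' : PowSection L k) (i : Fin n),
      (powConn conn s' p (coordField p i p)).1 (frame L p p)
      = fderiv ℝ (chartCoeff s' p) y₀ (e i)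
        + k * chartConn conn p y₀ (e i) * chartCoeff s' p y₀ := by
    intro s' i
    rw [powConn, LinePow.ofValue_apply_self hp, ← connCoeff_apply]
    have h3 := mvfderiv_paramDeriv p hy (fun x' => (s' x').1 (frame L p x')) (e i)
    rw [← coordField_symm p i hy, hinv] at h3
    rw [h3]
    congr 2
    · congr 1
      change _ = connCoeff conn (frame L p) ((extChartAt (𝓡 n) p).symm y₀) (paramDeriv p y₀ (e i))
      rw [← coordField_symm p i hy, hinv]
    · change _ = (s' ((extChartAt (𝓡 n) p).symm y₀)).1 (frame L p ((extChartAt (𝓡 n) p).symm y₀))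
      rw [hinv]
  have h4 : ∀ j, chartCoeff (fun x => powConn conn s x (coordField p j x)) p =ᶠ[𝓝 y₀]
      fun y => localCov k (chartConn conn p) (chartCoeff s p) y (e j) := by
    intro j
    filter_upwards [h1, extChartAt_target_mem_nhds_of_mem p hy] with y h5 h6
    rw [← h5, ← coordField_symm p j h6]
    rfl
  have h5 : ∀ l i j : Fin n, christoffel g p l i j p
      = localChristoffel (chartForm g p) l i j y₀ := fun l i j => by
    rw [← christoffel_symm g p l i j hy, hinv]
  have h6 : (bundleLaplacian g conn s p).1 (frame L p p)
      = -∑ i, ∑ j, (((gram g p p)⁻¹ i j : ℝ) : ℂ)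
        * localHessian k (chartForm g p) (chartConn conn p) (chartCoeff s p) i j y₀ := by
    simp only [bundleLaplacian, Submodule.coe_neg, Submodule.coe_sum, Submodule.coe_smul,
      Submodule.coe_sub, Pi.neg_apply, Finset.sum_apply, Pi.smul_apply, Pi.sub_apply, smul_eq_mul]
    congr 1
    refine Finset.sum_congr rfl fun i _ => Finset.sum_congr rfl fun j _ => ?_
    rw [h2, (h4 j).fderiv_eq, (h4 j).self_of_nhds, localHessian]
    simp only [h1', h5]
  have h7 : (s p).1 (frame L p p) = chartCoeff s p y₀ := by
    rw [chartCoeff, hinv]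
  simp only [hamiltonian, Submodule.coe_neg, Submodule.coe_smul, Submodule.coe_sub, Pi.neg_apply,
    Pi.smul_apply, Pi.sub_apply, smul_eq_mul, h6, h7, neg_neg, scalarCurvature_eq, gram_self,
    localHamiltonian]
  rfl

end Hamiltonian

end Charts

/-! ### Derivatives of scalar functions on a manifold -/

section ScalarFunctions

open Filter Topology

variable {n : ℕ} {N : Type*} [TopologicalSpace N] [ChartedSpace (EuclideanSpace ℝ (Fin n)) N]
  {F : Type*} [NormedAddCommGroup F] [NormedSpace ℝ F]

theorem mdifferentiableAt_iff_comp_symm {f : N → F} {x : N} (hf : ContinuousAt f x) :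
    MDifferentiableAt (𝓡 n) 𝓘(ℝ, F) f x
      ↔ DifferentiableAt ℝ (f ∘ (extChartAt (𝓡 n) x).symm) (extChartAt (𝓡 n) x x) := by
  rw [mdifferentiableAt_iff]
  simp only [hf, true_and]
  rw [show Set.range (𝓡 n) = Set.univ from ModelWithCorners.range_eq_univ _,
    differentiableWithinAt_univ]
  rfl

theorem mvfderiv_eq_fderiv_comp_symm {f : N → F} {x : N}
    (hf : MDifferentiableAt (𝓡 n) 𝓘(ℝ, F) f x) (X : TangentSpace (𝓡 n) x) :
    mvfderiv (𝓡 n) f x X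
      = fderiv ℝ (f ∘ (extChartAt (𝓡 n) x).symm) (extChartAt (𝓡 n) x x) X := by
  have h : mfderiv (𝓡 n) 𝓘(ℝ, F) f x = fderivWithin ℝ (f ∘ (extChartAt (𝓡 n) x).symm)
      (Set.range (𝓡 n)) (extChartAt (𝓡 n) x x) := if_pos hf
  rw [show Set.range (𝓡 n) = Set.univ from ModelWithCorners.range_eq_univ _,
    fderivWithin_univ] at h
  exact congrArg (fun A : EuclideanSpace ℝ (Fin n) →L[ℝ] F => A X) h

theorem mvfderiv_comp_deriv {f : N → ℂ} {x : N} (hf : MDifferentiableAt (𝓡 n) 𝓘(ℝ, ℂ) f x)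
    {φ : ℂ → ℂ} {c : ℂ} (hφ : HasDerivAt φ c (f x)) (X : TangentSpace (𝓡 n) x) :
    mvfderiv (𝓡 n) (fun x => φ (f x)) x X = c * mvfderiv (𝓡 n) f x X := by
  have hd := (mdifferentiableAt_iff_comp_symm hf.continuousAt).1 hf
  have hx : (f ∘ (extChartAt (𝓡 n) x).symm) (extChartAt (𝓡 n) x x) = f x := by
    rw [Function.comp_apply, extChartAt_to_inv]
  have hφ' : HasDerivAt φ c ((f ∘ (extChartAt (𝓡 n) x).symm) (extChartAt (𝓡 n) x x)) := by
    rwa [hx]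
  have h := (hφ'.hasFDerivAt.restrictScalars ℝ).comp _ hd.hasFDerivAt
  have hc : ContinuousAt (fun x => φ (f x)) x := hφ.continuousAt.comp hf.continuousAt
  rw [mvfderiv_eq_fderiv_comp_symm hf, mvfderiv_eq_fderiv_comp_symm
    ((mdifferentiableAt_iff_comp_symm hc).2 h.differentiableAt)]
  refine (congrArg (fun A : EuclideanSpace ℝ (Fin n) →L[ℝ] ℂ => A X) h.fderiv).trans ?_
  exact mul_comm _ c

theorem mvfderiv_mul_complex {f h : N → ℂ} {x : N} (hf : MDifferentiableAt (𝓡 n) 𝓘(ℝ, ℂ) f x)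
    (hh : MDifferentiableAt (𝓡 n) 𝓘(ℝ, ℂ) h x) (X : TangentSpace (𝓡 n) x) :
    mvfderiv (𝓡 n) (fun x => f x * h x) x X
      = f x * mvfderiv (𝓡 n) h x X + mvfderiv (𝓡 n) f x X * h x := by
  have hd := (mdifferentiableAt_iff_comp_symm hf.continuousAt).1 hf
  have hd' := (mdifferentiableAt_iff_comp_symm hh.continuousAt).1 hh
  have hc : ContinuousAt (fun x => f x * h x) x := hf.continuousAt.mul hh.continuousAt
  rw [mvfderiv_eq_fderiv_comp_symm hf, mvfderiv_eq_fderiv_comp_symm hh,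
    mvfderiv_eq_fderiv_comp_symm ((mdifferentiableAt_iff_comp_symm hc).2 (hd.mul hd'))]
  refine (congrArg (fun A : EuclideanSpace ℝ (Fin n) →L[ℝ] ℂ => A X)
    (fderiv_mul hd hd')).trans ?_
  have key : ∀ (a b : ℂ) (A B : EuclideanSpace ℝ (Fin n) →L[ℝ] ℂ) (Y : EuclideanSpace ℝ (Fin n)),
      (a • A + b • B) Y = a * A Y + B Y * b := fun a b A B Y => by
    rw [add_apply, smul_apply, smul_apply, smul_eq_mul, smul_eq_mul, mul_comm b]
  refine (key _ _ _ _ X).trans ?_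
  rw [Function.comp_apply, Function.comp_apply, extChartAt_to_inv]

theorem mvfderiv_congr {f h : N → F} {x : N} (hfh : f =ᶠ[𝓝 x] h) (X : TangentSpace (𝓡 n) x) :
    mvfderiv (𝓡 n) f x X = mvfderiv (𝓡 n) h x X := by
  exact congrArg (fun A : EuclideanSpace ℝ (Fin n) →L[ℝ] F => A X)
    (hfh.mfderiv_eq (I := 𝓡 n) (I' := 𝓘(ℝ, F)))

/-- Serves `conn_smul`, where the Leibniz rule for real functions is extended to complex ones. -/
theorem mvfderiv_re_add_im {f : N → ℂ} {x : N} (hf : MDifferentiableAt (𝓡 n) 𝓘(ℝ, ℂ) f x)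
    (X : TangentSpace (𝓡 n) x) :
    MDifferentiableAt (𝓡 n) 𝓘(ℝ, ℝ) (fun x => (f x).re) x ∧
    MDifferentiableAt (𝓡 n) 𝓘(ℝ, ℝ) (fun x => (f x).im) x ∧
    mvfderiv (𝓡 n) f x X = mvfderiv (𝓡 n) (fun x => (f x).re) x X
      + mvfderiv (𝓡 n) (fun x => (f x).im) x X * Complex.I := by
  have hd := (mdifferentiableAt_iff_comp_symm hf.continuousAt).1 hf
  have hr := (Complex.reCLM.hasFDerivAt).comp _ hd.hasFDerivAt
  have hi := (Complex.imCLM.hasFDerivAt).comp _ hd.hasFDerivAt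
  have h1 := (mdifferentiableAt_iff_comp_symm (f := fun x => (f x).re)
    (Complex.continuous_re.continuousAt.comp hf.continuousAt)).2 hr.differentiableAt
  have h2 := (mdifferentiableAt_iff_comp_symm (f := fun x => (f x).im)
    (Complex.continuous_im.continuousAt.comp hf.continuousAt)).2 hi.differentiableAt
  refine ⟨h1, h2, ?_⟩
  rw [mvfderiv_eq_fderiv_comp_symm hf, mvfderiv_eq_fderiv_comp_symm h1,
    mvfderiv_eq_fderiv_comp_symm h2]
  have e1 := congrArg (fun A : EuclideanSpace ℝ (Fin n) →L[ℝ] ℝ => A X) hr.fderiv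
  have e2 := congrArg (fun A : EuclideanSpace ℝ (Fin n) →L[ℝ] ℝ => A X) hi.fderiv
  refine (Complex.re_add_im _).symm.trans ?_
  congr 2
  · exact e1.symm
  · exact congrArg Complex.ofReal e2.symm

end ScalarFunctions

/-! ### Local frames of a Hermitian line bundle -/

section Frames

open Filter Topology

variable {n : ℕ} {M : Type*} [TopologicalSpace M] [ChartedSpace (EuclideanSpace ℝ (Fin n)) M]
  {L : M → Type*} [∀ x, NormedAddCommGroup (L x)] [∀ x, InnerProductSpace ℂ (L x)]
  [TopologicalSpace (TotalSpace ℂ L)] [FiberBundle ℂ L]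

variable (n) in
/-- The section `σ` of `L` is smooth at `x`. -/
abbrev SmoothAt (σ : ∀ x : M, L x) (x : M) : Prop :=
  ContMDiffAt (𝓡 n) ((𝓡 n).prod 𝓘(ℝ, ℂ)) ∞ (fun x => TotalSpace.mk' ℂ x (σ x)) x

section Fibers

variable [VectorBundle ℂ ℂ L]

theorem finrank_fiber (x : M) : Module.finrank ℂ (L x) = 1 := by
  rw [((trivializationAt ℂ L x).continuousLinearEquivAt ℂ x
    (FiberBundle.mem_baseSet_trivializationAt' x)).toLinearEquiv.finrank_eq,
    Module.finrank_self]

/-- The trivialization is linear on fibers, so it sends `0` to `0`, whereas it sends the frame to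
`1`. -/
theorem frame_ne_zero {p x : M} (hx : x ∈ (trivializationAt ℂ L p).baseSet) :
    frame L p x ≠ 0 := by
  intro h
  have h1 := (trivializationAt ℂ L p).apply_mk_symm hx 1
  have h2 := ((trivializationAt ℂ L p).linear ℂ hx).map_zero
  change (trivializationAt ℂ L p) ⟨x, frame L p x⟩ = _ at h1
  rw [h] at h1
  have h3 : (trivializationAt ℂ L p ⟨x, 0⟩).2 = 0 := h2
  rw [h1] at h3
  exact one_ne_zero h3

theorem trivialization_smul (p : M) {x : M} (hx : x ∈ (trivializationAt ℂ L p).baseSet) (c : ℂ)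
    (v : L x) : (trivializationAt ℂ L p ⟨x, c • v⟩).2 = c * (trivializationAt ℂ L p ⟨x, v⟩).2 :=
  ((trivializationAt ℂ L p).linear ℂ hx).map_smul c v

/-- The coefficient `χ` of a vector `v = χ u` of a complex line. -/
def lineCoeff {V : Type*} [NormedAddCommGroup V] [InnerProductSpace ℂ V] (u v : V) : ℂ :=
  inner ℂ u v / inner ℂ u u

theorem lineCoeff_smul_self {V : Type*} [NormedAddCommGroup V] [InnerProductSpace ℂ V]
    {u : V} (hu : u ≠ 0) (c : ℂ) : lineCoeff u (c • u) = c := by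
  rw [lineCoeff, inner_smul_right, mul_div_assoc, div_self (inner_self_ne_zero.2 hu), mul_one]

theorem lineCoeff_smul {V : Type*} [NormedAddCommGroup V] [InnerProductSpace ℂ V]
    (hV : Module.finrank ℂ V = 1) {u : V} (hu : u ≠ 0) (v : V) : lineCoeff u v • u = v := by
  obtain ⟨a, rfl⟩ := exists_smul_eq_of_finrank_eq_one hV hu v
  rw [lineCoeff_smul_self hu]

end Fibers

/-- Coefficients are quotients of inner products, so the smooth Hermitian structure alone makes
transition functions between arbitrary smooth frames smooth. -/
theorem contMDiffAt_lineCoeff (hL : IsSmoothHermitian n L) {e σ : ∀ x : M, L x} {x : M}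
    (he : SmoothAt n e x) (h0 : e x ≠ 0) (hσ : SmoothAt n σ x) :
    ContMDiffAt (𝓡 n) 𝓘(ℝ, ℂ) ∞ (fun x => lineCoeff (e x) (σ x)) x := by
  have h1 := hL x e σ he hσ
  have h2 := hL x e e he he
  have h3 : ContDiffAt ℝ ∞ (fun z : ℂ × ℂ => z.1 / z.2) (inner ℂ (e x) (σ x), inner ℂ (e x) (e x)) := by
    simp only [div_eq_mul_inv]
    exact contDiffAt_fst.mul (contDiffAt_snd.inv (inner_self_ne_zero.2 h0))
  exact ContMDiffAt.comp (g := fun z : ℂ × ℂ => z.1 / z.2)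
    (f := fun x => ((inner ℂ (e x) (σ x) : ℂ), (inner ℂ (e x) (e x) : ℂ))) x
    h3.contMDiffAt (h1.prodMk_space h2)

variable [VectorBundle ℂ ℂ L] [VectorBundle ℝ ℂ L]

variable [IsManifold (𝓡 n) ∞ M] [ContMDiffVectorBundle ∞ ℂ L (𝓡 n)]

theorem smoothAt_frame {p x : M} (hx : x ∈ (trivializationAt ℂ L p).baseSet) :
    SmoothAt n (frame L p) x := by
  rw [SmoothAt, (trivializationAt ℂ L p).contMDiffAt_section_iff hx]
  refine (contMDiffAt_const (c := (1 : ℂ))).congr_of_eventuallyEq ?_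
  filter_upwards [(trivializationAt ℂ L p).open_baseSet.mem_nhds hx] with y hy
  exact congrArg Prod.snd ((trivializationAt ℂ L p).apply_mk_symm hy 1)

theorem SmoothAt.smul {χ : M → ℂ} {σ : ∀ x : M, L x} {x : M}
    (hχ : ContMDiffAt (𝓡 n) 𝓘(ℝ, ℂ) ∞ χ x) (hσ : SmoothAt n σ x) :
    SmoothAt n (fun x => χ x • σ x) x := by
  have hx := FiberBundle.mem_baseSet_trivializationAt' (F := ℂ) (E := L) x
  rw [SmoothAt, (trivializationAt ℂ L x).contMDiffAt_section_iff hx] at hσ ⊢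
  have h3 : ContDiff ℝ ∞ (fun z : ℂ × ℂ => z.1 * z.2) := contDiff_fst.mul contDiff_snd
  refine (ContMDiffAt.comp (g := fun z : ℂ × ℂ => z.1 * z.2)
    (f := fun y => (χ y, (trivializationAt ℂ L x ⟨y, σ y⟩).2)) x
    h3.contMDiff.contMDiffAt (hχ.prodMk_space hσ)).congr_of_eventuallyEq ?_
  filter_upwards [(trivializationAt ℂ L x).open_baseSet.mem_nhds hx] with y hy
  exact trivialization_smul x hy _ _

theorem mdifferentiableAt_of_smooth {χ : M → ℂ} {x : M}
    (h : ContMDiffAt (𝓡 n) 𝓘(ℝ, ℂ) ∞ χ x) : MDifferentiableAt (𝓡 n) 𝓘(ℝ, ℂ) χ x :=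
  h.mdifferentiableAt (by simp)

theorem SmoothAt.mdiff {σ : ∀ x : M, L x} {x : M} (hσ : SmoothAt n σ x) :
    MDifferentiableAt (𝓡 n) ((𝓡 n).prod 𝓘(ℝ, ℂ)) (fun x => TotalSpace.mk' ℂ x (σ x)) x :=
  hσ.mdifferentiableAt (by simp)

variable {conn : CovariantDerivative (𝓡 n) ℂ L}

/-- Split `χ σ = (Re χ) σ + (Im χ) iσ`, apply the real Leibniz rule to each summand, and use `∇(iσ)
= i∇σ`. -/
theorem conn_smul (hconn : IsHermitianConnection conn) {χ : M → ℂ} {σ : ∀ x : M, L x} {x : M}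
    (hχ : ContMDiffAt (𝓡 n) 𝓘(ℝ, ℂ) ∞ χ x) (hσ : SmoothAt n σ x) (X : TangentSpace (𝓡 n) x) :
    conn (fun x => χ x • σ x) x X = χ x • conn σ x X + mvfderiv (𝓡 n) χ x X • σ x := by
  obtain ⟨h1, h2, h3⟩ := mvfderiv_re_add_im (mdifferentiableAt_of_smooth hχ) X
  have hI : SmoothAt n (fun x => Complex.I • σ x) x := SmoothAt.smul contMDiffAt_const hσ
  have hre : MDifferentiableAt (𝓡 n) ((𝓡 n).prod 𝓘(ℝ, ℂ))
      (fun x' => TotalSpace.mk' ℂ x' (((fun x => (χ x).re) • σ) x')) x := h1.smul_section hσ.mdiff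
  have him : MDifferentiableAt (𝓡 n) ((𝓡 n).prod 𝓘(ℝ, ℂ))
      (fun x' => TotalSpace.mk' ℂ x' (((fun x => (χ x).im) • fun x => Complex.I • σ x) x')) x :=
    h2.smul_section hI.mdiff
  have e : (fun x => χ x • σ x)
      = ((fun x => (χ x).re) • σ) + ((fun x => (χ x).im) • fun x => Complex.I • σ x) := by
    funext x'
    change χ x' • σ x' = (χ x').re • σ x' + (χ x').im • Complex.I • σ x'
    conv_lhs => rw [← Complex.re_add_im (χ x')]
    rw [add_smul, mul_smul]
    rfl
  have hu := conn.isCovariantDerivativeOnUniv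
  rw [e, hu.add hre him, hu.leibniz hσ.mdiff h1, hu.leibniz hI.mdiff h2, h3]
  simp only [add_apply, smul_apply, ContinuousLinearMap.smulRight_apply,
    hconn.complex_linear x σ hσ.mdiff]
  conv_rhs => rw [← Complex.re_add_im (χ x)]
  simp only [add_smul, mul_smul, Complex.coe_smul]
  abel

theorem conn_congr {σ τ : ∀ x : M, L x} {x : M} (hσ : SmoothAt n σ x) (hτ : SmoothAt n τ x)
    (h : ∀ᶠ y in 𝓝 x, σ y = τ y) : conn σ x = conn τ x :=
  conn.isCovariantDerivativeOnUniv.congr_of_eventuallyEq hσ.mdiff hτ.mdiff univ_mem h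

theorem SmoothAt.congr {σ τ : ∀ x : M, L x} {x : M} (hσ : SmoothAt n σ x)
    (h : ∀ᶠ y in 𝓝 x, τ y = σ y) : SmoothAt n τ x :=
  ContMDiffAt.congr_of_eventuallyEq hσ (h.mono fun y hy => congrArg (TotalSpace.mk' ℂ y) hy)

theorem conn_eq_connCoeff_smul (c : ConnField n L) {σ : ∀ x : M, L x} {x : M}
    (h0 : σ x ≠ 0) (X : TangentSpace (𝓡 n) x) : c σ x X = connCoeff c σ x X • σ x := by
  rw [connCoeff_apply]
  conv_lhs => rw [← lineCoeff_smul (finrank_fiber x) h0 (c σ x X)]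
  rw [lineCoeff, inner_self_eq_norm_sq_to_K]
  rfl

/-- The law `θ' = θ + dχ/χ` for a change of frame, kept free of division. It follows by comparing
the coefficients of `σ` in the Leibniz rule. -/
theorem connCoeff_smul (hconn : IsHermitianConnection conn) {χ : M → ℂ} {σ τ : ∀ x : M, L x}
    {x : M} (hχ : ContMDiffAt (𝓡 n) 𝓘(ℝ, ℂ) ∞ χ x) (hσ : SmoothAt n σ x)
    (hτ : SmoothAt n τ x) (h0 : τ x ≠ 0) (h : ∀ᶠ y in 𝓝 x, τ y = χ y • σ y)
    (X : TangentSpace (𝓡 n) x) :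
    χ x * connCoeff conn.toFun τ x X
      = χ x * connCoeff conn.toFun σ x X + mvfderiv (𝓡 n) χ x X := by
  have h1 := h.self_of_nhds
  have hσ0 : σ x ≠ 0 := fun h' => h0 (by rw [h1, h', smul_zero])
  have h2 : conn τ x X = χ x • conn σ x X + mvfderiv (𝓡 n) χ x X • σ x := by
    rw [conn_congr hτ (SmoothAt.smul hχ hσ) h, conn_smul hconn hχ hσ]
  rw [conn_eq_connCoeff_smul conn.toFun h0, conn_eq_connCoeff_smul conn.toFun hσ0, h1, smul_smul,
    smul_smul, ← add_smul] at h2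
  have h3 := smul_left_injective ℂ hσ0 h2
  rw [← h3, mul_comm]

/-- The induced connection on the powers of `L` can be computed in every smooth frame. -/
theorem powConn_apply_frame (hL : IsSmoothHermitian n L) (hconn : IsHermitianConnection conn)
    {k : ℤ} {w : PowSection L k} (hw : w ∈ smoothSections n L k) {e : ∀ x : M, L x} {x : M}
    (he : SmoothAt n e x) (h0 : e x ≠ 0) (X : TangentSpace (𝓡 n) x) :
    (powConn conn.toFun w x X).1 (e x) = mvfderiv (𝓡 n) (fun x' => (w x').1 (e x')) x X
      + k * connCoeff conn.toFun e x X * (w x).1 (e x) := by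
  have hx := FiberBundle.mem_baseSet_trivializationAt' (F := ℂ) (E := L) x
  have hf := smoothAt_frame (n := n) hx
  have hf0 := frame_ne_zero hx
  have hχ := contMDiffAt_lineCoeff hL hf hf0 he
  have hχe : ∀ᶠ y in 𝓝 x, lineCoeff (frame L x y) (e y) • frame L x y = e y := by
    filter_upwards [(trivializationAt ℂ L x).open_baseSet.mem_nhds hx] with y hy
    exact lineCoeff_smul (finrank_fiber y) (frame_ne_zero hy) _
  set χ : M → ℂ := fun y => lineCoeff (frame L x y) (e y)
  have hχ0 : χ x ≠ 0 := fun h => h0 (by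
    rw [← hχe.self_of_nhds]; exact (congrArg (· • frame L x x) h).trans (zero_smul _ _))
  have hwf : MDifferentiableAt (𝓡 n) 𝓘(ℝ, ℂ) (fun x' => (w x').1 (frame L x x')) x :=
    mdifferentiableAt_of_smooth ((hw x).contMDiffAt
      ((trivializationAt ℂ L x).open_baseSet.mem_nhds hx))
  have hχd := mdifferentiableAt_of_smooth hχ
  have hz := hasDerivAt_zpow (-k) (χ x) (Or.inl hχ0)
  -- Coefficients change by `χ^{-k}`; the derivative of this factor cancels `k` times the change
  -- `dχ/χ` of the connection form.
  have hev : (fun x' => (w x').1 (e x'))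
      =ᶠ[𝓝 x] fun x' => χ x' ^ (-k) * (w x').1 (frame L x x') := by
    filter_upwards [hχe, hχ.continuousAt.eventually_ne hχ0] with y hy hy0
    rw [← hy, LinePow.apply_smul _ hy0]
  have hzd : MDifferentiableAt (𝓡 n) 𝓘(ℝ, ℂ) (fun x' => χ x' ^ (-k)) x := by
    have := (hz.differentiableAt.restrictScalars ℝ).mdifferentiableAt
    exact MDifferentiableAt.comp (g := fun z : ℂ => z ^ (-k)) x this hχd
  have hc := connCoeff_smul hconn hχ hf he h0 (hχe.mono fun y hy => hy.symm) X
  rw [mvfderiv_congr hev, mvfderiv_mul_complex hzd hwf, mvfderiv_comp_deriv hχd hz]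
  have he' : e x = χ x • frame L x x := hχe.self_of_nhds.symm
  have hwe : (w x).1 (e x) = χ x ^ (-k) * (w x).1 (frame L x x) := hev.self_of_nhds
  rw [hwe]
  conv_lhs => rw [he', LinePow.apply_smul _ hχ0, powConn, LinePow.ofValue_apply_self hf0,
    ← connCoeff_apply]
  rw [zpow_sub_one₀ hχ0]
  push_cast
  have hc' : connCoeff conn.toFun e x X
      = connCoeff conn.toFun (frame L x) x X + (χ x)⁻¹ * mvfderiv (𝓡 n) χ x X := by
    field_simp
    linear_combination hc
  rw [hc']
  ring

end Frames

/-! ### Smoothness in charts -/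

section LocalSmoothness

open Filter Topology

variable {n : ℕ}

local notation "E" => EuclideanSpace ℝ (Fin n)
local notation "e" => stdVec

theorem contDiffAt_det {ι V : Type*} [Fintype ι] [DecidableEq ι] [NormedAddCommGroup V]
    [NormedSpace ℝ V] {A : V → Matrix ι ι ℝ} {y : V} {m : WithTop ℕ∞}
    (h : ∀ i j, ContDiffAt ℝ m (fun y => A y i j) y) : ContDiffAt ℝ m (fun y => (A y).det) y := by
  simp only [Matrix.det_apply]
  exact ContDiffAt.sum fun σ _ => ContDiffAt.const_smul _ (contDiffAt_prod fun i _ => h _ _)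

/-- Cramer's rule: the entries of the inverse are quotients of determinants. -/
theorem contDiffAt_inv_apply {ι V : Type*} [Fintype ι] [DecidableEq ι] [NormedAddCommGroup V]
    [NormedSpace ℝ V] {A : V → Matrix ι ι ℝ} {y : V} {m : WithTop ℕ∞}
    (h : ∀ i j, ContDiffAt ℝ m (fun y => A y i j) y) (h0 : IsUnit (A y).det) (i j : ι) :
    ContDiffAt ℝ m (fun y => (A y)⁻¹ i j) y := by
  simp only [Matrix.inv_def, Ring.inverse_eq_inv', Matrix.smul_apply, smul_eq_mul,
    Matrix.adjugate_apply]
  refine ((contDiffAt_det h).inv h0.ne_zero).mul (contDiffAt_det fun a b => ?_)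
  by_cases ha : a = j
  · subst ha
    simp only [Matrix.updateRow_self]
    exact contDiffAt_const
  · simp only [Matrix.updateRow_ne ha]
    exact h a b

theorem contDiffAt_fderiv_apply {V F : Type*} [NormedAddCommGroup V] [NormedSpace ℝ V]
    [NormedAddCommGroup F] [NormedSpace ℝ F] {f : V → F} {y : V} (h : ContDiffAt ℝ ∞ f y) (u : V) :
    ContDiffAt ℝ ∞ (fun z => fderiv ℝ f z u) y :=
  (h.fderiv_right (m := ∞) (by simp)).clm_apply contDiffAt_const

variable {G : EuclideanSpace ℝ (Fin n) →
    EuclideanSpace ℝ (Fin n) →L[ℝ] EuclideanSpace ℝ (Fin n) →L[ℝ] ℝ} {y : EuclideanSpace ℝ (Fin n)}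

theorem contDiffAt_formMatrix (hG : ContDiffAt ℝ ∞ G y) (i j : Fin n) :
    ContDiffAt ℝ ∞ (fun z => formMatrix (G z) i j) y :=
  (hG.clm_apply contDiffAt_const).clm_apply contDiffAt_const

theorem contDiffAt_inv_formMatrix (hG : ContDiffAt ℝ ∞ G y) (hm : IsMetricForm (G y))
    (i j : Fin n) : ContDiffAt ℝ ∞ (fun z => (formMatrix (G z))⁻¹ i j) y :=
  contDiffAt_inv_apply (contDiffAt_formMatrix hG) hm.isUnit_det i j

theorem contDiffAt_localChristoffel (hG : ContDiffAt ℝ ∞ G y) (hm : IsMetricForm (G y))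
    (l i j : Fin n) : ContDiffAt ℝ ∞ (localChristoffel G l i j) y :=
  contDiffAt_const.mul (ContDiffAt.sum fun _ _ => (contDiffAt_inv_formMatrix hG hm _ _).mul
    (((contDiffAt_fderiv_apply (contDiffAt_formMatrix hG _ _) _).add
      (contDiffAt_fderiv_apply (contDiffAt_formMatrix hG _ _) _)).sub
      (contDiffAt_fderiv_apply (contDiffAt_formMatrix hG _ _) _)))

theorem contDiffAt_localScalarCurvature (hG : ContDiffAt ℝ ∞ G y) (hm : IsMetricForm (G y)) :
    ContDiffAt ℝ ∞ (localScalarCurvature G) y := by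
  have h := contDiffAt_localChristoffel hG hm
  exact ContDiffAt.sum fun i _ => ContDiffAt.sum fun j _ =>
    (contDiffAt_inv_formMatrix hG hm i j).mul (ContDiffAt.sum fun l _ =>
      ((contDiffAt_fderiv_apply (h _ _ _) _).sub
        (contDiffAt_fderiv_apply (h _ _ _) _)).add
        (ContDiffAt.sum fun m _ => ((h _ _ _).mul (h _ _ _)).sub ((h _ _ _).mul (h _ _ _))))

theorem contDiffAt_complex_ofReal {V : Type*} [NormedAddCommGroup V] [NormedSpace ℝ V] {f : V → ℝ}
    {y : V} (h : ContDiffAt ℝ ∞ f y) : ContDiffAt ℝ ∞ (fun z => (f z : ℂ)) y :=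
  Complex.ofRealCLM.contDiff.contDiffAt.comp y h

theorem contDiffAt_localHamiltonian {k : ℤ} {θ : E → E →L[ℝ] ℂ} {f : E → ℂ}
    (hG : ContDiffAt ℝ ∞ G y) (hm : IsMetricForm (G y)) (hθ : ContDiffAt ℝ ∞ θ y)
    (hf : ContDiffAt ℝ ∞ f y) : ContDiffAt ℝ ∞ (localHamiltonian k G θ f) y := by
  have hθ' : ∀ u, ContDiffAt ℝ ∞ (fun z => θ z u) y := fun u => hθ.clm_apply contDiffAt_const
  have hc : ∀ u, ContDiffAt ℝ ∞ (fun z => localCov k θ f z u) y := fun u =>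
    (contDiffAt_fderiv_apply hf u).add ((contDiffAt_const.mul hf).mul (hθ' u))
  refine contDiffAt_const.mul (ContDiffAt.sub (ContDiffAt.sum fun i _ => ContDiffAt.sum fun j _ =>
    (contDiffAt_complex_ofReal (contDiffAt_inv_formMatrix hG hm i j)).mul
      (ContDiffAt.sub (ContDiffAt.add (contDiffAt_fderiv_apply (hc _) _)
        ((contDiffAt_const.mul (hθ' _)).mul (hc _))) ?_))
    (((contDiffAt_complex_ofReal (contDiffAt_localScalarCurvature hG hm)).div_const _).mul hf))
  exact ContDiffAt.sum fun l _ =>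
    (contDiffAt_complex_ofReal (contDiffAt_localChristoffel hG hm _ _ _)).mul (hc _)

/-- In finite dimension a linear map is a sum of coordinate functionals times its values on a basis,
so smoothness can be checked on vectors. -/
theorem contDiffAt_of_forall_apply {F W : Type*} [NormedAddCommGroup F] [NormedSpace ℝ F]
    [NormedAddCommGroup W] [NormedSpace ℝ W] {A : W → E →L[ℝ] F} {y : W} {m : WithTop ℕ∞}
    (h : ∀ u, ContDiffAt ℝ m (fun z => A z u) y) : ContDiffAt ℝ m A y := by
  have e1 : A = fun z => ∑ j, (ContinuousLinearMap.smulRightL ℝ E F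
      (EuclideanSpace.proj (𝕜 := ℝ) j)) (A z (e j)) := by
    funext z
    ext u
    conv_lhs => rw [sum_coord_smul_single u, map_sum]
    simp
  rw [e1]
  exact ContDiffAt.sum fun j _ => contDiffAt_const.clm_apply (h _)

end LocalSmoothness

/-! ### Smoothness of metrics, connection forms and coefficients in charts. -/

section ManifoldSmoothness

open Filter Topology

variable {n : ℕ} {M : Type*} [TopologicalSpace M] [ChartedSpace (EuclideanSpace ℝ (Fin n)) M]
  [IsManifold (𝓡 n) ∞ M]

/-- The coordinate vector field of the preferred chart at `p` with constant components `u`. -/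
def paramField (p : M) (u : EuclideanSpace ℝ (Fin n)) (x : M) : TangentSpace (𝓡 n) x :=
  (trivializationAt (EuclideanSpace ℝ (Fin n)) (TangentSpace (𝓡 n)) p).symm x u

theorem contMDiffAt_paramField {p x : M} (hx : x ∈ (extChartAt (𝓡 n) p).source)
    (u : EuclideanSpace ℝ (Fin n)) :
    ContMDiffAt (𝓡 n) ((𝓡 n).prod 𝓘(ℝ, EuclideanSpace ℝ (Fin n))) ∞
      (fun x => TotalSpace.mk' (EuclideanSpace ℝ (Fin n)) x (paramField p u x)) x := by
  rw [extChartAt_source] at hx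
  have hx' : x ∈ (trivializationAt (EuclideanSpace ℝ (Fin n)) (TangentSpace (𝓡 n)) p).baseSet := by
    simpa using hx
  rw [(trivializationAt (EuclideanSpace ℝ (Fin n)) (TangentSpace (𝓡 n)) p).contMDiffAt_section_iff
    hx']
  refine (contMDiffAt_const (c := u)).congr_of_eventuallyEq ?_
  filter_upwards [(trivializationAt (EuclideanSpace ℝ (Fin n)) (TangentSpace (𝓡 n))
    p).open_baseSet.mem_nhds hx'] with y hy
  exact congrArg Prod.snd ((trivializationAt (EuclideanSpace ℝ (Fin n)) (TangentSpace (𝓡 n))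
    p).apply_mk_symm hy u)

/-- The fields coming from the tangent bundle trivialization are visibly smooth, those coming from
the inverse chart occur in the coordinate formulas; this identifies the two. -/
theorem paramField_symm {p : M} {y : EuclideanSpace ℝ (Fin n)}
    (hy : y ∈ (extChartAt (𝓡 n) p).target) (u : EuclideanSpace ℝ (Fin n)) :
    paramField p u ((extChartAt (𝓡 n) p).symm y) = paramDeriv p y u := by
  have : IsManifold (𝓡 n) 1 M := IsManifold.of_le (n := ∞) (by simp)
  have hs := (extChartAt (𝓡 n) p).map_target hy
  rw [extChartAt_source] at hs
  have h := TangentBundle.symmL_trivializationAt (I := 𝓡 n) hs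
  rw [show Set.range (𝓡 n) = Set.univ from ModelWithCorners.range_eq_univ _,
    mfderivWithin_univ] at h
  have h1 : ∀ y', y' = y → (mfderiv 𝓘(ℝ, EuclideanSpace ℝ (Fin n)) (𝓡 n)
      (extChartAt (𝓡 n) p).symm y' u : EuclideanSpace ℝ (Fin n)) = paramDeriv p y u := by
    rintro _ rfl; rfl
  refine Eq.trans ?_ (h1 (extChartAt (𝓡 n) p ((extChartAt (𝓡 n) p).symm y))
    ((extChartAt (𝓡 n) p).right_inv hy))
  have hb : (extChartAt (𝓡 n) p).symm y ∈
      (trivializationAt (EuclideanSpace ℝ (Fin n)) (TangentSpace (𝓡 n)) p).baseSet := by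
    simpa using hs
  refine (Trivialization.symmL_apply (R := ℝ) _ hb u).symm.trans ?_
  exact congrArg (fun A : EuclideanSpace ℝ (Fin n) →L[ℝ] EuclideanSpace ℝ (Fin n) => A u) h

theorem contDiffAt_comp_symm {F : Type*} [NormedAddCommGroup F] [NormedSpace ℝ F] {f : M → F}
    {p : M} {y : EuclideanSpace ℝ (Fin n)} (hy : y ∈ (extChartAt (𝓡 n) p).target)
    (hf : ContMDiffAt (𝓡 n) 𝓘(ℝ, F) ∞ f ((extChartAt (𝓡 n) p).symm y)) :
    ContDiffAt ℝ ∞ (fun y => f ((extChartAt (𝓡 n) p).symm y)) y := by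
  have h : ContMDiffAt 𝓘(ℝ, EuclideanSpace ℝ (Fin n)) (𝓡 n) ∞ (extChartAt (𝓡 n) p).symm y :=
    (contMDiffOn_extChartAt_symm p y hy).contMDiffAt (extChartAt_target_mem_nhds_of_mem p hy)
  exact (ContMDiffAt.comp y hf h).contDiffAt

theorem contDiffAt_chartForm {g : FormField n M}
    (hg : ContMDiff (𝓡 n) ((𝓡 n).prod 𝓘(ℝ, EuclideanSpace ℝ (Fin n) →L[ℝ]
      EuclideanSpace ℝ (Fin n) →L[ℝ] ℝ)) ∞
      (fun b => TotalSpace.mk' (EuclideanSpace ℝ (Fin n) →L[ℝ] EuclideanSpace ℝ (Fin n) →L[ℝ] ℝ)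
        (E := fun b => TangentSpace (𝓡 n) b →L[ℝ] TangentSpace (𝓡 n) b →L[ℝ] ℝ) b (g b)))
    {p : M} {y : EuclideanSpace ℝ (Fin n)} (hy : y ∈ (extChartAt (𝓡 n) p).target) :
    ContDiffAt ℝ ∞ (chartForm g p) y := by
  refine contDiffAt_of_forall_apply fun u => contDiffAt_of_forall_apply fun v => ?_
  have hx := (extChartAt (𝓡 n) p).map_target hy
  have h1 : ContMDiffAt (𝓡 n) 𝓘(ℝ, ℝ) ∞ (fun x => g x (paramField p u x) (paramField p v x))
      ((extChartAt (𝓡 n) p).symm y) := by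
    have : ContMDiffAt (𝓡 n) ((𝓡 n).prod 𝓘(ℝ)) ∞
        (fun x => TotalSpace.mk' ℝ (E := Bundle.Trivial M ℝ) x
          (g x (paramField p u x) (paramField p v x))) ((extChartAt (𝓡 n) p).symm y) :=
      ContMDiffAt.clm_bundle_apply₂ (F₁ := EuclideanSpace ℝ (Fin n))
        (F₂ := EuclideanSpace ℝ (Fin n)) (hg _) (contMDiffAt_paramField hx u)
        (contMDiffAt_paramField hx v)
    simp only [contMDiffAt_totalSpace] at this
    exact this.2
  refine (contDiffAt_comp_symm hy h1).congr_of_eventuallyEq ?_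
  filter_upwards [extChartAt_target_mem_nhds_of_mem p hy] with z hz
  rw [chartForm_apply, paramField_symm hz, paramField_symm hz]

theorem paramDeriv_injective {p : M} {y : EuclideanSpace ℝ (Fin n)}
    (hy : y ∈ (extChartAt (𝓡 n) p).target) : Function.Injective (paramDeriv p y) := by
  have : IsManifold (𝓡 n) 1 M := IsManifold.of_le (n := ∞) (by simp)
  have h := isInvertible_mfderivWithin_extChartAt_symm (I := 𝓡 n) hy
  rw [show Set.range (𝓡 n) = Set.univ from ModelWithCorners.range_eq_univ _,
    mfderivWithin_univ] at h
  exact h.injective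

theorem isMetricForm_chartForm {g : FormField n M} (hs : ∀ x v w, g x v w = g x w v)
    (hp : ∀ x v, v ≠ 0 → 0 < g x v v) {p : M} {y : EuclideanSpace ℝ (Fin n)}
    (hy : y ∈ (extChartAt (𝓡 n) p).target) : IsMetricForm (chartForm g p y) where
  symm u v := by
    rw [chartForm_apply, chartForm_apply]
    exact hs _ _ _
  pos u hu := by
    rw [chartForm_apply]
    refine hp _ _ fun h => hu (paramDeriv_injective hy ?_)
    rw [h]
    exact (ContinuousLinearMap.map_zero _).symm

theorem contDiffAt_zpow_complex {z : ℂ} (hz : z ≠ 0) {k : ℤ} :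
    ContDiffAt ℝ ∞ (fun z : ℂ => z ^ k) z :=
  (AnalyticAt.zpow (𝕜 := ℂ) (f := fun z : ℂ => z) analyticAt_id hz).contDiffAt.restrict_scalars ℝ

theorem contMDiffAt_mul_complex {f h : M → ℂ} {x : M} (hf : ContMDiffAt (𝓡 n) 𝓘(ℝ, ℂ) ∞ f x)
    (hh : ContMDiffAt (𝓡 n) 𝓘(ℝ, ℂ) ∞ h x) :
    ContMDiffAt (𝓡 n) 𝓘(ℝ, ℂ) ∞ (fun y => f y * h y) x := by
  have h3 : ContDiff ℝ ∞ (fun z : ℂ × ℂ => z.1 * z.2) := contDiff_fst.mul contDiff_snd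
  exact ContMDiffAt.comp (g := fun z : ℂ × ℂ => z.1 * z.2) (f := fun y => (f y, h y)) x
    h3.contMDiff.contMDiffAt (hf.prodMk_space hh)

section Bundle

variable {L : M → Type*} [∀ x, NormedAddCommGroup (L x)] [∀ x, InnerProductSpace ℂ (L x)]
  [TopologicalSpace (TotalSpace ℂ L)] [FiberBundle ℂ L] [VectorBundle ℂ ℂ L] [VectorBundle ℝ ℂ L]
  [ContMDiffVectorBundle ∞ ℂ L (𝓡 n)] {conn : CovariantDerivative (𝓡 n) ℂ L}

/-- Multiply by a bump function. Frames are only local, while the smoothness of the connection is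
applied to sections smooth on all of `M`. -/
theorem exists_global_section [T2Space M] {σ : ∀ x : M, L x} {p : M}
    (hσ : ∀ᶠ x in 𝓝 p, SmoothAt n σ x) :
    ∃ τ : ∀ x : M, L x, (∀ x, SmoothAt n τ x) ∧ ∀ᶠ x in 𝓝 p, τ x = σ x := by
  obtain ⟨U, hU, hUo, hpU⟩ := eventually_nhds_iff.1 hσ
  obtain ⟨f, -, hf⟩ := (SmoothBumpFunction.nhds_basis_tsupport (I := 𝓡 n) p).mem_iff.1
    (hUo.mem_nhds hpU)
  refine ⟨fun x => f x • σ x, fun x => ?_, ?_⟩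
  · exact ContMDiffOn.smul_section_of_tsupport (f.contMDiff.contMDiffOn) hUo hf
      (fun x hx => (hU x hx).contMDiffWithinAt) x
  · filter_upwards [f.eventuallyEq_one] with x hx
    rw [hx, Pi.one_apply, one_smul]

theorem smoothAt_conn_apply [T2Space M] (hconn : IsHermitianConnection conn) {σ : ∀ x : M, L x}
    {p : M} (hσ : ∀ᶠ x in 𝓝 p, SmoothAt n σ x) {V : ∀ x : M, TangentSpace (𝓡 n) x}
    (hV : ContMDiffAt (𝓡 n) ((𝓡 n).prod 𝓘(ℝ, EuclideanSpace ℝ (Fin n))) ∞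
      (fun x => TotalSpace.mk' (EuclideanSpace ℝ (Fin n)) x (V x)) p) :
    SmoothAt n (fun x => conn σ x (V x)) p := by
  obtain ⟨τ, hτ, hτσ⟩ := exists_global_section hσ
  have h1 := hconn.smooth.contMDiff.contMDiff (σ := τ) (fun x _ => (hτ x).contMDiffWithinAt)
  have h2 : SmoothAt n (fun x => conn τ x (V x)) p :=
    ContMDiffAt.clm_bundle_apply (F₁ := EuclideanSpace ℝ (Fin n)) (F₂ := ℂ)
      (h1.contMDiffAt univ_mem) hV
  refine h2.congr ?_
  filter_upwards [hτσ.eventually_nhds, hσ] with x hx hx'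
  rw [conn_congr (hτ x) hx' hx]

theorem contDiffAt_chartConn [T2Space M] (hL : IsSmoothHermitian n L)
    (hconn : IsHermitianConnection conn) {p : M} {y : EuclideanSpace ℝ (Fin n)}
    (hy : y ∈ (extChartAt (𝓡 n) p).target)
    (hb : (extChartAt (𝓡 n) p).symm y ∈ (trivializationAt ℂ L p).baseSet) :
    ContDiffAt ℝ ∞ (chartConn conn.toFun p) y := by
  refine contDiffAt_of_forall_apply fun u => ?_
  have hx := (extChartAt (𝓡 n) p).map_target hy
  have hσ : ∀ᶠ x in 𝓝 ((extChartAt (𝓡 n) p).symm y), SmoothAt n (frame L p) x := by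
    filter_upwards [(trivializationAt ℂ L p).open_baseSet.mem_nhds hb] with x hx
    exact smoothAt_frame hx
  have h1 := contMDiffAt_lineCoeff hL hσ.self_of_nhds (frame_ne_zero hb)
    (smoothAt_conn_apply hconn hσ (contMDiffAt_paramField hx u))
  refine (contDiffAt_comp_symm hy h1).congr_of_eventuallyEq ?_
  filter_upwards [extChartAt_target_mem_nhds_of_mem p hy] with z hz
  rw [paramField_symm hz, lineCoeff, inner_self_eq_norm_sq_to_K]
  exact connCoeff_apply _ _ _ _

theorem contDiffAt_chartCoeff {k : ℤ} {w : PowSection L k} (hw : w ∈ smoothSections n L k) {p : M}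
    {y : EuclideanSpace ℝ (Fin n)} (hy : y ∈ (extChartAt (𝓡 n) p).target)
    (hb : (extChartAt (𝓡 n) p).symm y ∈ (trivializationAt ℂ L p).baseSet) :
    ContDiffAt ℝ ∞ (chartCoeff w p) y :=
  contDiffAt_comp_symm hy ((hw p).contMDiffAt ((trivializationAt ℂ L p).open_baseSet.mem_nhds hb))

theorem SmoothAt.eventually_ne (hL : IsSmoothHermitian n L) {e : ∀ x : M, L x} {x : M}
    (he : SmoothAt n e x) (h0 : e x ≠ 0) : ∀ᶠ y in 𝓝 x, e y ≠ 0 := by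
  filter_upwards [(hL x e e he he).continuousAt.eventually_ne (inner_self_ne_zero.2 h0)] with y hy
  exact inner_self_ne_zero.1 hy

theorem eventually_lineCoeff_smul (hL : IsSmoothHermitian n L) {e : ∀ x : M, L x} {x : M}
    (he : SmoothAt n e x) (h0 : e x ≠ 0) (σ : ∀ x : M, L x) :
    ∀ᶠ y in 𝓝 x, lineCoeff (e y) (σ y) • e y = σ y :=
  (he.eventually_ne hL h0).mono fun y hy => lineCoeff_smul (finrank_fiber y) hy _

theorem lineCoeff_ne_zero {V : Type*} [NormedAddCommGroup V] [InnerProductSpace ℂ V]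
    (hV : Module.finrank ℂ V = 1) {u v : V} (hu : u ≠ 0) (hv : v ≠ 0) : lineCoeff u v ≠ 0 :=
  fun h => hv (by rw [← lineCoeff_smul hV hu v, h, zero_smul])

/-- The coefficient of a section of `L^{⊗k}` in one smooth frame is smooth if its coefficient in
another smooth frame is smooth. -/
theorem contMDiffAt_apply_frame (hL : IsSmoothHermitian n L) {k : ℤ} {w : PowSection L k} {x : M}
    {e e' : ∀ x : M, L x} (he : SmoothAt n e x) (h0 : e x ≠ 0) (he' : SmoothAt n e' x)
    (h0' : e' x ≠ 0) (hw : ContMDiffAt (𝓡 n) 𝓘(ℝ, ℂ) ∞ (fun x => (w x).1 (e x)) x) :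
    ContMDiffAt (𝓡 n) 𝓘(ℝ, ℂ) ∞ (fun x => (w x).1 (e' x)) x := by
  have hχ := contMDiffAt_lineCoeff hL he h0 he'
  have hχ0 := lineCoeff_ne_zero (finrank_fiber x) h0 h0'
  have hz : ContMDiffAt (𝓡 n) 𝓘(ℝ, ℂ) ∞ (fun y => lineCoeff (e y) (e' y) ^ (-k)) x :=
    ContMDiffAt.comp (g := fun z : ℂ => z ^ (-k)) x (contDiffAt_zpow_complex hχ0).contMDiffAt hχ
  refine (contMDiffAt_mul_complex hz hw).congr_of_eventuallyEq ?_
  filter_upwards [eventually_lineCoeff_smul hL he h0 e', hχ.continuousAt.eventually_ne hχ0]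
    with y hy hy0
  conv_lhs => rw [← hy]
  exact LinePow.apply_smul _ hy0 _

/-- Smoothness may be tested in any frame near each point, in particular in frames pulled back from
another bundle. -/
theorem mem_smoothSections_of_frames (hL : IsSmoothHermitian n L) {k : ℤ} {w : PowSection L k}
    (h : ∀ x, ∃ e : ∀ x : M, L x, SmoothAt n e x ∧ e x ≠ 0 ∧
      ContMDiffAt (𝓡 n) 𝓘(ℝ, ℂ) ∞ (fun x => (w x).1 (e x)) x) : w ∈ smoothSections n L k := by
  intro p x hx
  obtain ⟨e, he, h0, hw⟩ := h x
  exact (contMDiffAt_apply_frame hL he h0 (smoothAt_frame hx) (frame_ne_zero hx)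
    hw).contMDiffWithinAt

theorem contMDiffAt_of_mem_smoothSections (hL : IsSmoothHermitian n L) {k : ℤ}
    {w : PowSection L k} (hw : w ∈ smoothSections n L k) {e : ∀ x : M, L x} {x : M}
    (he : SmoothAt n e x) (h0 : e x ≠ 0) :
    ContMDiffAt (𝓡 n) 𝓘(ℝ, ℂ) ∞ (fun x => (w x).1 (e x)) x := by
  have hx := FiberBundle.mem_baseSet_trivializationAt' (F := ℂ) (E := L) x
  exact contMDiffAt_apply_frame hL (smoothAt_frame hx) (frame_ne_zero hx) he h0
    ((hw x).contMDiffAt ((trivializationAt ℂ L x).open_baseSet.mem_nhds hx))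

end Bundle

end ManifoldSmoothness

/-! ### Local isometries and the Hamiltonian -/

section LocalIsometry

open Filter Topology

variable {n : ℕ} {M : Type*} [TopologicalSpace M] [ChartedSpace (EuclideanSpace ℝ (Fin n)) M]
  {L : M → Type*} [∀ x, NormedAddCommGroup (L x)] [∀ x, InnerProductSpace ℂ (L x)]
  [TopologicalSpace (TotalSpace ℂ L)]
  {N : Type*} [TopologicalSpace N] [ChartedSpace (EuclideanSpace ℝ (Fin n)) N]
  {L' : N → Type*} [∀ x, NormedAddCommGroup (L' x)] [∀ x, InnerProductSpace ℂ (L' x)]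
  [TopologicalSpace (TotalSpace ℂ L')]

/-- The pullback of a section along a map of line bundles. -/
def pullSection {Φ : M → N} (Ψ : ∀ x, L x ≃ₗᵢ[ℂ] L' (Φ x)) (σ : ∀ y : N, L' y) (x : M) : L x :=
  (Ψ x).symm (σ (Φ x))

/-- The pullback of a section of `L'^{⊗k}` along a map of line bundles. -/
def pullPow {Φ : M → N} (Ψ : ∀ x, L x ≃ₗᵢ[ℂ] L' (Φ x)) (k : ℤ) :
    PowSection L' k →ₗ[ℂ] PowSection L k where
  toFun s x := LinePow.comap k (Ψ x) (s (Φ x))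
  map_add' _ _ := rfl
  map_smul' _ _ := rfl

theorem pullPow_apply {Φ : M → N} (Ψ : ∀ x, L x ≃ₗᵢ[ℂ] L' (Φ x)) {k : ℤ} (s : PowSection L' k)
    (x : M) (v : L x) : (pullPow Ψ k s x).1 v = (s (Φ x)).1 (Ψ x v) := rfl

theorem pullPow_apply_pullSection {Φ : M → N} (Ψ : ∀ x, L x ≃ₗᵢ[ℂ] L' (Φ x)) {k : ℤ}
    (s : PowSection L' k) (σ : ∀ y : N, L' y) (x : M) :
    (pullPow Ψ k s x).1 (pullSection Ψ σ x) = (s (Φ x)).1 (σ (Φ x)) := by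
  rw [pullPow_apply, pullSection, LinearIsometryEquiv.apply_symm_apply]

variable [FiberBundle ℂ L] [FiberBundle ℂ L']

/-- A surjective local isometry `Φ : M → N` covered by a map of Hermitian line bundles which
identifies the connections. -/
structure IsBundleLocalIsometry {Φ : M → N} (Ψ : ∀ x, L x ≃ₗᵢ[ℂ] L' (Φ x)) (g : FormField n M)
    (conn : ConnField n L) (g' : FormField n N) (conn' : ConnField n L') : Prop where
  surjective : Function.Surjective Φ
  contMDiff : ContMDiff (𝓡 n) (𝓡 n) ∞ Φ
  exists_localInverse : ∀ x, ∃ Θ : OpenPartialHomeomorph M N, x ∈ Θ.source ∧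
    Set.EqOn Θ Φ Θ.source ∧ ContMDiffOn (𝓡 n) (𝓡 n) ∞ Θ.symm Θ.target
  metric : ∀ x (X Y : TangentSpace (𝓡 n) x),
    g' (Φ x) (mfderiv (𝓡 n) (𝓡 n) Φ x X) (mfderiv (𝓡 n) (𝓡 n) Φ x Y) = g x X Y
  frame_ne_zero : ∀ q x, Φ x ∈ (trivializationAt ℂ L' q).baseSet → frame L' q (Φ x) ≠ 0
  smoothAt_frame : ∀ q x, Φ x ∈ (trivializationAt ℂ L' q).baseSet →
    SmoothAt n (pullSection Ψ (frame L' q)) x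
  conn_frame : ∀ q x, Φ x ∈ (trivializationAt ℂ L' q).baseSet → ∀ X : TangentSpace (𝓡 n) x,
    conn' (frame L' q) (Φ x) (mfderiv (𝓡 n) (𝓡 n) Φ x X)
      = Ψ x (conn (pullSection Ψ (frame L' q)) x X)

namespace IsBundleLocalIsometry

variable {Φ : M → N} {Ψ : ∀ x, L x ≃ₗᵢ[ℂ] L' (Φ x)} {g : FormField n M}
  {g' : FormField n N} {conn' : ConnField n L'}

theorem pullSection_ne_zero {conn : ConnField n L} (h : IsBundleLocalIsometry Ψ g conn g' conn')
    {q : N} {x : M} (hx : Φ x ∈ (trivializationAt ℂ L' q).baseSet) :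
    pullSection Ψ (frame L' q) x ≠ 0 := fun h0 => h.frame_ne_zero q x hx (by
  rw [pullSection, LinearIsometryEquiv.map_eq_zero_iff] at h0
  exact h0)

theorem connCoeff_frame {conn : ConnField n L} (h : IsBundleLocalIsometry Ψ g conn g' conn')
    {q : N} {x : M} (hx : Φ x ∈ (trivializationAt ℂ L' q).baseSet) (X : TangentSpace (𝓡 n) x) :
    connCoeff conn' (frame L' q) (Φ x) (mfderiv (𝓡 n) (𝓡 n) Φ x X)
      = connCoeff conn (pullSection Ψ (frame L' q)) x X := by
  rw [connCoeff_apply, connCoeff_apply, h.conn_frame q x hx]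
  have h1 : frame L' q (Φ x) = Ψ x (pullSection Ψ (frame L' q) x) := by
    rw [pullSection, LinearIsometryEquiv.apply_symm_apply]
  rw [h1, LinearIsometryEquiv.inner_map_map, LinearIsometryEquiv.norm_map]

/-- The differential of a local isometry is surjective. -/
theorem mfderiv_surjective {conn : ConnField n L} (h : IsBundleLocalIsometry Ψ g conn g' conn')
    (x : M) : Function.Surjective (mfderiv (𝓡 n) (𝓡 n) Φ x) := by
  obtain ⟨Θ, hx, hΘ, hs⟩ := h.exists_localInverse x
  have hx' : Φ x ∈ Θ.target := by
    rw [← hΘ hx]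
    exact Θ.map_source hx
  have hinv : Θ.symm (Φ x) = x := by rw [← hΘ hx, Θ.left_inv hx]
  have h1 : MDifferentiableAt (𝓡 n) (𝓡 n) Θ.symm (Φ x) :=
    (hs.contMDiffAt (Θ.open_target.mem_nhds hx')).mdifferentiableAt (by simp)
  have h2 : MDifferentiableAt (𝓡 n) (𝓡 n) Φ (Θ.symm (Φ x)) :=
    (h.contMDiff _).mdifferentiableAt (by simp)
  have h3 := mfderiv_comp (Φ x) h2 h1
  have h4 : Φ ∘ Θ.symm =ᶠ[𝓝 (Φ x)] id := by
    filter_upwards [Θ.open_target.mem_nhds hx'] with y hy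
    rw [Function.comp_apply, ← hΘ (Θ.map_target hy), Θ.right_inv hy]
    rfl
  have h5 : (mfderiv (𝓡 n) (𝓡 n) (Φ ∘ Θ.symm) (Φ x) :
      EuclideanSpace ℝ (Fin n) →L[ℝ] EuclideanSpace ℝ (Fin n))
      = ContinuousLinearMap.id ℝ (EuclideanSpace ℝ (Fin n)) := by
    have := h4.mfderiv_eq (I := 𝓡 n) (I' := 𝓡 n)
    exact this.trans mfderiv_id
  have h6 : ∀ z, z = x → Function.Surjective (mfderiv (𝓡 n) (𝓡 n) Φ z) →
      Function.Surjective (mfderiv (𝓡 n) (𝓡 n) Φ x) := by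
    rintro _ rfl h; exact h
  refine h6 _ hinv fun Y => ⟨mfderiv (𝓡 n) (𝓡 n) Θ.symm (Φ x) Y, ?_⟩
  have h7 := congrArg (fun A : EuclideanSpace ℝ (Fin n) →L[ℝ] EuclideanSpace ℝ (Fin n) => A Y)
    (h3.symm.trans h5)
  exact h7

section Smooth

variable [IsManifold (𝓡 n) ∞ M] [VectorBundle ℂ ℂ L] [VectorBundle ℝ ℂ L]
  [ContMDiffVectorBundle ∞ ℂ L (𝓡 n)]

/-- In a pulled back frame the coefficient of a pulled back section is the old coefficient composed
with `Φ`. Smoothness passes up by composing with `Φ` and down by composing with a smooth local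
inverse. -/
theorem pullPow_mem_smoothSections {conn : ConnField n L}
    (h : IsBundleLocalIsometry Ψ g conn g' conn') (hL : IsSmoothHermitian n L) {k : ℤ}
    {s : PowSection L' k} :
    pullPow Ψ k s ∈ smoothSections n L k ↔ s ∈ smoothSections n L' k := by
  constructor
  · intro hs q y hy
    obtain ⟨x, rfl⟩ := h.surjective y
    have h1 := contMDiffAt_of_mem_smoothSections hL hs (h.smoothAt_frame q x hy)
      (h.pullSection_ne_zero hy)
    simp only [pullPow_apply_pullSection] at h1
    obtain ⟨Θ, hx, hΘ, hΘs⟩ := h.exists_localInverse x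
    have hx' : Φ x ∈ Θ.target := by
      rw [← hΘ hx]
      exact Θ.map_source hx
    have hinv : Θ.symm (Φ x) = x := by rw [← hΘ hx, Θ.left_inv hx]
    rw [← hinv] at h1
    refine ((h1.comp _ (hΘs.contMDiffAt (Θ.open_target.mem_nhds hx'))).congr_of_eventuallyEq
      ?_).contMDiffWithinAt
    filter_upwards [Θ.open_target.mem_nhds hx'] with y hy
    have : Φ (Θ.symm y) = y := by rw [← hΘ (Θ.map_target hy), Θ.right_inv hy]
    rw [Function.comp_apply, this]
  · intro hs
    refine mem_smoothSections_of_frames hL fun x => ?_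
    have hx := FiberBundle.mem_baseSet_trivializationAt' (F := ℂ) (E := L') (Φ x)
    refine ⟨_, h.smoothAt_frame (Φ x) x hx, h.pullSection_ne_zero hx, ?_⟩
    simp only [pullPow_apply_pullSection]
    exact ContMDiffAt.comp (g := fun y => (s y).1 (frame L' (Φ x) y)) x
      ((hs (Φ x)).contMDiffAt ((trivializationAt ℂ L' (Φ x)).open_baseSet.mem_nhds hx))
      (h.contMDiff x)

variable {conn : CovariantDerivative (𝓡 n) ℂ L}

theorem mvfderiv_comp_map {conn : ConnField n L} (h : IsBundleLocalIsometry Ψ g conn g' conn')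
    {f : N → ℂ} {x : M} (hf : ContMDiffAt (𝓡 n) 𝓘(ℝ, ℂ) ∞ f (Φ x)) (X : TangentSpace (𝓡 n) x) :
    mvfderiv (𝓡 n) f (Φ x) (mfderiv (𝓡 n) (𝓡 n) Φ x X)
      = mvfderiv (𝓡 n) (fun x => f (Φ x)) x X :=
  (mfderiv_comp_apply (g := f) (f := Φ) (I'' := 𝓘(ℝ, ℂ)) x (hf.mdifferentiableAt (by simp))
    ((h.contMDiff x).mdifferentiableAt (by simp)) X).symm

/-- The induced connections on the powers correspond to each other. -/
theorem comap_powConn (h : IsBundleLocalIsometry Ψ g conn.toFun g' conn')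
    (hL : IsSmoothHermitian n L) (hconn : IsHermitianConnection conn) {k : ℤ}
    {s : PowSection L' k} (hs : s ∈ smoothSections n L' k) (x : M) (X : TangentSpace (𝓡 n) x) :
    LinePow.comap k (Ψ x) (powConn conn' s (Φ x) (mfderiv (𝓡 n) (𝓡 n) Φ x X))
      = powConn conn.toFun (pullPow Ψ k s) x X := by
  have hx := FiberBundle.mem_baseSet_trivializationAt' (F := ℂ) (E := L') (Φ x)
  have h0 := h.pullSection_ne_zero hx
  refine LinePow.ext_of_apply_eq (finrank_fiber x) h0 ?_
  rw [powConn_apply_frame hL hconn ((h.pullPow_mem_smoothSections hL).2 hs)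
    (h.smoothAt_frame _ x hx) h0]
  simp only [pullPow_apply_pullSection]
  rw [LinePow.comap_apply, pullSection, LinearIsometryEquiv.apply_symm_apply, powConn,
    LinePow.ofValue_apply_self (h.frame_ne_zero _ x hx), ← connCoeff_apply, h.connCoeff_frame hx,
    h.mvfderiv_comp_map ((hs (Φ x)).contMDiffAt
      ((trivializationAt ℂ L' (Φ x)).open_baseSet.mem_nhds hx))]

/-- Independence of the frame is transferred from `M`, because `Φ` and its differentials are
surjective. In this way no axioms of a covariant derivative are asked of `conn'`. -/
theorem powConn_apply_frame (h : IsBundleLocalIsometry Ψ g conn.toFun g' conn')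
    (hL : IsSmoothHermitian n L) (hconn : IsHermitianConnection conn) {k : ℤ}
    {s : PowSection L' k} (hs : s ∈ smoothSections n L' k) {q y : N}
    (hy : y ∈ (trivializationAt ℂ L' q).baseSet) (X : TangentSpace (𝓡 n) y) :
    (powConn conn' s y X).1 (frame L' q y)
      = mvfderiv (𝓡 n) (fun x' => (s x').1 (frame L' q x')) y X
        + k * connCoeff conn' (frame L' q) y X * (s y).1 (frame L' q y) := by
  obtain ⟨x, rfl⟩ := h.surjective y
  obtain ⟨X, rfl⟩ := h.mfderiv_surjective x X
  have h1 := QuantumMagnetic.powConn_apply_frame hL hconn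
    ((h.pullPow_mem_smoothSections hL).2 hs) (h.smoothAt_frame q x hy) (h.pullSection_ne_zero hy) X
  simp only [pullPow_apply_pullSection] at h1
  rw [← h.comap_powConn hL hconn hs, LinePow.comap_apply, pullSection,
    LinearIsometryEquiv.apply_symm_apply] at h1
  rw [h1, h.connCoeff_frame hy, h.mvfderiv_comp_map ((hs q).contMDiffAt
      ((trivializationAt ℂ L' q).open_baseSet.mem_nhds hy))]

/-- The Hamiltonian of `N` is computed in the charts and frames of `M`. -/
theorem hamiltonian_apply [T2Space M] [IsManifold (𝓡 n) ∞ N]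
    (h : IsBundleLocalIsometry Ψ g conn.toFun g' conn')
    (hg : ContMDiff (𝓡 n) ((𝓡 n).prod 𝓘(ℝ, EuclideanSpace ℝ (Fin n) →L[ℝ]
      EuclideanSpace ℝ (Fin n) →L[ℝ] ℝ)) ∞
      (fun b => TotalSpace.mk' (EuclideanSpace ℝ (Fin n) →L[ℝ] EuclideanSpace ℝ (Fin n) →L[ℝ] ℝ)
        (E := fun b => TangentSpace (𝓡 n) b →L[ℝ] TangentSpace (𝓡 n) b →L[ℝ] ℝ) b (g b)))
    (hgs : ∀ x v w, g x v w = g x w v) (hgp : ∀ x v, v ≠ 0 → 0 < g x v v)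
    (hL : IsSmoothHermitian n L) (hconn : IsHermitianConnection conn) {k : ℤ}
    {s : PowSection L' k} (hs : s ∈ smoothSections n L' k) {x p : M}
    (hx : x ∈ (extChartAt (𝓡 n) p).source) (hxb : x ∈ (trivializationAt ℂ L p).baseSet) :
    (hamiltonian g' conn' s (Φ x)).1 (Ψ x (frame L p x))
      = localHamiltonian k (chartForm g p) (chartConn conn.toFun p)
          (chartCoeff (pullPow Ψ k s) p) (extChartAt (𝓡 n) p x) := by
  obtain ⟨Θ, hxΘ, hΘ, hΘs⟩ := h.exists_localInverse x
  set q := Φ x with hq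
  have hqb := FiberBundle.mem_baseSet_trivializationAt' (F := ℂ) (E := L') q
  have hqΘ : q ∈ Θ.target := by
    rw [hq, ← hΘ hxΘ]
    exact Θ.map_source hxΘ
  have hinv : Θ.symm q = x := by rw [hq, ← hΘ hxΘ, Θ.left_inv hxΘ]
  have hs' := (h.pullPow_mem_smoothSections hL).2 hs
  set y₀ := extChartAt (𝓡 n) q q with hy₀
  have hψq : (extChartAt (𝓡 n) q).symm y₀ = q := extChartAt_to_inv q
  have hy₀t : y₀ ∈ (extChartAt (𝓡 n) q).target := mem_extChartAt_target q
  -- The local inverse of `Φ`, read from the chart of `N` at `q` to the chart of `M` at `p`.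
  set φ : EuclideanSpace ℝ (Fin n) → EuclideanSpace ℝ (Fin n) :=
    fun z => extChartAt (𝓡 n) p (Θ.symm ((extChartAt (𝓡 n) q).symm z)) with hφ
  have hφ₀ : φ y₀ = extChartAt (𝓡 n) p x := by rw [hφ]; simp only [hψq, hinv]
  -- The transition function from the frame of `L` at `p` to the pulled back frame of `L'`;
  -- coefficients on the `k`-th power change by `χ^{-k}`, which becomes the factor `c`.
  set χ : M → ℂ := fun x' => lineCoeff (frame L p x') (pullSection Ψ (frame L' q) x') with hχdef
  -- the set of good points
  have hcψ : ContinuousAt (extChartAt (𝓡 n) q).symm y₀ := continuousAt_extChartAt_symm'' hy₀t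
  have hgood : ∀ᶠ z in 𝓝 y₀, z ∈ (extChartAt (𝓡 n) q).target ∧
      (extChartAt (𝓡 n) q).symm z ∈ Θ.target ∧
      (extChartAt (𝓡 n) q).symm z ∈ (trivializationAt ℂ L' q).baseSet ∧
      Θ.symm ((extChartAt (𝓡 n) q).symm z) ∈ (extChartAt (𝓡 n) p).source ∧
      Θ.symm ((extChartAt (𝓡 n) q).symm z) ∈ (trivializationAt ℂ L p).baseSet := by
    have hcΘ : ContinuousAt Θ.symm ((extChartAt (𝓡 n) q).symm y₀) := by
      rw [hψq]
      exact Θ.symm.continuousAt hqΘ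
    have hcc := hcΘ.comp hcψ
    filter_upwards [extChartAt_target_mem_nhds_of_mem q hy₀t,
      hcψ.eventually (by rw [hψq]; exact Θ.open_target.mem_nhds hqΘ),
      hcψ.eventually (by rw [hψq]; exact (trivializationAt ℂ L' q).open_baseSet.mem_nhds hqb),
      hcc.eventually (by
        rw [Function.comp_apply, hψq, hinv]
        exact (isOpen_extChartAt_source p).mem_nhds hx),
      hcc.eventually (by
        rw [Function.comp_apply, hψq, hinv]
        exact (trivializationAt ℂ L p).open_baseSet.mem_nhds hxb)] with z h1 h2 h3 h4 h5
    exact ⟨h1, h2, h3, h4, h5⟩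
  have hgood' := hgood.eventually_nhds
  have hpt : ∀ᶠ z in 𝓝 y₀, φ z ∈ (extChartAt (𝓡 n) p).target ∧
      (extChartAt (𝓡 n) p).symm (φ z) = Θ.symm ((extChartAt (𝓡 n) q).symm z) ∧
      Φ ((extChartAt (𝓡 n) p).symm (φ z)) = (extChartAt (𝓡 n) q).symm z := by
    filter_upwards [hgood] with z ⟨_, h2, _, h4, _⟩
    have e1 : (extChartAt (𝓡 n) p).symm (φ z) = Θ.symm ((extChartAt (𝓡 n) q).symm z) :=
      (extChartAt (𝓡 n) p).left_inv h4
    refine ⟨(extChartAt (𝓡 n) p).map_source h4, e1, ?_⟩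
    rw [e1, ← hΘ (Θ.map_target h2), Θ.right_inv h2]
  have hφs : ∀ᶠ z in 𝓝 y₀, ContDiffAt ℝ ∞ φ z := by
    filter_upwards [hgood] with z ⟨h1, h2, _, h4, _⟩
    have a1 : ContMDiffAt (𝓡 n) 𝓘(ℝ, EuclideanSpace ℝ (Fin n)) ∞ (extChartAt (𝓡 n) p)
        (Θ.symm ((extChartAt (𝓡 n) q).symm z)) :=
      contMDiffAt_extChartAt' (by rwa [extChartAt_source] at h4)
    exact contDiffAt_comp_symm h1 (a1.comp _ (hΘs.contMDiffAt (Θ.open_target.mem_nhds h2)))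
  have hφd : ∀ᶠ z in 𝓝 y₀, DifferentiableAt ℝ φ z :=
    hφs.mono fun z hz => hz.differentiableAt (by simp)
  -- the differential of `Φ` in the charts
  have hdiff : ∀ᶠ z in 𝓝 y₀, ∀ u, (mfderiv (𝓡 n) (𝓡 n) Φ ((extChartAt (𝓡 n) p).symm (φ z))
      (paramDeriv p (φ z) (fderiv ℝ φ z u)) : EuclideanSpace ℝ (Fin n)) = paramDeriv q z u := by
    have : IsManifold (𝓡 n) 1 M := IsManifold.of_le (n := ∞) (by simp)
    filter_upwards [hpt.eventually_nhds, hφd] with z hz hd u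
    have hd' : MDifferentiableAt 𝓘(ℝ, EuclideanSpace ℝ (Fin n)) 𝓘(ℝ, EuclideanSpace ℝ (Fin n)) φ z :=
      hd.mdifferentiableAt
    have hψ : MDifferentiableAt 𝓘(ℝ, EuclideanSpace ℝ (Fin n)) (𝓡 n) (extChartAt (𝓡 n) p).symm
        (φ z) :=
      (mdifferentiableOn_extChartAt_symm _ hz.self_of_nhds.1).mdifferentiableAt
        (extChartAt_target_mem_nhds_of_mem p hz.self_of_nhds.1)
    have hΦ : MDifferentiableAt (𝓡 n) (𝓡 n) Φ ((extChartAt (𝓡 n) p).symm (φ z)) :=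
      (h.contMDiff _).mdifferentiableAt (by simp)
    have e1 := mfderiv_comp z (hΦ.comp (φ z) hψ) hd'
    have e2 := mfderiv_comp (φ z) hΦ hψ
    rw [e2, mfderiv_eq_fderiv] at e1
    have e3 : (Φ ∘ (extChartAt (𝓡 n) p).symm) ∘ φ =ᶠ[𝓝 z] (extChartAt (𝓡 n) q).symm :=
      hz.mono fun z' hz' => hz'.2.2
    have e4 : (mfderiv 𝓘(ℝ, EuclideanSpace ℝ (Fin n)) (𝓡 n)
        ((Φ ∘ (extChartAt (𝓡 n) p).symm) ∘ φ) z :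
        EuclideanSpace ℝ (Fin n) →L[ℝ] EuclideanSpace ℝ (Fin n)) = paramDerivModel q z :=
      e3.mfderiv_eq (I := 𝓘(ℝ, EuclideanSpace ℝ (Fin n))) (I' := 𝓡 n)
    exact congrArg (fun A : EuclideanSpace ℝ (Fin n) →L[ℝ] EuclideanSpace ℝ (Fin n) => A u)
      (e1.symm.trans e4)
  have hχs : ∀ᶠ z in 𝓝 y₀, ContMDiffAt (𝓡 n) 𝓘(ℝ, ℂ) ∞ χ ((extChartAt (𝓡 n) p).symm (φ z)) ∧
      χ ((extChartAt (𝓡 n) p).symm (φ z)) ≠ 0 := by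
    filter_upwards [hgood, hpt] with z ⟨_, _, h3, _, h5⟩ ⟨_, p2, p3⟩
    rw [← p2] at h5
    rw [← p3] at h3
    exact ⟨contMDiffAt_lineCoeff hL (QuantumMagnetic.smoothAt_frame h5)
      (QuantumMagnetic.frame_ne_zero h5) (h.smoothAt_frame _ _ h3),
      lineCoeff_ne_zero (finrank_fiber _) (QuantumMagnetic.frame_ne_zero h5)
        (h.pullSection_ne_zero h3)⟩
  set c : EuclideanSpace ℝ (Fin n) → ℂ :=
    fun z => χ ((extChartAt (𝓡 n) p).symm (φ z)) ^ (-k) with hc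
  have hcs : ∀ᶠ z in 𝓝 y₀, ContDiffAt ℝ ∞ (fun z => χ ((extChartAt (𝓡 n) p).symm z) ^ (-k)) (φ z) := by
    filter_upwards [hpt, hχs] with z ⟨p1, _, _⟩ ⟨h1, h2⟩
    exact contDiffAt_comp_symm p1 (ContMDiffAt.comp (g := fun z : ℂ => z ^ (-k)) _
      (contDiffAt_zpow_complex h2).contMDiffAt h1)
  have key : localHamiltonian k (chartForm g' q) (chartConn conn' q) (chartCoeff s q) y₀
      = c y₀ * localHamiltonian k (chartForm g p) (chartConn conn.toFun p)
          (chartCoeff (pullPow Ψ k s) p) (φ y₀) := by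
    have g₀ := hgood.self_of_nhds
    have p₀ := hpt.self_of_nhds
    have b₀ : (extChartAt (𝓡 n) p).symm (φ y₀) ∈ (trivializationAt ℂ L p).baseSet := by
      rw [p₀.2.1]
      exact g₀.2.2.2.2
    refine localHamiltonian_of_pullback ?_ (hφs.self_of_nhds.of_le (WithTop.coe_le_coe.2 (le_top (a := (4 : ℕ∞))))) ?_
      ((contDiffAt_chartForm hg p₀.1).of_le (WithTop.coe_le_coe.2 (le_top (a := (2 : ℕ∞))))) ?_
      ((contDiffAt_chartCoeff hs' p₀.1 b₀).of_le (WithTop.coe_le_coe.2 (le_top (a := (2 : ℕ∞)))))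
      ((contDiffAt_chartConn hL hconn p₀.1 b₀).differentiableAt (by simp)) ?_ ?_ ?_
    · filter_upwards [hpt, hdiff] with z ⟨p1, p2, p3⟩ hd
      ext u v
      rw [chartForm_apply, ContinuousLinearMap.bilinearComp_apply, chartForm_apply, ← h.metric]
      change formAt g' _ _ _ = formAt g' _ _ _
      rw [p3]
      exact congrArg₂ (fun a b => formAt g' _ a b) (hd u).symm (hd v).symm
    -- `dφ` is a right factor of the differential of the inverse chart at `q`, which is injective.
    · filter_upwards [hdiff, hgood] with z hd hz u v huv
      refine paramDeriv_injective hz.1 ?_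
      refine (hd u).symm.trans (Eq.trans ?_ (hd v))
      rw [huv]
    · filter_upwards [extChartAt_target_mem_nhds_of_mem p p₀.1] with z hz
      exact isMetricForm_chartForm hgs hgp hz
    · filter_upwards [hpt, hgood, hχs] with z ⟨p1, p2, p3⟩ ⟨_, _, h3, _, h5⟩ ⟨_, hχ0⟩
      rw [← p2] at h5
      have e1 : chartCoeff s q z = (s (Φ ((extChartAt (𝓡 n) p).symm (φ z)))).1
          (frame L' q (Φ ((extChartAt (𝓡 n) p).symm (φ z)))) := by rw [p3]; rfl
      rw [e1, ← pullPow_apply_pullSection Ψ, ← lineCoeff_smul (finrank_fiber _)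
        (QuantumMagnetic.frame_ne_zero h5) (pullSection Ψ (frame L' q) _)]
      exact LinePow.apply_smul _ hχ0 _
    · filter_upwards [hcs, hφd] with z h1 h2
      exact (h1.differentiableAt (by simp)).comp z h2
    -- The required formula for `dc` is the derivative of `χ^{-k}` combined with the law
    -- `connCoeff_smul` for the two connection forms.
    · filter_upwards [hcs, hφd, hpt, hχs, hdiff, hgood] with z h1 h2 ⟨p1, p2, p3⟩ ⟨h3, h4⟩ hd
        ⟨_, _, h6, _, h7⟩ u
      rw [← p2] at h7
      rw [← p3] at h6
      have e1 : fderiv ℝ c z u = fderiv ℝ (fun z => χ ((extChartAt (𝓡 n) p).symm z) ^ (-k)) (φ z)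
          (fderiv ℝ φ z u) :=
        congrArg (fun A => A u) (fderiv_comp z (h1.differentiableAt (by simp)) h2)
      have e2 := mvfderiv_paramDeriv p p1 (fun x => χ x ^ (-k)) (fderiv ℝ φ z u)
      rw [e1]
      refine e2.symm.trans ?_
      rw [mvfderiv_comp_deriv (mdifferentiableAt_of_smooth h3)
        (hasDerivAt_zpow (-k) _ (Or.inl h4))]
      have e3 : chartConn conn' q z u = connCoeff conn.toFun (pullSection Ψ (frame L' q))
          ((extChartAt (𝓡 n) p).symm (φ z)) (paramDeriv p (φ z) (fderiv ℝ φ z u)) := by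
        rw [← h.connCoeff_frame h6]
        have : ∀ (a b : N) (A B : EuclideanSpace ℝ (Fin n)), a = b → A = B →
            (connCoeff conn' (frame L' q) a : EuclideanSpace ℝ (Fin n) →L[ℝ] ℂ) A
              = (connCoeff conn' (frame L' q) b : EuclideanSpace ℝ (Fin n) →L[ℝ] ℂ) B := by
          rintro a _ A _ rfl rfl; rfl
        exact this _ _ _ _ p3.symm (hd u).symm
      have e4 := connCoeff_smul hconn h3 (QuantumMagnetic.smoothAt_frame h7)
        (h.smoothAt_frame _ _ h6) (h.pullSection_ne_zero h6)
        ((eventually_lineCoeff_smul hL (QuantumMagnetic.smoothAt_frame h7)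
          (QuantumMagnetic.frame_ne_zero h7) (pullSection Ψ (frame L' q))).mono fun _ h => h.symm)
        (paramDeriv p (φ z) (fderiv ℝ φ z u))
      rw [e3]
      have e5 : chartConn conn.toFun p (φ z) (fderiv ℝ φ z u) = connCoeff conn.toFun (frame L p)
          ((extChartAt (𝓡 n) p).symm (φ z)) (paramDeriv p (φ z) (fderiv ℝ φ z u)) := rfl
      rw [e5, hc]
      simp only
      rw [zpow_sub_one₀ h4]
      push_cast
      field_simp
      linear_combination (k : ℂ) * e4
  have hframe : frame L' q q = Ψ x (pullSection Ψ (frame L' q) x) := by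
    rw [pullSection, LinearIsometryEquiv.apply_symm_apply]
  have hχ0 : χ x ≠ 0 := lineCoeff_ne_zero (finrank_fiber x) (QuantumMagnetic.frame_ne_zero hxb)
    (h.pullSection_ne_zero hqb)
  have hχx : χ x • frame L p x = pullSection Ψ (frame L' q) x :=
    lineCoeff_smul (finrank_fiber x) (QuantumMagnetic.frame_ne_zero hxb) _
  -- At `q` the Hamiltonian is given by its own chart and frame. Both sides then carry the factor
  -- `χ^{-k}`, which is cancelled at the end.
  have hA := hamiltonian_apply_frame g' conn' s q (h.frame_ne_zero q x hqb) (by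
    filter_upwards [(trivializationAt ℂ L' q).open_baseSet.mem_nhds hqb] with y hy X
    exact h.powConn_apply_frame hL hconn hs hy X)
  rw [key, hframe, ← hχx, map_smul] at hA
  erw [LinePow.apply_smul _ hχ0] at hA
  have hcx : c y₀ = χ x ^ (-k) := by
    rw [hc]
    simp only [hφ₀, (extChartAt (𝓡 n) p).left_inv hx]
  rw [hcx, hφ₀] at hA
  exact mul_left_cancel₀ (zpow_ne_zero _ hχ0) hA

end Smooth

end IsBundleLocalIsometry

end LocalIsometry

/-! ### The Hamiltonian on smooth sections -/

section HamiltonianSmooth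

open Filter Topology

variable {n : ℕ} {M : Type*} [TopologicalSpace M] [T2Space M]
  [ChartedSpace (EuclideanSpace ℝ (Fin n)) M] [IsManifold (𝓡 n) ∞ M]
  {g : ContMDiffRiemannianMetric (𝓡 n) ∞ (EuclideanSpace ℝ (Fin n))
      (fun x : M => TangentSpace (𝓡 n) x)}
  {L : M → Type*} [∀ x, NormedAddCommGroup (L x)] [∀ x, InnerProductSpace ℂ (L x)]
  [TopologicalSpace (TotalSpace ℂ L)] [FiberBundle ℂ L] [VectorBundle ℂ ℂ L]
  [VectorBundle ℝ ℂ L] [ContMDiffVectorBundle ∞ ℂ L (𝓡 n)]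
  {conn : CovariantDerivative (𝓡 n) ℂ L}

theorem isBundleLocalIsometry_refl (g : FormField n M) (conn : ConnField n L) :
    IsBundleLocalIsometry (Φ := id) (L' := L) (fun x => LinearIsometryEquiv.refl ℂ (L x))
      g conn g conn where
  surjective := Function.surjective_id
  contMDiff := contMDiff_id
  exists_localInverse x := ⟨OpenPartialHomeomorph.refl M, trivial, fun _ _ => rfl,
    contMDiffOn_id⟩
  metric x X Y := by
    rw [mfderiv_id]
    rfl
  frame_ne_zero q x hx := frame_ne_zero hx
  smoothAt_frame q x hx := smoothAt_frame hx
  conn_frame q x hx X := by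
    rw [mfderiv_id]
    rfl

/-- The identity regarded as a local isometry. By definition each value of the Hamiltonian uses the
chart and frame at its own point; here one chart and one frame serve a whole neighbourhood, so that
the Hamiltonian of a smooth section is seen to be smooth. -/
theorem hamiltonian_apply_frame_of_mem (hL : IsSmoothHermitian n L)
    (hconn : IsHermitianConnection conn) {k : ℤ} {w : PowSection L k}
    (hw : w ∈ smoothSections n L k) {x p : M} (hx : x ∈ (extChartAt (𝓡 n) p).source)
    (hxb : x ∈ (trivializationAt ℂ L p).baseSet) :
    (hamiltonian g.inner conn.toFun w x).1 (frame L p x)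
      = localHamiltonian k (chartForm g.inner p) (chartConn conn.toFun p) (chartCoeff w p)
          (extChartAt (𝓡 n) p x) :=
  (isBundleLocalIsometry_refl g.inner conn.toFun).hamiltonian_apply g.contMDiff g.symm g.pos
    hL hconn hw hx hxb

theorem hamiltonian_mem_smoothSections (hL : IsSmoothHermitian n L)
    (hconn : IsHermitianConnection conn) {k : ℤ} {w : PowSection L k}
    (hw : w ∈ smoothSections n L k) :
    hamiltonian g.inner conn.toFun w ∈ smoothSections n L k := by
  refine mem_smoothSections_of_frames hL fun p => ?_
  have hp := FiberBundle.mem_baseSet_trivializationAt' (F := ℂ) (E := L) p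
  refine ⟨frame L p, smoothAt_frame hp, frame_ne_zero hp, ?_⟩
  have hy := mem_extChartAt_target (I := 𝓡 n) p
  have hb : (extChartAt (𝓡 n) p).symm (extChartAt (𝓡 n) p p)
      ∈ (trivializationAt ℂ L p).baseSet := by rwa [extChartAt_to_inv]
  have h1 := contDiffAt_localHamiltonian (k := k) (contDiffAt_chartForm g.contMDiff hy)
    (isMetricForm_chartForm g.symm g.pos hy) (contDiffAt_chartConn hL hconn hy hb)
    (contDiffAt_chartCoeff hw hy hb)
  refine (ContMDiffAt.comp p h1.contMDiffAt contMDiffAt_extChartAt).congr_of_eventuallyEq ?_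
  filter_upwards [(isOpen_extChartAt_source p).mem_nhds (mem_extChartAt_source (I := 𝓡 n) p),
    (trivializationAt ℂ L p).open_baseSet.mem_nhds hp] with x hx hxb
  exact hamiltonian_apply_frame_of_mem hL hconn hw hx hxb

theorem hamiltonian_add (hL : IsSmoothHermitian n L) (hconn : IsHermitianConnection conn) {k : ℤ}
    {w w' : PowSection L k} (hw : w ∈ smoothSections n L k) (hw' : w' ∈ smoothSections n L k) :
    hamiltonian g.inner conn.toFun (w + w')
      = hamiltonian g.inner conn.toFun w + hamiltonian g.inner conn.toFun w' := by
  funext p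
  have hp := FiberBundle.mem_baseSet_trivializationAt' (F := ℂ) (E := L) p
  have hy := mem_extChartAt_target (I := 𝓡 n) p
  have hs := mem_extChartAt_source (I := 𝓡 n) p
  have hb : (extChartAt (𝓡 n) p).symm (extChartAt (𝓡 n) p p)
      ∈ (trivializationAt ℂ L p).baseSet := by rwa [extChartAt_to_inv]
  refine LinePow.ext_of_apply_eq (finrank_fiber p) (frame_ne_zero hp) ?_
  rw [hamiltonian_apply_frame_of_mem hL hconn (Submodule.add_mem _ hw hw') hs hp]
  refine Eq.trans ?_ (congrArg₂ (· + ·) (hamiltonian_apply_frame_of_mem hL hconn hw hs hp)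
    (hamiltonian_apply_frame_of_mem hL hconn hw' hs hp)).symm
  exact localHamiltonian_add
    ((contDiffAt_chartCoeff hw hy hb).of_le (WithTop.coe_le_coe.2 (le_top (a := (2 : ℕ∞)))))
    ((contDiffAt_chartCoeff hw' hy hb).of_le (WithTop.coe_le_coe.2 (le_top (a := (2 : ℕ∞)))))
    ((contDiffAt_chartConn hL hconn hy hb).differentiableAt (by simp))

theorem hamiltonian_smul (hL : IsSmoothHermitian n L) (hconn : IsHermitianConnection conn) {k : ℤ}
    (c : ℂ) {w : PowSection L k} (hw : w ∈ smoothSections n L k) :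
    hamiltonian g.inner conn.toFun (c • w) = c • hamiltonian g.inner conn.toFun w := by
  funext p
  have hp := FiberBundle.mem_baseSet_trivializationAt' (F := ℂ) (E := L) p
  have hy := mem_extChartAt_target (I := 𝓡 n) p
  have hs := mem_extChartAt_source (I := 𝓡 n) p
  have hb : (extChartAt (𝓡 n) p).symm (extChartAt (𝓡 n) p p)
      ∈ (trivializationAt ℂ L p).baseSet := by rwa [extChartAt_to_inv]
  refine LinePow.ext_of_apply_eq (finrank_fiber p) (frame_ne_zero hp) ?_
  rw [hamiltonian_apply_frame_of_mem hL hconn (Submodule.smul_mem _ c hw) hs hp]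
  refine Eq.trans ?_ (congrArg (c * ·) (hamiltonian_apply_frame_of_mem hL hconn hw hs hp)).symm
  exact localHamiltonian_const_smul c
    ((contDiffAt_chartCoeff hw hy hb).of_le (WithTop.coe_le_coe.2 (le_top (a := (2 : ℕ∞)))))
    ((contDiffAt_chartConn hL hconn hy hb).differentiableAt (by simp))

theorem hamiltonian_sum (hL : IsSmoothHermitian n L) (hconn : IsHermitianConnection conn) {k : ℤ}
    {ι : Type*} (t : Finset ι) (c : ι → ℂ) {w : ι → PowSection L k}
    (hw : ∀ i, w i ∈ smoothSections n L k) :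
    hamiltonian g.inner conn.toFun (∑ i ∈ t, c i • w i)
      = ∑ i ∈ t, c i • hamiltonian g.inner conn.toFun (w i) := by
  classical
  induction t using Finset.induction_on with
  | empty =>
    have := hamiltonian_smul (g := g) hL hconn 0 (Submodule.zero_mem (smoothSections n L k))
    simpa using this
  | insert i t hi ih =>
    rw [Finset.sum_insert hi, Finset.sum_insert hi, hamiltonian_add hL hconn
      (Submodule.smul_mem _ _ (hw i)) (Submodule.sum_mem _ fun j _ => Submodule.smul_mem _ _ (hw j)),
      ih, hamiltonian_smul hL hconn _ (hw i)]

namespace IsBundleLocalIsometry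

variable {N : Type*} [TopologicalSpace N] [ChartedSpace (EuclideanSpace ℝ (Fin n)) N]
  [IsManifold (𝓡 n) ∞ N] {L' : N → Type*} [∀ x, NormedAddCommGroup (L' x)]
  [∀ x, InnerProductSpace ℂ (L' x)] [TopologicalSpace (TotalSpace ℂ L')] [FiberBundle ℂ L']
  {Φ : M → N} {Ψ : ∀ x, L x ≃ₗᵢ[ℂ] L' (Φ x)} {g' : FormField n N} {conn' : ConnField n L'}

/-- The Hamiltonian commutes with pullbacks along local isometries. -/
theorem pullPow_hamiltonian (h : IsBundleLocalIsometry Ψ g.inner conn.toFun g' conn')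
    (hL : IsSmoothHermitian n L) (hconn : IsHermitianConnection conn) {k : ℤ}
    {s : PowSection L' k} (hs : s ∈ smoothSections n L' k) :
    pullPow Ψ k (hamiltonian g' conn' s) = hamiltonian g.inner conn.toFun (pullPow Ψ k s) := by
  funext p
  have hp := FiberBundle.mem_baseSet_trivializationAt' (F := ℂ) (E := L) p
  have hx := mem_extChartAt_source (I := 𝓡 n) p
  refine LinePow.ext_of_apply_eq (finrank_fiber p) (QuantumMagnetic.frame_ne_zero hp) ?_
  rw [hamiltonian_apply_frame_of_mem hL hconn ((h.pullPow_mem_smoothSections hL).2 hs) hx hp]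
  exact h.hamiltonian_apply g.contMDiff g.symm g.pos hL hconn hs hx hp

end IsBundleLocalIsometry

end HamiltonianSmooth

/-! ### The Riemannian volume and local isometries -/

section Volume

open Filter Topology

theorem measurableSet_inter_preimage {α β : Type*} [TopologicalSpace α] [MeasurableSpace α]
    [OpensMeasurableSpace α] [TopologicalSpace β] [MeasurableSpace β] [BorelSpace β] {f : α → β}
    {s : Set α} {t : Set β} (hf : ContinuousOn f s) (hs : MeasurableSet s) (ht : MeasurableSet t) :
    MeasurableSet (s ∩ f ⁻¹' t) := by
  rw [← Subtype.image_preimage_coe s (f ⁻¹' t)]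
  exact hs.subtype_image (hf.domRestrict.measurable ht)

/-- An upper bound for a supremum of measures on the measurable subsets of a given set. -/
theorem iSup_measure_apply_le {α ι : Type*} [MeasurableSpace α] {μ : ι → Measure α} {ν : Measure α}
    {S : Set α} (hS : MeasurableSet S)
    (h : ∀ i, ∀ A ⊆ S, MeasurableSet A → μ i A ≤ ν A) {A : Set α} (hAS : A ⊆ S)
    (hA : MeasurableSet A) : (⨆ i, μ i) A ≤ ν A := by
  -- The supremum is the least upper bound among measures on the whole space; adding its own
  -- restriction to the complement of `S` turns the bound inside `S` into a global one.
  have h1 : (⨆ i, μ i) ≤ ν + (⨆ i, μ i).restrict Sᶜ := by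
    refine iSup_le fun i => Measure.le_iff.2 fun B hB => ?_
    rw [← measure_inter_add_sdiff B hS, Measure.add_apply, Measure.restrict_apply hB]
    refine add_le_add ((h i _ Set.inter_subset_right (hB.inter hS)).trans
      (measure_mono Set.inter_subset_left)) ?_
    rw [Set.sdiff_eq]
    exact (le_iSup μ i) _
  refine (h1 A).trans ?_
  rw [Measure.add_apply, Measure.restrict_apply hA]
  have : A ∩ Sᶜ = ∅ := by
    rw [← Set.sdiff_eq]
    exact Set.sdiff_eq_empty.2 hAS
  rw [this, measure_empty, add_zero]

section FormDet

variable {n : ℕ}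

theorem det_formMatrix_bilinearComp
    (B : EuclideanSpace ℝ (Fin n) →L[ℝ] EuclideanSpace ℝ (Fin n) →L[ℝ] ℝ)
    (P : EuclideanSpace ℝ (Fin n) →L[ℝ] EuclideanSpace ℝ (Fin n)) :
    (formMatrix (B.bilinearComp P P)).det = P.det ^ 2 * (formMatrix B).det := by
  have hDa : ∀ l j, LinearMap.toMatrix (EuclideanSpace.basisFun (Fin n) ℝ).toBasis
      (EuclideanSpace.basisFun (Fin n) ℝ).toBasis P.toLinearMap l j = P (stdVec j) l := by
    intro l j
    rw [LinearMap.toMatrix_apply, OrthonormalBasis.coe_toBasis_repr_apply,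
      OrthonormalBasis.coe_toBasis, EuclideanSpace.basisFun_repr, EuclideanSpace.basisFun_apply]
    rfl
  have h2 : (LinearMap.toMatrix (EuclideanSpace.basisFun (Fin n) ℝ).toBasis
      (EuclideanSpace.basisFun (Fin n) ℝ).toBasis P.toLinearMap).det = P.det :=
    LinearMap.det_toMatrix _ _
  generalize LinearMap.toMatrix (EuclideanSpace.basisFun (Fin n) ℝ).toBasis
    (EuclideanSpace.basisFun (Fin n) ℝ).toBasis P.toLinearMap = D at hDa h2
  have h1 : formMatrix (B.bilinearComp P P) = D.transpose * formMatrix B * D := by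
    ext i j
    rw [Matrix.mul_apply]
    have h3 : ∀ m, (D.transpose * formMatrix B) i m = B (P (stdVec i)) (stdVec m) := fun m => by
      rw [Matrix.mul_apply, formMatrix_mul_apply]
      simp only [Matrix.transpose_apply, hDa]
    have h4 : formMatrix (B.bilinearComp P P) i j = B (P (stdVec i)) (P (stdVec j)) := rfl
    rw [h4, sum_coord_smul_single (P (stdVec j)), map_sum]
    refine Finset.sum_congr rfl fun m _ => ?_
    rw [map_smul, h3, hDa, smul_eq_mul, mul_comm]
  rw [h1, Matrix.det_mul, Matrix.det_mul, Matrix.det_transpose, h2]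
  ring

end FormDet

variable {n : ℕ} {N : Type*} [TopologicalSpace N] [ChartedSpace (EuclideanSpace ℝ (Fin n)) N]

/-- The volume density in the preferred chart at `p`. -/
def volumeDensity (g : FormField n N) (p : N) (y : EuclideanSpace ℝ (Fin n)) : ℝ≥0∞ :=
  ENNReal.ofReal (Real.sqrt (gram g p ((extChartAt (𝓡 n) p).symm y)).det)

/-- The Riemannian volume on the domain of the preferred chart at `p`. -/
def localVolume (g : FormField n N) (p : N) : @Measure N (borel N) :=
  letI : MeasurableSpace N := borel N
  Measure.map (extChartAt (𝓡 n) p).symm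
    (((volume : Measure (EuclideanSpace ℝ (Fin n))).restrict
        (extChartAt (𝓡 n) p).target).withDensity (volumeDensity g p))

theorem riemannianVolume_eq_iSup (g : FormField n N) :
    riemannianVolume g = ⨆ p, localVolume g p := rfl

theorem localVolume_le (g : FormField n N) (p : N) : localVolume g p ≤ riemannianVolume g :=
  le_iSup (localVolume g) p

theorem localVolume_apply (g : FormField n N) (p : N) {A : Set N} (hA : MeasurableSet[borel N] A) :
    localVolume g p A = ∫⁻ y in (extChartAt (𝓡 n) p).target ∩ (extChartAt (𝓡 n) p).symm ⁻¹' A,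
      volumeDensity g p y := by
  let _ : MeasurableSpace N := borel N
  have : BorelSpace N := ⟨rfl⟩
  have hT : MeasurableSet (extChartAt (𝓡 n) p).target := (isOpen_extChartAt_target p).measurableSet
  have h1 : AEMeasurable (extChartAt (𝓡 n) p).symm
      ((volume : Measure (EuclideanSpace ℝ (Fin n))).restrict (extChartAt (𝓡 n) p).target) :=
    (continuousOn_extChartAt_symm p).aemeasurable hT
  rw [localVolume, Measure.map_apply_of_aemeasurable
    (h1.mono_ac (withDensity_absolutelyContinuous _ _)) hA, withDensity_apply',
    Measure.restrict_restrict' hT, Set.inter_comm]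

theorem localVolume_inter_source (g : FormField n N) (p : N) {A : Set N}
    (hA : MeasurableSet[borel N] A) :
    localVolume g p A = localVolume g p (A ∩ (extChartAt (𝓡 n) p).source) := by
  let _ : MeasurableSpace N := borel N
  have : BorelSpace N := ⟨rfl⟩
  rw [localVolume_apply g p hA,
    localVolume_apply g p (hA.inter (isOpen_extChartAt_source p).measurableSet)]
  congr 2
  ext y
  simp only [Set.mem_inter_iff, Set.mem_preimage]
  exact ⟨fun h => ⟨h.1, h.2, (extChartAt (𝓡 n) p).map_target h.1⟩, fun h => ⟨h.1, h.2.1⟩⟩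

namespace IsBundleLocalIsometry

variable [IsManifold (𝓡 n) ∞ N] {M : Type*} [TopologicalSpace M]
  [ChartedSpace (EuclideanSpace ℝ (Fin n)) M] [IsManifold (𝓡 n) ∞ M]
  {L : M → Type*} [∀ x, NormedAddCommGroup (L x)] [∀ x, InnerProductSpace ℂ (L x)]
  [TopologicalSpace (TotalSpace ℂ L)] [FiberBundle ℂ L]
  {L' : N → Type*} [∀ x, NormedAddCommGroup (L' x)]
  [∀ x, InnerProductSpace ℂ (L' x)] [TopologicalSpace (TotalSpace ℂ L')] [FiberBundle ℂ L']
  {Φ : M → N} {Ψ : ∀ x, L x ≃ₗᵢ[ℂ] L' (Φ x)} {g : FormField n M} {conn : ConnField n L}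
  {g' : FormField n N} {conn' : ConnField n L'}

/-- A local isometry in charts: it is differentiable and pulls back the metric. -/
theorem chartForm_eq (h : IsBundleLocalIsometry Ψ g conn g' conn') {p : M} {q : N}
    {y : EuclideanSpace ℝ (Fin n)} (hy : y ∈ (extChartAt (𝓡 n) p).target)
    (hq : Φ ((extChartAt (𝓡 n) p).symm y) ∈ (extChartAt (𝓡 n) q).source) :
    DifferentiableAt ℝ (fun y => extChartAt (𝓡 n) q (Φ ((extChartAt (𝓡 n) p).symm y))) y ∧
    chartForm g p y = (chartForm g' q (extChartAt (𝓡 n) q (Φ ((extChartAt (𝓡 n) p).symm y)))).bilinearComp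
      (fderiv ℝ (fun y => extChartAt (𝓡 n) q (Φ ((extChartAt (𝓡 n) p).symm y))) y)
      (fderiv ℝ (fun y => extChartAt (𝓡 n) q (Φ ((extChartAt (𝓡 n) p).symm y))) y) := by
  have : IsManifold (𝓡 n) 1 M := IsManifold.of_le (n := ∞) (by simp)
  have : IsManifold (𝓡 n) 1 N := IsManifold.of_le (n := ∞) (by simp)
  set φ : EuclideanSpace ℝ (Fin n) → EuclideanSpace ℝ (Fin n) :=
    fun y => extChartAt (𝓡 n) q (Φ ((extChartAt (𝓡 n) p).symm y)) with hφ
  have a1 : ContMDiffAt (𝓡 n) 𝓘(ℝ, EuclideanSpace ℝ (Fin n)) ∞ (extChartAt (𝓡 n) q)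
      (Φ ((extChartAt (𝓡 n) p).symm y)) :=
    contMDiffAt_extChartAt' (by rwa [extChartAt_source] at hq)
  have hd : DifferentiableAt ℝ φ y :=
    (contDiffAt_comp_symm hy (a1.comp _ (h.contMDiff _))).differentiableAt (by simp)
  refine ⟨hd, ?_⟩
  have hψp : MDifferentiableAt 𝓘(ℝ, EuclideanSpace ℝ (Fin n)) (𝓡 n) (extChartAt (𝓡 n) p).symm y :=
    (mdifferentiableOn_extChartAt_symm _ hy).mdifferentiableAt
      (extChartAt_target_mem_nhds_of_mem p hy)
  have hqt : φ y ∈ (extChartAt (𝓡 n) q).target := (extChartAt (𝓡 n) q).map_source hq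
  have hψq : MDifferentiableAt 𝓘(ℝ, EuclideanSpace ℝ (Fin n)) (𝓡 n) (extChartAt (𝓡 n) q).symm
      (φ y) :=
    (mdifferentiableOn_extChartAt_symm _ hqt).mdifferentiableAt
      (extChartAt_target_mem_nhds_of_mem q hqt)
  have hΦ : MDifferentiableAt (𝓡 n) (𝓡 n) Φ ((extChartAt (𝓡 n) p).symm y) :=
    (h.contMDiff _).mdifferentiableAt (by simp)
  have e1 := mfderiv_comp y hΦ hψp
  have e2 := mfderiv_comp y hψq hd.mdifferentiableAt
  rw [mfderiv_eq_fderiv] at e2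
  have e3 : (extChartAt (𝓡 n) q).symm ∘ φ =ᶠ[𝓝 y] Φ ∘ (extChartAt (𝓡 n) p).symm := by
    have hc : ContinuousAt (fun y => Φ ((extChartAt (𝓡 n) p).symm y)) y :=
      (h.contMDiff.continuous.continuousAt).comp (continuousAt_extChartAt_symm'' hy)
    filter_upwards [hc.eventually ((isOpen_extChartAt_source q).mem_nhds hq)] with z hz
    exact (extChartAt (𝓡 n) q).left_inv hz
  have e4 : (mfderiv 𝓘(ℝ, EuclideanSpace ℝ (Fin n)) (𝓡 n) ((extChartAt (𝓡 n) q).symm ∘ φ) y :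
      EuclideanSpace ℝ (Fin n) →L[ℝ] EuclideanSpace ℝ (Fin n))
      = mfderiv 𝓘(ℝ, EuclideanSpace ℝ (Fin n)) (𝓡 n) (Φ ∘ (extChartAt (𝓡 n) p).symm) y :=
    e3.mfderiv_eq (I := 𝓘(ℝ, EuclideanSpace ℝ (Fin n))) (I' := 𝓡 n)
  have e5 : ∀ u, (paramDeriv q (φ y) (fderiv ℝ φ y u) : EuclideanSpace ℝ (Fin n))
      = mfderiv (𝓡 n) (𝓡 n) Φ ((extChartAt (𝓡 n) p).symm y) (paramDeriv p y u) := fun u =>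
    congrArg (fun A : EuclideanSpace ℝ (Fin n) →L[ℝ] EuclideanSpace ℝ (Fin n) => A u)
      (e2.symm.trans (e4.trans e1))
  ext u v
  rw [chartForm_apply, ContinuousLinearMap.bilinearComp_apply, chartForm_apply, ← h.metric]
  change formAt g' _ _ _ = formAt g' _ _ _
  rw [(extChartAt (𝓡 n) q).left_inv hq]
  exact congrArg₂ (fun a b => formAt g' _ a b) (e5 u).symm (e5 v).symm

/-- A local isometry preserves the volume of subsets of a chart. -/
theorem localVolume_image (h : IsBundleLocalIsometry Ψ g conn g' conn')
    {Θ : OpenPartialHomeomorph M N} (hΘ : Set.EqOn Θ Φ Θ.source) {p : M} {q : N} {A : Set M}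
    (hA : MeasurableSet[borel M] A) (hA₁ : A ⊆ Θ.source) (hA₂ : A ⊆ (extChartAt (𝓡 n) p).source)
    (hA₃ : ∀ x ∈ A, Φ x ∈ (extChartAt (𝓡 n) q).source) :
    MeasurableSet[borel N] (Φ '' A) ∧ localVolume g' q (Φ '' A) = localVolume g p A := by
  let _ : MeasurableSpace N := borel N
  have : BorelSpace N := ⟨rfl⟩
  let _ : MeasurableSpace M := borel M
  have : BorelSpace M := ⟨rfl⟩
  have hinj : Set.InjOn Φ A := fun x hx y hy hxy => Θ.injOn (hA₁ hx) (hA₁ hy) (by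
    rw [hΘ (hA₁ hx), hΘ (hA₁ hy), hxy])
  have himg : Φ '' A = Θ.target ∩ Θ.symm ⁻¹' A := by
    rw [← Θ.image_source_inter_eq', Set.inter_eq_right.2 hA₁]
    exact Set.image_congr fun x hx => (hΘ (hA₁ hx)).symm
  have hm : MeasurableSet (Φ '' A) := by
    rw [himg]
    exact measurableSet_inter_preimage Θ.continuousOn_symm Θ.open_target.measurableSet hA
  refine ⟨hm, ?_⟩
  rw [localVolume_apply g' q hm, localVolume_apply g p hA]
  set W := (extChartAt (𝓡 n) p).target ∩ (extChartAt (𝓡 n) p).symm ⁻¹' A with hW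
  have hWm : MeasurableSet W := measurableSet_inter_preimage (continuousOn_extChartAt_symm p)
    (isOpen_extChartAt_target p).measurableSet hA
  set φ : EuclideanSpace ℝ (Fin n) → EuclideanSpace ℝ (Fin n) :=
    fun y => extChartAt (𝓡 n) q (Φ ((extChartAt (𝓡 n) p).symm y)) with hφ
  have hφi : φ '' W = (extChartAt (𝓡 n) q).target ∩ (extChartAt (𝓡 n) q).symm ⁻¹' (Φ '' A) := by
    ext z
    constructor
    · rintro ⟨y, ⟨hy, hyA⟩, rfl⟩
      have h1 := hA₃ _ hyA
      refine ⟨(extChartAt (𝓡 n) q).map_source h1, ?_⟩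
      rw [Set.mem_preimage, (extChartAt (𝓡 n) q).left_inv h1]
      exact ⟨_, hyA, rfl⟩
    · rintro ⟨hz, x, hxA, hx⟩
      refine ⟨extChartAt (𝓡 n) p x, ⟨(extChartAt (𝓡 n) p).map_source (hA₂ hxA), ?_⟩, ?_⟩
      · rwa [Set.mem_preimage, (extChartAt (𝓡 n) p).left_inv (hA₂ hxA)]
      · rw [hφ]
        simp only [(extChartAt (𝓡 n) p).left_inv (hA₂ hxA), hx]
        exact (extChartAt (𝓡 n) q).right_inv hz
  have hφinj : Set.InjOn φ W := by
    rintro y ⟨hy, hyA⟩ z ⟨hz, hzA⟩ hyz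
    have h1 := (extChartAt (𝓡 n) q).injOn (hA₃ _ hyA) (hA₃ _ hzA) hyz
    exact (extChartAt (𝓡 n) p).symm.injOn hy hz (hinj hyA hzA h1)
  have hφd : ∀ y ∈ W, HasFDerivWithinAt φ (fderiv ℝ φ y) W y := fun y hy =>
    (h.chartForm_eq hy.1 (hA₃ _ hy.2)).1.hasFDerivAt.hasFDerivWithinAt
  -- The Jacobian `|det dφ|` from the change of variables is absorbed by the density, since `det g`
  -- is multiplied by `(det dφ)²`.
  rw [← hφi, lintegral_image_eq_lintegral_abs_det_fderiv_mul volume hWm hφd hφinj]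
  refine setLIntegral_congr_fun hWm fun y hy => ?_
  have h1 := (h.chartForm_eq hy.1 (hA₃ _ hy.2)).2
  have h2 : φ y ∈ (extChartAt (𝓡 n) q).target := (extChartAt (𝓡 n) q).map_source (hA₃ _ hy.2)
  simp only [volumeDensity]
  rw [gram_symm g p hy.1, gram_symm g' q h2, h1, det_formMatrix_bilinearComp,
    Real.sqrt_mul (sq_nonneg _), Real.sqrt_sq_eq_abs, ENNReal.ofReal_mul (abs_nonneg _)]

end IsBundleLocalIsometry

end Volume

/-! ### Comparison of volumes and of square integrable sections -/

section VolumeComparison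

open Filter Topology

variable {n : ℕ}

theorem exists_finset_charts (N : Type*) [TopologicalSpace N] [CompactSpace N]
    [ChartedSpace (EuclideanSpace ℝ (Fin n)) N] :
    ∃ P : Finset N, ∀ x, ∃ p ∈ P, x ∈ (extChartAt (𝓡 n) p).source := by
  obtain ⟨P, hP⟩ := CompactSpace.elim_nhds_subcover (fun p : N => (extChartAt (𝓡 n) p).source)
    fun p => extChartAt_source_mem_nhds p
  refine ⟨P, fun x => ?_⟩
  have : x ∈ ⋃ p ∈ P, (extChartAt (𝓡 n) p).source := by rw [hP]; trivial
  simpa using this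

namespace IsBundleLocalIsometry

variable {N : Type*} [TopologicalSpace N] [ChartedSpace (EuclideanSpace ℝ (Fin n)) N]
  [IsManifold (𝓡 n) ∞ N] {M : Type*} [TopologicalSpace M]
  [ChartedSpace (EuclideanSpace ℝ (Fin n)) M] [IsManifold (𝓡 n) ∞ M]
  {L : M → Type*} [∀ x, NormedAddCommGroup (L x)] [∀ x, InnerProductSpace ℂ (L x)]
  [TopologicalSpace (TotalSpace ℂ L)] [FiberBundle ℂ L]
  {L' : N → Type*} [∀ x, NormedAddCommGroup (L' x)]
  [∀ x, InnerProductSpace ℂ (L' x)] [TopologicalSpace (TotalSpace ℂ L')] [FiberBundle ℂ L']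
  {Φ : M → N} {Ψ : ∀ x, L x ≃ₗᵢ[ℂ] L' (Φ x)} {g : FormField n M} {conn : ConnField n L}
  {g' : FormField n N} {conn' : ConnField n L'}

theorem measurableSet_image {Θ : OpenPartialHomeomorph M N}
    (hΘ : Set.EqOn Θ Φ Θ.source) {A : Set M} (hA : MeasurableSet[borel M] A)
    (hAΘ : A ⊆ Θ.source) : Φ '' A = Θ.target ∩ Θ.symm ⁻¹' A ∧ MeasurableSet[borel N] (Φ '' A) := by
  let _ : MeasurableSpace N := borel N
  have : BorelSpace N := ⟨rfl⟩
  let _ : MeasurableSpace M := borel M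
  have : BorelSpace M := ⟨rfl⟩
  have himg : Φ '' A = Θ.target ∩ Θ.symm ⁻¹' A := by
    rw [← Θ.image_source_inter_eq', Set.inter_eq_right.2 hAΘ]
    exact Set.image_congr fun x hx => (hΘ (hAΘ hx)).symm
  refine ⟨himg, ?_⟩
  rw [himg]
  exact measurableSet_inter_preimage Θ.continuousOn_symm Θ.open_target.measurableSet hA

/-- Cut `A` along a finite atlas of `M`; the local volume of the image of each piece equals a local
volume of the piece, so `C` is the number of charts. Accepting such a constant avoids comparing the
local measures on overlaps. -/
theorem exists_volume_image_le [CompactSpace M] (h : IsBundleLocalIsometry Ψ g conn g' conn') :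
    ∃ C : ℕ, ∀ Θ : OpenPartialHomeomorph M N, Set.EqOn Θ Φ Θ.source → ∀ A ⊆ Θ.source,
      MeasurableSet[borel M] A →
      riemannianVolume g' (Φ '' A) ≤ C * riemannianVolume g A := by
  let _ : MeasurableSpace N := borel N
  have : BorelSpace N := ⟨rfl⟩
  let _ : MeasurableSpace M := borel M
  have : BorelSpace M := ⟨rfl⟩
  obtain ⟨P, hP⟩ := exists_finset_charts (n := n) M
  refine ⟨P.card, fun Θ hΘ A hAΘ hA => ?_⟩
  have hsm : MeasurableSet Θ.source := Θ.open_source.measurableSet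
  have hΘm : AEMeasurable Θ ((riemannianVolume g).restrict Θ.source) :=
    Θ.continuousOn.aemeasurable hsm
  have key : ∀ q, ∀ A ⊆ Θ.source, MeasurableSet A →
      localVolume g' q (Φ '' A) ≤ P.card * riemannianVolume g A := by
    intro q A hAΘ hA
    rw [localVolume_inter_source g' q (measurableSet_image hΘ hA hAΘ).2]
    have hs : ∀ p, A ∩ (extChartAt (𝓡 n) p).source ∩ Φ ⁻¹' (extChartAt (𝓡 n) q).source ⊆ A :=
      fun p => Set.inter_subset_left.trans Set.inter_subset_left
    have h1 : ∀ p, MeasurableSet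
        (A ∩ (extChartAt (𝓡 n) p).source ∩ Φ ⁻¹' (extChartAt (𝓡 n) q).source) := fun p =>
      (hA.inter (isOpen_extChartAt_source p).measurableSet).inter
        ((isOpen_extChartAt_source q).preimage h.contMDiff.continuous).measurableSet
    have h2 : Φ '' A ∩ (extChartAt (𝓡 n) q).source ⊆ ⋃ p ∈ P, Φ ''
        (A ∩ (extChartAt (𝓡 n) p).source ∩ Φ ⁻¹' (extChartAt (𝓡 n) q).source) := by
      rintro _ ⟨⟨x, hx, rfl⟩, hxq⟩
      obtain ⟨p, hp, hxp⟩ := hP x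
      exact Set.mem_biUnion hp ⟨x, ⟨⟨hx, hxp⟩, hxq⟩, rfl⟩
    refine (measure_mono h2).trans ((measure_biUnion_finset_le P _).trans ?_)
    refine (Finset.sum_le_card_nsmul P _ (riemannianVolume g A) fun p _ => ?_).trans
      (nsmul_eq_mul _ _).le
    rw [(h.localVolume_image hΘ (h1 p) ((hs p).trans hAΘ)
      (Set.inter_subset_left.trans Set.inter_subset_right) fun x hx => hx.2).2]
    exact (localVolume_le g p _).trans (measure_mono (hs p))
  -- A value of a supremum of measures need not be the supremum of the values, so the bound is first
  -- made an inequality of measures, with the volume of `M` transported by `Θ`.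
  have h3 := iSup_measure_apply_le (μ := localVolume g')
    (ν := (P.card : ℝ≥0∞) • Measure.map Θ ((riemannianVolume g).restrict Θ.source))
    (S := Θ.target) Θ.open_target.measurableSet (fun q B hBΘ hB => ?_)
    (A := Φ '' A) (by
      rw [(measurableSet_image hΘ hA hAΘ).1]
      exact Set.inter_subset_left) (measurableSet_image hΘ hA hAΘ).2
  · rw [← riemannianVolume_eq_iSup, Measure.smul_apply, smul_eq_mul,
      Measure.map_apply_of_aemeasurable hΘm (measurableSet_image hΘ hA hAΘ).2,
      Measure.restrict_apply' hsm] at h3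
    refine h3.trans (le_of_eq ?_)
    congr 2
    ext x
    constructor
    · rintro ⟨⟨x', hx', hxx⟩, hx⟩
      rw [hΘ hx] at hxx
      have : x' = x := Θ.injOn (hAΘ hx') hx (by rw [hΘ (hAΘ hx'), hΘ hx, hxx])
      rwa [← this]
    · intro hx
      exact ⟨⟨x, hx, (hΘ (hAΘ hx)).symm⟩, hAΘ hx⟩
  · rw [Measure.smul_apply, smul_eq_mul, Measure.map_apply_of_aemeasurable hΘm hB,
      Measure.restrict_apply' hsm, Set.inter_comm]
    have hB' : Φ '' (Θ.source ∩ Θ ⁻¹' B) = B := by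
      ext y
      constructor
      · rintro ⟨x, ⟨hx, hxB⟩, rfl⟩
        rw [← hΘ hx]
        exact hxB
      · intro hy
        have hr : Θ (Θ.symm y) = y := Θ.right_inv (hBΘ hy)
        refine ⟨Θ.symm y, ⟨Θ.map_target (hBΘ hy), ?_⟩, ?_⟩
        · rwa [Set.mem_preimage, hr]
        · rw [← hΘ (Θ.map_target (hBΘ hy)), hr]
    have := key q (Θ.source ∩ Θ ⁻¹' B) Set.inter_subset_left
      (measurableSet_inter_preimage Θ.continuousOn hsm hB)
    rwa [hB'] at this

/-- The same estimate in the other direction, with a finite atlas of `N` and the measure transported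
by the inverse of `Θ`. -/
theorem exists_volume_le_image [CompactSpace N] (h : IsBundleLocalIsometry Ψ g conn g' conn') :
    ∃ C : ℕ, ∀ Θ : OpenPartialHomeomorph M N, Set.EqOn Θ Φ Θ.source → ∀ A ⊆ Θ.source,
      MeasurableSet[borel M] A →
      riemannianVolume g A ≤ C * riemannianVolume g' (Φ '' A) := by
  let _ : MeasurableSpace N := borel N
  have : BorelSpace N := ⟨rfl⟩
  let _ : MeasurableSpace M := borel M
  have : BorelSpace M := ⟨rfl⟩
  obtain ⟨P, hP⟩ := exists_finset_charts (n := n) N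
  refine ⟨P.card, fun Θ hΘ A hAΘ hA => ?_⟩
  have htm : MeasurableSet Θ.target := Θ.open_target.measurableSet
  have hΘm : AEMeasurable Θ.symm ((riemannianVolume g').restrict Θ.target) :=
    Θ.continuousOn_symm.aemeasurable htm
  have hκ : ∀ A ⊆ Θ.source, MeasurableSet A →
      ((P.card : ℝ≥0∞) • Measure.map Θ.symm ((riemannianVolume g').restrict Θ.target)) A
        = P.card * riemannianVolume g' (Φ '' A) := by
    intro A hAΘ hA
    rw [Measure.smul_apply, smul_eq_mul, Measure.map_apply_of_aemeasurable hΘm hA,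
      Measure.restrict_apply' htm, Set.inter_comm, ← (measurableSet_image hΘ hA hAΘ).1]
  have h3 := iSup_measure_apply_le (μ := localVolume g)
    (ν := (P.card : ℝ≥0∞) • Measure.map Θ.symm ((riemannianVolume g').restrict Θ.target))
    (S := Θ.source) Θ.open_source.measurableSet (fun p A hAΘ hA => ?_) (A := A) hAΘ hA
  · rwa [hκ A hAΘ hA, ← riemannianVolume_eq_iSup] at h3
  · rw [hκ A hAΘ hA, localVolume_inter_source g p hA]
    have hs : ∀ q, A ∩ (extChartAt (𝓡 n) p).source ∩ Φ ⁻¹' (extChartAt (𝓡 n) q).source ⊆ A :=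
      fun p => Set.inter_subset_left.trans Set.inter_subset_left
    have h1 : ∀ q, MeasurableSet
        (A ∩ (extChartAt (𝓡 n) p).source ∩ Φ ⁻¹' (extChartAt (𝓡 n) q).source) := fun q =>
      (hA.inter (isOpen_extChartAt_source p).measurableSet).inter
        ((isOpen_extChartAt_source q).preimage h.contMDiff.continuous).measurableSet
    have h2 : A ∩ (extChartAt (𝓡 n) p).source ⊆ ⋃ q ∈ P,
        (A ∩ (extChartAt (𝓡 n) p).source ∩ Φ ⁻¹' (extChartAt (𝓡 n) q).source) := by
      intro x hx
      obtain ⟨q, hq, hxq⟩ := hP (Φ x)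
      exact Set.mem_biUnion hq ⟨hx, hxq⟩
    refine (measure_mono h2).trans ((measure_biUnion_finset_le P _).trans ?_)
    refine (Finset.sum_le_card_nsmul P _ (riemannianVolume g' (Φ '' A)) fun q _ => ?_).trans
      (nsmul_eq_mul _ _).le
    rw [← (h.localVolume_image hΘ (h1 q) ((hs q).trans hAΘ)
      (Set.inter_subset_left.trans Set.inter_subset_right) fun x hx => hx.2).2]
    exact (localVolume_le g' q _).trans (measure_mono (Set.image_mono (hs q)))

/-- A finite family of local inverses of `Φ` whose domains cover `M`. -/
theorem exists_finset_localInverse [CompactSpace M]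
    (h : IsBundleLocalIsometry Ψ g conn g' conn') :
    ∃ (P : Finset M) (Θ : M → OpenPartialHomeomorph M N),
      (∀ p, Set.EqOn (Θ p) Φ (Θ p).source) ∧ ∀ x, ∃ p ∈ P, x ∈ (Θ p).source := by
  choose Θ h1 h2 h3 using h.exists_localInverse
  obtain ⟨P, hP⟩ := CompactSpace.elim_nhds_subcover (fun p : M => (Θ p).source)
    fun p => (Θ p).open_source.mem_nhds (h1 p)
  refine ⟨P, Θ, h2, fun x => ?_⟩
  have : x ∈ ⋃ p ∈ P, (Θ p).source := by rw [hP]; trivial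
  simpa using this

/-- Finitely many domains on which `Φ` is injective cover `M`, so the estimate for one domain is
multiplied by their number. -/
theorem exists_volume_le_map [CompactSpace M] (h : IsBundleLocalIsometry Ψ g conn g' conn') :
    ∃ C : ℕ, riemannianVolume g' ≤ (C : ℝ≥0∞) •
      @Measure.map M N (borel M) (borel N) Φ (riemannianVolume g) := by
  let _ : MeasurableSpace N := borel N
  have : BorelSpace N := ⟨rfl⟩
  let _ : MeasurableSpace M := borel M
  have : BorelSpace M := ⟨rfl⟩
  obtain ⟨C, hC⟩ := h.exists_volume_image_le
  obtain ⟨P, Θ, hΘ, hP⟩ := h.exists_finset_localInverse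
  refine ⟨P.card * C, Measure.le_iff.2 fun B hB => ?_⟩
  have hΦ : Measurable Φ := h.contMDiff.continuous.measurable
  have h1 : B ⊆ ⋃ p ∈ P, Φ '' ((Θ p).source ∩ Φ ⁻¹' B) := by
    intro y hy
    obtain ⟨x, rfl⟩ := h.surjective y
    obtain ⟨p, hp, hx⟩ := hP x
    exact Set.mem_biUnion hp ⟨x, ⟨hx, hy⟩, rfl⟩
  rw [Measure.smul_apply, Measure.map_apply hΦ hB, smul_eq_mul]
  refine (measure_mono h1).trans ((measure_biUnion_finset_le P _).trans ?_)
  refine (Finset.sum_le_card_nsmul P _ (C * riemannianVolume g (Φ ⁻¹' B)) fun p _ => ?_).trans ?_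
  · refine (hC (Θ p) (hΘ p) _ Set.inter_subset_left
      ((Θ p).open_source.measurableSet.inter (hΦ hB))).trans ?_
    gcongr
    exact Set.inter_subset_right
  · rw [nsmul_eq_mul, Nat.cast_mul, mul_assoc]

theorem exists_map_le_volume [CompactSpace M] [CompactSpace N]
    (h : IsBundleLocalIsometry Ψ g conn g' conn') :
    ∃ C : ℕ, @Measure.map M N (borel M) (borel N) Φ (riemannianVolume g)
      ≤ (C : ℝ≥0∞) • riemannianVolume g' := by
  let _ : MeasurableSpace N := borel N
  have : BorelSpace N := ⟨rfl⟩
  let _ : MeasurableSpace M := borel M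
  have : BorelSpace M := ⟨rfl⟩
  obtain ⟨C, hC⟩ := h.exists_volume_le_image
  obtain ⟨P, Θ, hΘ, hP⟩ := h.exists_finset_localInverse
  refine ⟨P.card * C, Measure.le_iff.2 fun B hB => ?_⟩
  have hΦ : Measurable Φ := h.contMDiff.continuous.measurable
  have h1 : Φ ⁻¹' B ⊆ ⋃ p ∈ P, ((Θ p).source ∩ Φ ⁻¹' B) := by
    intro x hx
    obtain ⟨p, hp, hxp⟩ := hP x
    exact Set.mem_biUnion hp ⟨hxp, hx⟩
  rw [Measure.smul_apply, Measure.map_apply hΦ hB, smul_eq_mul]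
  refine (measure_mono h1).trans ((measure_biUnion_finset_le P _).trans ?_)
  refine (Finset.sum_le_card_nsmul P _ (C * riemannianVolume g' B) fun p _ => ?_).trans ?_
  · refine (hC (Θ p) (hΘ p) _ Set.inter_subset_left
      ((Θ p).open_source.measurableSet.inter (hΦ hB))).trans ?_
    gcongr
    rintro _ ⟨x, hx, rfl⟩
    exact hx.2
  · rw [nsmul_eq_mul, Nat.cast_mul, mul_assoc]

/-- Measurability on `N` can be tested on `M`. -/
theorem aemeasurable_comp_iff [CompactSpace M] [CompactSpace N]
    (h : IsBundleLocalIsometry Ψ g conn g' conn') {β : Type*} [MeasurableSpace β] {f : N → β}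
    {V : Set N} (hV : IsOpen V) :
    @AEMeasurable M β _ (borel M) (fun x => f (Φ x))
        (@Measure.restrict M (borel M) (riemannianVolume g) (Φ ⁻¹' V))
      ↔ @AEMeasurable N β _ (borel N) f
        (@Measure.restrict N (borel N) (riemannianVolume g') V) := by
  let _ : MeasurableSpace N := borel N
  have : BorelSpace N := ⟨rfl⟩
  let _ : MeasurableSpace M := borel M
  have : BorelSpace M := ⟨rfl⟩
  have hΦ : Measurable Φ := h.contMDiff.continuous.measurable
  constructor
  · intro hf
    obtain ⟨C, hC⟩ := h.exists_volume_image_le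
    obtain ⟨P, Θ, hΘ, hP⟩ := h.exists_finset_localInverse
    have hcov : V ⊆ ⋃ p ∈ P, V ∩ (Θ p).target := by
      intro y hy
      obtain ⟨x, rfl⟩ := h.surjective y
      obtain ⟨p, hp, hx⟩ := hP x
      refine Set.mem_biUnion hp ⟨hy, ?_⟩
      rw [← hΘ p hx]
      exact (Θ p).map_source hx
    refine AEMeasurable.mono_measure ?_ (Measure.restrict_mono hcov le_rfl)
    rw [← Finset.set_biUnion_coe, Set.biUnion_eq_iUnion, aemeasurable_iUnion_iff]
    rintro ⟨p, -⟩
    have htm : MeasurableSet (V ∩ (Θ p).target) :=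
      hV.measurableSet.inter (Θ p).open_target.measurableSet
    have hs : AEMeasurable (Θ p).symm ((riemannianVolume g').restrict (V ∩ (Θ p).target)) :=
      ((Θ p).continuousOn_symm.mono Set.inter_subset_right).aemeasurable htm
    -- On each such domain `f` is `f ∘ Φ` composed with a local inverse. Domination of the
    -- transported measure ensures that exceptional null sets stay null.
    have hle : Measure.map (Θ p).symm ((riemannianVolume g').restrict (V ∩ (Θ p).target))
        ≤ (C : ℝ≥0∞) • (riemannianVolume g).restrict (Φ ⁻¹' V) := by
      refine Measure.le_iff.2 fun A hA => ?_
      rw [Measure.map_apply_of_aemeasurable hs hA, Measure.restrict_apply' htm, Measure.smul_apply,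
        smul_eq_mul, Measure.restrict_apply hA]
      have h1 : (Θ p).symm ⁻¹' A ∩ (V ∩ (Θ p).target)
          ⊆ Φ '' ((A ∩ Φ ⁻¹' V) ∩ (Θ p).source) := by
        rintro y ⟨hyA, hyV, hyt⟩
        have h2 : Φ ((Θ p).symm y) = y := by
          rw [← hΘ p ((Θ p).map_target hyt), (Θ p).right_inv hyt]
        exact ⟨(Θ p).symm y, ⟨⟨hyA, by rwa [Set.mem_preimage, h2]⟩, (Θ p).map_target hyt⟩, h2⟩
      refine (measure_mono h1).trans ((hC (Θ p) (hΘ p) _ Set.inter_subset_right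
        ((hA.inter (hΦ hV.measurableSet)).inter (Θ p).open_source.measurableSet)).trans ?_)
      exact mul_le_mul' le_rfl (measure_mono Set.inter_subset_left)
    have h2 := (hf.smul_measure (C : ℝ≥0∞)).mono_measure hle |>.comp_aemeasurable hs
    refine h2.congr ?_
    filter_upwards [ae_restrict_mem htm] with y hy
    rw [Function.comp_apply, ← hΘ p ((Θ p).map_target hy.2), (Θ p).right_inv hy.2]
  · intro hf
    obtain ⟨C, hC⟩ := h.exists_map_le_volume
    refine AEMeasurable.comp_aemeasurable (f := Φ) (g := f) ?_ hΦ.aemeasurable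
    refine (hf.smul_measure (C : ℝ≥0∞)).mono_measure ?_
    rw [← Measure.restrict_map hΦ hV.measurableSet, ← Measure.restrict_smul]
    exact Measure.restrict_mono le_rfl hC

/-- In this direction `lintegral_map_le` holds for every function; the reverse estimate below is for
measurable ones. -/
theorem exists_lintegral_le [CompactSpace M] (h : IsBundleLocalIsometry Ψ g conn g' conn') :
    ∃ C : ℕ, ∀ f : N → ℝ≥0∞, ∫⁻ y, f y ∂riemannianVolume g'
      ≤ C * ∫⁻ x, f (Φ x) ∂riemannianVolume g := by
  let _ : MeasurableSpace N := borel N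
  have : BorelSpace N := ⟨rfl⟩
  let _ : MeasurableSpace M := borel M
  have : BorelSpace M := ⟨rfl⟩
  have hΦ : Measurable Φ := h.contMDiff.continuous.measurable
  obtain ⟨C, hC⟩ := h.exists_volume_le_map
  refine ⟨C, fun f => (lintegral_mono' hC le_rfl).trans ?_⟩
  rw [lintegral_smul_measure, smul_eq_mul]
  gcongr
  exact lintegral_map_le f Φ

theorem exists_lintegral_comp_le [CompactSpace M] [CompactSpace N]
    (h : IsBundleLocalIsometry Ψ g conn g' conn') :
    ∃ C : ℕ, ∀ f : N → ℝ≥0∞, @AEMeasurable N _ _ (borel N) f (riemannianVolume g') →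
      ∫⁻ x, f (Φ x) ∂riemannianVolume g ≤ C * ∫⁻ y, f y ∂riemannianVolume g' := by
  let _ : MeasurableSpace N := borel N
  have : BorelSpace N := ⟨rfl⟩
  let _ : MeasurableSpace M := borel M
  have : BorelSpace M := ⟨rfl⟩
  have hΦ : Measurable Φ := h.contMDiff.continuous.measurable
  obtain ⟨C, hC⟩ := h.exists_map_le_volume
  refine ⟨C, fun f hf => ?_⟩
  rw [← lintegral_map' ((hf.smul_measure (C : ℝ≥0∞)).mono_measure hC) hΦ.aemeasurable]
  refine (lintegral_mono' hC le_rfl).trans ?_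
  rw [lintegral_smul_measure, smul_eq_mul]

end IsBundleLocalIsometry

end VolumeComparison

/-! ### Measurable sections and the `L²` norm -/

section MeasurableSections

open Filter Topology

namespace LinePow

variable {V : Type*} [NormedAddCommGroup V] [InnerProductSpace ℂ V] {k : ℤ}

theorem fiberNorm_add_le (f h : LinePow k V) : fiberNorm (f + h) ≤ fiberNorm f + fiberNorm h := by
  refine iSup₂_le fun u hu => ?_
  refine (enorm_add_le (f.1 u) (h.1 u)).trans (add_le_add ?_ ?_)
  · exact le_iSup₂ (f := fun (u : V) (_ : ‖u‖ = 1) => ‖f.1 u‖ₑ) u hu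
  · exact le_iSup₂ (f := fun (u : V) (_ : ‖u‖ = 1) => ‖h.1 u‖ₑ) u hu

theorem fiberNorm_smul (c : ℂ) (f : LinePow k V) : fiberNorm (c • f) = ‖c‖ₑ * fiberNorm f := by
  have h1 : ∀ u : V, ‖(c • f).1 u‖ₑ = ‖c‖ₑ * ‖f.1 u‖ₑ := fun u => enorm_mul c (f.1 u)
  simp only [fiberNorm, h1, ENNReal.mul_iSup]

end LinePow

theorem aemeasurable_restrict_of_forall_exists_isOpen {N β : Type*} [TopologicalSpace N]
    [CompactSpace N] [MeasurableSpace N] [MeasurableSpace β] {μ : Measure N} {f : N → β} {U : Set N}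
    (h : ∀ x, ∃ W, IsOpen W ∧ x ∈ W ∧ AEMeasurable f (μ.restrict (U ∩ W))) :
    AEMeasurable f (μ.restrict U) := by
  choose W hWo hxW hW using h
  obtain ⟨P, hP⟩ := CompactSpace.elim_nhds_subcover W fun x => (hWo x).mem_nhds (hxW x)
  have hcov : U ⊆ ⋃ p ∈ P, U ∩ W p := by
    intro x hx
    have : x ∈ ⋃ p ∈ P, W p := by rw [hP]; trivial
    obtain ⟨p, hp, hxp⟩ := Set.mem_iUnion₂.1 this
    exact Set.mem_biUnion hp ⟨hx, hxp⟩
  refine AEMeasurable.mono_measure ?_ (Measure.restrict_mono hcov le_rfl)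
  rw [← Finset.set_biUnion_coe, Set.biUnion_eq_iUnion, aemeasurable_iUnion_iff]
  exact fun p => hW p

variable {n : ℕ}

/-! ### Measurable sections and scaling of the norm. -/

section Norm

variable {N : Type*} [TopologicalSpace N] [ChartedSpace (EuclideanSpace ℝ (Fin n)) N]
  {L : N → Type*} [∀ x, NormedAddCommGroup (L x)] [∀ x, InnerProductSpace ℂ (L x)]
  [TopologicalSpace (TotalSpace ℂ L)] [FiberBundle ℂ L] {g : FormField n N} {k : ℤ}

/-- Sections of `L^{⊗k}` which are almost everywhere measurable. -/
def IsMeasurableSection (g : FormField n N) (w : PowSection L k) : Prop :=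
  letI : MeasurableSpace N := borel N
  ∀ p : N, AEMeasurable (fun x => (w x).1 (frame L p x))
    ((riemannianVolume g).restrict (trivializationAt ℂ L p).baseSet)

theorem IsMeasurableSection.sub {v w : PowSection L k} (hv : IsMeasurableSection g v)
    (hw : IsMeasurableSection g w) : IsMeasurableSection g (v - w) :=
  fun p => (hv p).sub (hw p)

theorem IsMeasurableSection.add {v w : PowSection L k} (hv : IsMeasurableSection g v)
    (hw : IsMeasurableSection g w) : IsMeasurableSection g (v + w) :=
  fun p => (hv p).add (hw p)

theorem IsMeasurableSection.smul {w : PowSection L k} (c : ℂ) (hw : IsMeasurableSection g w) :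
    IsMeasurableSection g (c • w) :=
  fun p => (hw p).const_smul c

theorem isMeasurableSection_zero : IsMeasurableSection g (0 : PowSection L k) :=
  fun _ => aemeasurable_const

theorem IsMeasurableSection.sum {ι : Type*} (t : Finset ι) {w : ι → PowSection L k}
    (hw : ∀ i, IsMeasurableSection g (w i)) : IsMeasurableSection g (∑ i ∈ t, w i) := by
  classical
  induction t using Finset.induction_on with
  | empty => simpa using isMeasurableSection_zero
  | insert i t hi ih => rw [Finset.sum_insert hi]; exact (hw i).add ih

theorem isMeasurableSection_of_smooth {w : PowSection L k} (hw : w ∈ smoothSections n L k) :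
    IsMeasurableSection g w := by
  let _ : MeasurableSpace N := borel N
  have : BorelSpace N := ⟨rfl⟩
  exact fun p => (hw p).continuousOn.aemeasurable
    (trivializationAt ℂ L p).open_baseSet.measurableSet

theorem l2Norm_smul (c : ℂ) (w : PowSection L k) : l2Norm g (c • w) = ‖c‖ₑ * l2Norm g w := by
  have h1 : ∀ x, LinePow.fiberNorm ((c • w) x) ^ 2 = ‖c‖ₑ ^ 2 * LinePow.fiberNorm (w x) ^ 2 :=
    fun x => by rw [Pi.smul_apply, LinePow.fiberNorm_smul, mul_pow]
  simp only [l2Norm, h1]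
  rw [lintegral_const_mul' _ _ (by finiteness), ENNReal.mul_rpow_of_nonneg _ _ (by norm_num)]
  congr 1
  rw [← ENNReal.rpow_natCast, ← ENNReal.rpow_mul]
  norm_num

end Norm

/-! ### Change of frame, the triangle inequality, and pullbacks. -/

section Frames

variable {M : Type*} [TopologicalSpace M] [CompactSpace M]
  [ChartedSpace (EuclideanSpace ℝ (Fin n)) M] [IsManifold (𝓡 n) ∞ M]
  {L : M → Type*} [∀ x, NormedAddCommGroup (L x)] [∀ x, InnerProductSpace ℂ (L x)]
  [TopologicalSpace (TotalSpace ℂ L)] [FiberBundle ℂ L] [VectorBundle ℂ ℂ L] [VectorBundle ℝ ℂ L]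
  [ContMDiffVectorBundle ∞ ℂ L (𝓡 n)] {g : FormField n M} {k : ℤ}

/-- The coefficient of a section in one frame is measurable if it is in another frame. -/
theorem aemeasurable_apply_frame (hL : IsSmoothHermitian n L) {w : PowSection L k}
    {e e' : ∀ x : M, L x} {U : Set M} (hU : IsOpen U) (he : ∀ x ∈ U, SmoothAt n e x ∧ e x ≠ 0)
    (he' : ∀ x ∈ U, SmoothAt n e' x ∧ e' x ≠ 0)
    (hw : @AEMeasurable M ℂ _ (borel M) (fun x => (w x).1 (e x))
      (@Measure.restrict M (borel M) (riemannianVolume g) U)) :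
    @AEMeasurable M ℂ _ (borel M) (fun x => (w x).1 (e' x))
      (@Measure.restrict M (borel M) (riemannianVolume g) U) := by
  let _ : MeasurableSpace M := borel M
  have : BorelSpace M := ⟨rfl⟩
  have hχ : ContinuousOn (fun x => lineCoeff (e x) (e' x) ^ (-k)) U := fun x hx =>
    ((contMDiffAt_lineCoeff hL (he x hx).1 (he x hx).2 (he' x hx).1).continuousAt.zpow₀ _
      (Or.inl (lineCoeff_ne_zero (finrank_fiber x) (he x hx).2 (he' x hx).2))).continuousWithinAt
  refine ((hχ.aemeasurable hU.measurableSet).mul hw).congr ?_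
  filter_upwards [ae_restrict_mem hU.measurableSet] with x hx
  have h0 := lineCoeff_ne_zero (finrank_fiber x) (he x hx).2 (he' x hx).2
  have h1 := lineCoeff_smul (finrank_fiber x) (he x hx).2 (e' x)
  rw [Pi.mul_apply, ← (w x).2.2 _ (e x) h0, h1]

theorem smoothAt_frame_and_ne_zero (p : M) : ∀ x ∈ (trivializationAt ℂ L p).baseSet,
    SmoothAt n (frame L p) x ∧ frame L p x ≠ 0 :=
  fun _ hx => ⟨smoothAt_frame hx, frame_ne_zero hx⟩

/-- By compactness finitely many preferred frames suffice, and on each of their domains the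
coefficients differ by a continuous transition function. -/
theorem IsMeasurableSection.apply_frame (hL : IsSmoothHermitian n L) {w : PowSection L k}
    (hw : IsMeasurableSection g w) {e : ∀ x : M, L x} {U : Set M} (hU : IsOpen U)
    (he : ∀ x ∈ U, SmoothAt n e x ∧ e x ≠ 0) :
    @AEMeasurable M ℂ _ (borel M) (fun x => (w x).1 (e x))
      (@Measure.restrict M (borel M) (riemannianVolume g) U) := by
  let _ : MeasurableSpace M := borel M
  have : BorelSpace M := ⟨rfl⟩
  refine aemeasurable_restrict_of_forall_exists_isOpen fun p =>
    ⟨_, (trivializationAt ℂ L p).open_baseSet, FiberBundle.mem_baseSet_trivializationAt' p, ?_⟩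
  exact aemeasurable_apply_frame hL (hU.inter (trivializationAt ℂ L p).open_baseSet)
    (fun x hx => smoothAt_frame_and_ne_zero p x hx.2) (fun x hx => he x hx.1)
    ((hw p).mono_measure (Measure.restrict_mono Set.inter_subset_right le_rfl))

theorem isMeasurableSection_of_frames (hL : IsSmoothHermitian n L) {w : PowSection L k}
    (h : ∀ p, ∃ (e : ∀ x : M, L x) (U : Set M), IsOpen U ∧ p ∈ U ∧
      (∀ x ∈ U, SmoothAt n e x ∧ e x ≠ 0) ∧ @AEMeasurable M ℂ _ (borel M) (fun x => (w x).1 (e x))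
        (@Measure.restrict M (borel M) (riemannianVolume g) U)) :
    IsMeasurableSection g w := by
  let _ : MeasurableSpace M := borel M
  have : BorelSpace M := ⟨rfl⟩
  intro q
  refine aemeasurable_restrict_of_forall_exists_isOpen fun p => ?_
  obtain ⟨e, U, hU, hp, he, hw⟩ := h p
  refine ⟨U, hU, hp, ?_⟩
  exact aemeasurable_apply_frame hL ((trivializationAt ℂ L q).open_baseSet.inter hU)
    (fun x hx => he x hx.2) (fun x hx => smoothAt_frame_and_ne_zero q x hx.1)
    (hw.mono_measure (Measure.restrict_mono Set.inter_subset_right le_rfl))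

theorem IsMeasurableSection.aemeasurable_fiberNorm (hL : IsSmoothHermitian n L)
    {w : PowSection L k} (hw : IsMeasurableSection g w) :
    @AEMeasurable M ℝ≥0∞ _ (borel M) (fun x => LinePow.fiberNorm (w x)) (riemannianVolume g) := by
  let _ : MeasurableSpace M := borel M
  have : BorelSpace M := ⟨rfl⟩
  rw [← Measure.restrict_univ (μ := riemannianVolume g)]
  refine aemeasurable_restrict_of_forall_exists_isOpen fun p =>
    ⟨_, (trivializationAt ℂ L p).open_baseSet, FiberBundle.mem_baseSet_trivializationAt' p, ?_⟩
  rw [Set.univ_inter]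
  have hm := (trivializationAt ℂ L p).open_baseSet.measurableSet
  have hc : ContinuousOn (fun x => ‖frame L p x‖) (trivializationAt ℂ L p).baseSet := by
    intro x hx
    have h1 := (hL x _ _ (smoothAt_frame hx) (smoothAt_frame hx)).continuousAt
    have h2 : (fun x => ‖frame L p x‖)
        = fun x => Real.sqrt (RCLike.re (inner ℂ (frame L p x) (frame L p x))) := by
      funext x
      exact norm_eq_sqrt_re_inner (𝕜 := ℂ) _
    rw [h2]
    exact (Real.continuous_sqrt.continuousAt.comp
      (RCLike.continuous_re.continuousAt.comp h1)).continuousWithinAt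
  have hc' : ContinuousOn (fun x => ‖frame L p x‖ ^ k) (trivializationAt ℂ L p).baseSet :=
    hc.zpow₀ _ fun x hx => Or.inl (norm_ne_zero_iff.2 (frame_ne_zero hx))
  refine ((hw p).enorm.mul (hc'.aemeasurable hm).ennreal_ofReal).congr ?_
  filter_upwards [ae_restrict_mem hm] with x hx
  exact (LinePow.fiberNorm_eq (finrank_fiber x) (w x) (frame_ne_zero hx)).symm

/-- Minkowski's inequality for the pointwise norms, whose measurability comes from that of the
sections. -/
theorem l2Norm_add_le (hL : IsSmoothHermitian n L) {v w : PowSection L k}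
    (hv : IsMeasurableSection g v) (hw : IsMeasurableSection g w) :
    l2Norm g (v + w) ≤ l2Norm g v + l2Norm g w := by
  let _ : MeasurableSpace M := borel M
  have h1 := ENNReal.lintegral_Lp_add_le (hv.aemeasurable_fiberNorm hL)
    (hw.aemeasurable_fiberNorm hL) (p := 2) (by norm_num)
  simp only [ENNReal.rpow_ofNat] at h1
  refine le_trans ?_ h1
  refine ENNReal.rpow_le_rpow (lintegral_mono fun x => ?_) (by norm_num)
  exact pow_le_pow_left' (LinePow.fiberNorm_add_le _ _) 2

theorem l2Norm_sum_le (hL : IsSmoothHermitian n L) {ι : Type*} (t : Finset ι)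
    {w : ι → PowSection L k} (hw : ∀ i, IsMeasurableSection g (w i)) :
    l2Norm g (∑ i ∈ t, w i) ≤ ∑ i ∈ t, l2Norm g (w i) := by
  classical
  induction t using Finset.induction_on with
  | empty =>
    have := l2Norm_smul (g := g) 0 (0 : PowSection L k)
    simpa using this.le
  | insert i t hi ih =>
    rw [Finset.sum_insert hi, Finset.sum_insert hi]
    exact (l2Norm_add_le hL (hw i) (IsMeasurableSection.sum t hw)).trans (by gcongr)

namespace IsBundleLocalIsometry

variable {N : Type*} [TopologicalSpace N] [CompactSpace N]
  [ChartedSpace (EuclideanSpace ℝ (Fin n)) N] [IsManifold (𝓡 n) ∞ N]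
  {L' : N → Type*} [∀ x, NormedAddCommGroup (L' x)]
  [∀ x, InnerProductSpace ℂ (L' x)] [TopologicalSpace (TotalSpace ℂ L')] [FiberBundle ℂ L']
  {Φ : M → N} {Ψ : ∀ x, L x ≃ₗᵢ[ℂ] L' (Φ x)} {conn : ConnField n L}
  {g' : FormField n N} {conn' : ConnField n L'}

theorem isMeasurableSection_pullPow (h : IsBundleLocalIsometry Ψ g conn g' conn')
    (hL : IsSmoothHermitian n L) {s : PowSection L' k} :
    IsMeasurableSection g (pullPow Ψ k s) ↔ IsMeasurableSection g' s := by
  have hU : ∀ q, IsOpen (Φ ⁻¹' (trivializationAt ℂ L' q).baseSet) := fun q =>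
    (trivializationAt ℂ L' q).open_baseSet.preimage h.contMDiff.continuous
  have he : ∀ q, ∀ x ∈ Φ ⁻¹' (trivializationAt ℂ L' q).baseSet,
      SmoothAt n (pullSection Ψ (frame L' q)) x ∧ pullSection Ψ (frame L' q) x ≠ 0 :=
    fun q x hx => ⟨h.smoothAt_frame q x hx, h.pullSection_ne_zero hx⟩
  have key := fun q => h.aemeasurable_comp_iff (f := fun y => (s y).1 (frame L' q y))
    (trivializationAt ℂ L' q).open_baseSet
  constructor
  · intro hs q
    refine (key q).1 ?_
    have := hs.apply_frame hL (hU q) (he q)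
    simpa only [pullPow_apply_pullSection] using this
  · intro hs
    refine isMeasurableSection_of_frames hL fun p => ⟨pullSection Ψ (frame L' (Φ p)), _, hU (Φ p),
      FiberBundle.mem_baseSet_trivializationAt' (Φ p), he _, ?_⟩
    have := (key (Φ p)).2 (hs (Φ p))
    simpa only [pullPow_apply_pullSection] using this

theorem exists_l2Norm_le (h : IsBundleLocalIsometry Ψ g conn g' conn') (k : ℤ) :
    ∃ C : NNReal, ∀ s : PowSection L' k, l2Norm g' s ≤ C * l2Norm g (pullPow Ψ k s) := by
  obtain ⟨C, hC⟩ := h.exists_lintegral_le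
  -- The norm is the square root of an integral, hence so is the constant.
  refine ⟨(C : NNReal) ^ (1 / 2 : ℝ), fun s => ?_⟩
  rw [ENNReal.coe_rpow_of_nonneg _ (by norm_num), l2Norm, l2Norm,
    ← ENNReal.mul_rpow_of_nonneg _ _ (by norm_num)]
  refine ENNReal.rpow_le_rpow ((hC _).trans (le_of_eq ?_)) (by norm_num)
  rw [ENNReal.coe_natCast]
  congr 2
  funext x
  exact congrArg (· ^ 2) (LinePow.fiberNorm_comap (Ψ x) (s (Φ x))).symm

theorem exists_l2Norm_pullPow_le (h : IsBundleLocalIsometry Ψ g conn g' conn')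
    (hL : IsSmoothHermitian n L) (k : ℤ) :
    ∃ C : NNReal, ∀ s : PowSection L' k, IsMeasurableSection g' s →
      l2Norm g (pullPow Ψ k s) ≤ C * l2Norm g' s := by
  let _ : MeasurableSpace M := borel M
  have : BorelSpace M := ⟨rfl⟩
  let _ : MeasurableSpace N := borel N
  have : BorelSpace N := ⟨rfl⟩
  obtain ⟨C, hC⟩ := h.exists_lintegral_comp_le
  refine ⟨(C : NNReal) ^ (1 / 2 : ℝ), fun s hs => ?_⟩
  have h1 : ∀ x, LinePow.fiberNorm (pullPow Ψ k s x) = LinePow.fiberNorm (s (Φ x)) :=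
    fun x => LinePow.fiberNorm_comap (Ψ x) (s (Φ x))
  have h2 : AEMeasurable (fun y => LinePow.fiberNorm (s y)) (riemannianVolume g') := by
    have := ((h.isMeasurableSection_pullPow hL).2 hs).aemeasurable_fiberNorm hL
    simp only [h1] at this
    rw [← Measure.restrict_univ (μ := riemannianVolume g')]
    refine (h.aemeasurable_comp_iff isOpen_univ).1 ?_
    rwa [Set.preimage_univ, Measure.restrict_univ]
  rw [ENNReal.coe_rpow_of_nonneg _ (by norm_num), l2Norm, l2Norm,
    ← ENNReal.mul_rpow_of_nonneg _ _ (by norm_num)]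
  simp only [h1]
  refine ENNReal.rpow_le_rpow ((hC _ (h2.pow_const 2)).trans (le_of_eq ?_)) (by norm_num)
  rw [ENNReal.coe_natCast]

end IsBundleLocalIsometry

end Frames

end MeasurableSections

/-! ### Isometries of the line bundle and its quotients -/

section GroupAction

open Filter Topology

variable {n : ℕ} {M : Type*} [TopologicalSpace M] [ChartedSpace (EuclideanSpace ℝ (Fin n)) M]
  {L : M → Type*} [∀ x, NormedAddCommGroup (L x)] [∀ x, InnerProductSpace ℂ (L x)]
  [TopologicalSpace (TotalSpace ℂ L)] [FiberBundle ℂ L]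

namespace BundleAction

/-! ### Elements of the group as isometries of the bundle. -/

section Act

variable {G : Type*} [Group G] [MulAction G M] (ρ : BundleAction n G L)

/-- Formulated on the total space, because `a⁻¹ • a • x` and `x` are equal only propositionally and
their fibers are different types. It turns smoothness of the action of `a⁻¹` into smoothness of
pullbacks. -/
theorem mk_act_symm (a : G) (x : M) (v : L (a • x)) :
    (⟨x, (ρ.act a x).symm v⟩ : TotalSpace ℂ L) = ρ.total a⁻¹ ⟨a • x, v⟩ := by
  have h : (⟨a • x, v⟩ : TotalSpace ℂ L) = ρ.total a ⟨x, (ρ.act a x).symm v⟩ :=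
    congrArg (TotalSpace.mk (a • x)) ((ρ.act a x).apply_symm_apply v).symm
  rw [h, ← total_mul, inv_mul_cancel, total_one]

theorem smoothAt_pullSection_act {a : G} (ha : ContMDiff (𝓡 n) (𝓡 n) ∞ (fun x : M => a • x))
    {σ : ∀ x : M, L x} {x : M} (hσ : SmoothAt n σ (a • x)) :
    SmoothAt n (pullSection (ρ.act a) σ) x := by
  have h1 : (fun y => TotalSpace.mk' ℂ y (pullSection (ρ.act a) σ y))
      = fun y => ρ.total a⁻¹ (TotalSpace.mk' ℂ (a • y) (σ (a • y))) :=
    funext fun y => ρ.mk_act_symm a y _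
  rw [SmoothAt, h1]
  have h2 := ContMDiffAt.comp (g := fun y => TotalSpace.mk' ℂ y (σ y)) x hσ (ha x)
  exact ((ρ.contMDiff_act a⁻¹) _).comp x h2

/-- The elements of the group are isometries of the Hermitian line bundle. -/
theorem isBundleLocalIsometry_act [VectorBundle ℂ ℂ L] [ContinuousConstSMul G M]
    [IsManifold (𝓡 n) ∞ M] [VectorBundle ℝ ℂ L] [ContMDiffVectorBundle ∞ ℂ L (𝓡 n)]
    {g : FormField n M} {conn : ConnField n L}
    (hg : ActsByIsometries G g) (hρ : ρ.Preserves conn) (a : G) :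
    IsBundleLocalIsometry (Φ := fun x : M => a • x) (ρ.act a) g conn g conn where
  surjective := MulAction.surjective a
  contMDiff := (hg a).1
  exists_localInverse _ := ⟨(Homeomorph.smul a).toOpenPartialHomeomorph, trivial, fun _ _ => rfl,
    (hg a⁻¹).1.contMDiffOn⟩
  metric := (hg a).2
  frame_ne_zero _ _ := QuantumMagnetic.frame_ne_zero
  smoothAt_frame _ _ hx := ρ.smoothAt_pullSection_act (hg a).1 (QuantumMagnetic.smoothAt_frame hx)
  conn_frame q x hx := hρ a _ (frame L q) (fun y => ((ρ.act a y).apply_symm_apply _).symm) x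
    (ρ.smoothAt_pullSection_act (hg a).1 (QuantumMagnetic.smoothAt_frame hx)).mdiff

end Act

section Quotient

variable {Γ : Type*} [Group Γ] [MulAction Γ M] [T2Space M] [LocallyCompactSpace M]
  [ContinuousConstSMul Γ M] [ProperlyDiscontinuousSMul Γ M] [IsCancelSMul Γ M]

/-! ### The smooth structure on the quotient manifold. -/

section Base

variable [IsManifold (𝓡 n) ∞ M]

variable (Γ M n) in
theorem exists_chartAt_quotient (q : orbitRel.Quotient Γ M) : ∃ x₀ : M,
    Quotient.mk (orbitRel Γ M) x₀ = q ∧ chartAt (EuclideanSpace ℝ (Fin n)) q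
      = (localSection Γ x₀).trans (chartAt (EuclideanSpace ℝ (Fin n)) x₀) :=
  ⟨_, Quotient.mk_surjective.hasRightInverse.choose_spec q, rfl⟩

theorem localSection_symm (x₀ : M) :
    ((localSection Γ x₀).symm : M → orbitRel.Quotient Γ M) = Quotient.mk (orbitRel Γ M) :=
  (isLocalHomeomorph_mk Γ M).localInverseAt_symm x₀

/-- Local sections of the projection differ locally by one element of `Γ`, so a transition map is
locally that element read in charts of `M`. -/
theorem isManifold_quotient (hΓ : ∀ γ : Γ, ContMDiff (𝓡 n) (𝓡 n) ∞ (fun x : M => γ • x)) :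
    IsManifold (𝓡 n) ∞ (orbitRel.Quotient Γ M) := by
  refine isManifold_of_contDiffOn _ _ _ ?_
  rintro _ _ ⟨q₁, rfl⟩ ⟨q₂, rfl⟩ y ⟨hy, -⟩
  generalize (Quotient.mk_surjective (s := orbitRel Γ M)).hasRightInverse.choose q₁ = x₁ at hy ⊢
  generalize (Quotient.mk_surjective (s := orbitRel Γ M)).hasRightInverse.choose q₂ = x₂ at hy ⊢
  refine ContDiffAt.contDiffWithinAt ?_
  simp only [OpenPartialHomeomorph.trans_source, OpenPartialHomeomorph.symm_source,
    OpenPartialHomeomorph.trans_symm_eq_symm_trans_symm,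
    OpenPartialHomeomorph.coe_trans, Set.mem_inter_iff, Set.mem_preimage,
    Function.comp_apply] at hy
  obtain ⟨⟨hy₁, hy₂⟩, hy₃, hy₄⟩ := hy
  change y ∈ (chartAt (EuclideanSpace ℝ (Fin n)) x₁).target at hy₁
  change (chartAt (EuclideanSpace ℝ (Fin n)) x₁).symm y ∈ (localSection Γ x₁).target at hy₂
  change (localSection Γ x₁).symm ((chartAt (EuclideanSpace ℝ (Fin n)) x₁).symm y)
    ∈ (localSection Γ x₂).source at hy₃
  change localSection Γ x₂ ((localSection Γ x₁).symm
    ((chartAt (EuclideanSpace ℝ (Fin n)) x₁).symm y))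
    ∈ (chartAt (EuclideanSpace ℝ (Fin n)) x₂).source at hy₄
  obtain ⟨δ, hδ⟩ := exists_localSection_smul x₂ x₁ hy₃ ((localSection Γ x₁).map_target hy₂)
  have hz := (localSection Γ x₁).right_inv hy₂
  have hc : ContMDiffAt (𝓡 n) (𝓡 n) ∞ (chartAt (EuclideanSpace ℝ (Fin n)) x₁).symm y :=
    contMDiffOn_chart_symm.contMDiffAt
      ((chartAt (EuclideanSpace ℝ (Fin n)) x₁).open_target.mem_nhds hy₁)
  have hδ0 := hδ.self_of_nhds
  rw [hz] at hδ0
  rw [← hδ0] at hy₄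
  have hc' : ContMDiffAt (𝓡 n) (𝓡 n) ∞ (chartAt (EuclideanSpace ℝ (Fin n)) x₂)
      (δ • (chartAt (EuclideanSpace ℝ (Fin n)) x₁).symm y) :=
    contMDiffOn_chart.contMDiffAt
      ((chartAt (EuclideanSpace ℝ (Fin n)) x₂).open_source.mem_nhds hy₄)
  have h1 := (hc'.comp y (((hΓ δ) _).comp y hc)).contDiffAt
  refine h1.congr_of_eventuallyEq ?_
  have hcont : ContinuousAt (fun z => (localSection Γ x₁).symm
      ((chartAt (EuclideanSpace ℝ (Fin n)) x₁).symm z)) y :=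
    ContinuousAt.comp ((localSection Γ x₁).symm.continuousAt hy₂) hc.continuousAt
  filter_upwards [hcont.eventually hδ,
    hc.continuousAt.eventually ((localSection Γ x₁).open_target.mem_nhds hy₂)] with z hz₁ hz₂
  rw [(localSection Γ x₁).right_inv hz₂] at hz₁
  change chartAt (EuclideanSpace ℝ (Fin n)) x₂ (localSection Γ x₂ ((localSection Γ x₁).symm
    ((chartAt (EuclideanSpace ℝ (Fin n)) x₁).symm z))) = _
  rw [← hz₁]
  rfl

variable (hΓ : ∀ γ : Γ, ContMDiff (𝓡 n) (𝓡 n) ∞ (fun x : M => γ • x))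
include hΓ

theorem contMDiff_mk : ContMDiff (𝓡 n) (𝓡 n) ∞ (Quotient.mk (orbitRel Γ M)) := by
  have := isManifold_quotient hΓ
  intro x
  obtain ⟨x₀, hx₀, hch⟩ := exists_chartAt_quotient n M Γ (Quotient.mk (orbitRel Γ M) x)
  obtain ⟨δ, hδ⟩ : ∃ δ : Γ, δ • x = x₀ := orbitRel_apply.1 (Quotient.exact hx₀)
  have hmk : Quotient.mk (orbitRel Γ M) = Quotient.mk (orbitRel Γ M) ∘ fun x => δ • x :=
    funext fun y => Quotient.sound (s := orbitRel Γ M) ⟨δ⁻¹, inv_smul_smul δ y⟩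
  -- Invariance of the projection moves the question to the lift used by the chart of the quotient,
  -- where the projection is the identity in charts.
  suffices h : ContMDiffAt (𝓡 n) (𝓡 n) ∞ (Quotient.mk (orbitRel Γ M)) (δ • x) by
    rw [hmk]
    exact h.comp x (hΓ δ x)
  rw [hδ]
  have ht : x₀ ∈ (localSection Γ x₀).target :=
    (isLocalHomeomorph_mk Γ M).self_mem_localInverseAt_target
  have hs := mem_chart_source (EuclideanSpace ℝ (Fin n)) x₀
  have hc : ContMDiffAt (𝓡 n) (𝓡 n) ∞ (chartAt (EuclideanSpace ℝ (Fin n)) x₀) x₀ :=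
    contMDiffOn_chart.contMDiffAt (chart_source_mem_nhds _ _)
  have hc' : ContMDiffAt (𝓡 n) (𝓡 n) ∞
      (chartAt (EuclideanSpace ℝ (Fin n)) (Quotient.mk (orbitRel Γ M) x)).symm
      (chartAt (EuclideanSpace ℝ (Fin n)) x₀ x₀) := by
    refine contMDiffOn_chart_symm.contMDiffAt (IsOpen.mem_nhds
      (chartAt (EuclideanSpace ℝ (Fin n)) (Quotient.mk (orbitRel Γ M) x)).open_target ?_)
    rw [hch, OpenPartialHomeomorph.trans_target]
    refine ⟨(chartAt (EuclideanSpace ℝ (Fin n)) x₀).map_source hs, ?_⟩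
    change (chartAt (EuclideanSpace ℝ (Fin n)) x₀).symm
      (chartAt (EuclideanSpace ℝ (Fin n)) x₀ x₀) ∈ (localSection Γ x₀).target
    rwa [(chartAt (EuclideanSpace ℝ (Fin n)) x₀).left_inv hs]
  refine (hc'.comp x₀ hc).congr_of_eventuallyEq ?_
  filter_upwards [chart_source_mem_nhds (EuclideanSpace ℝ (Fin n)) x₀] with z hz
  rw [Function.comp_apply, hch]
  change _ = (localSection Γ x₀).symm ((chartAt (EuclideanSpace ℝ (Fin n)) x₀).symm
    (chartAt (EuclideanSpace ℝ (Fin n)) x₀ z))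
  rw [(chartAt (EuclideanSpace ℝ (Fin n)) x₀).left_inv hz, localSection_symm]

theorem contMDiffOn_localSection (x₁ : M) :
    ContMDiffOn (𝓡 n) (𝓡 n) ∞ (localSection Γ x₁) (localSection Γ x₁).source := by
  have := isManifold_quotient hΓ
  intro q hq
  refine ContMDiffAt.contMDiffWithinAt ?_
  obtain ⟨x₀, hx₀, hch⟩ := exists_chartAt_quotient n M Γ q
  have hs : q ∈ ((localSection Γ x₀).trans (chartAt (EuclideanSpace ℝ (Fin n)) x₀)).source := by
    rw [← hch]
    exact mem_chart_source _ _
  rw [OpenPartialHomeomorph.trans_source] at hs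
  obtain ⟨δ, hδ⟩ := exists_localSection_smul x₁ x₀ hq hs.1
  suffices h : ContMDiffAt (𝓡 n) (𝓡 n) ∞ (localSection Γ x₀) q from
    (((hΓ δ) _).comp q h).congr_of_eventuallyEq (hδ.mono fun _ h => h.symm)
  have hc : ContMDiffAt (𝓡 n) (𝓡 n) ∞ (chartAt (EuclideanSpace ℝ (Fin n)) q) q :=
    contMDiffOn_chart.contMDiffAt (chart_source_mem_nhds _ _)
  have hc' : ContMDiffAt (𝓡 n) (𝓡 n) ∞ (chartAt (EuclideanSpace ℝ (Fin n)) x₀).symm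
      (chartAt (EuclideanSpace ℝ (Fin n)) q q) := by
    refine contMDiffOn_chart_symm.contMDiffAt
      ((chartAt (EuclideanSpace ℝ (Fin n)) x₀).open_target.mem_nhds ?_)
    rw [hch]
    exact (chartAt (EuclideanSpace ℝ (Fin n)) x₀).map_source hs.2
  refine (hc'.comp q hc).congr_of_eventuallyEq ?_
  filter_upwards [chart_source_mem_nhds (EuclideanSpace ℝ (Fin n)) q] with z hz
  rw [hch, OpenPartialHomeomorph.trans_source] at hz
  rw [Function.comp_apply, hch]
  exact ((chartAt (EuclideanSpace ℝ (Fin n)) x₀).left_inv hz.2).symm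

theorem exists_localInverse_mk (x : M) :
    ∃ Θ : OpenPartialHomeomorph M (orbitRel.Quotient Γ M), x ∈ Θ.source ∧
      Set.EqOn Θ (Quotient.mk (orbitRel Γ M)) Θ.source ∧
      ContMDiffOn (𝓡 n) (𝓡 n) ∞ Θ.symm Θ.target :=
  ⟨(localSection Γ x).symm, (isLocalHomeomorph_mk Γ M).self_mem_localInverseAt_target,
    fun y _ => congrFun (localSection_symm x) y, contMDiffOn_localSection hΓ x⟩

omit hΓ in
theorem isInvertible_of_comp_eq_id {V : Type*} [NormedAddCommGroup V] [NormedSpace ℝ V]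
    [FiniteDimensional ℝ V] {A B : V →L[ℝ] V} (h : B.comp A = ContinuousLinearMap.id ℝ V) :
    A.IsInvertible := by
  have h1 : Function.Injective A.toLinearMap :=
    Function.LeftInverse.injective (g := B) fun u => congrArg (fun A : V →L[ℝ] V => A u) h
  exact ⟨(LinearEquiv.ofInjectiveEndo _ h1).toContinuousLinearEquiv, by ext; rfl⟩

/-- A local section provides a left inverse of the differential. Invertibility matters because
`tangentLift` is defined by `inverse`, which is `0` on maps that are not invertible. -/
theorem mfderiv_mk_isInvertible (x : M) :
    (mfderiv (𝓡 n) (𝓡 n) (Quotient.mk (orbitRel Γ M)) x :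
      EuclideanSpace ℝ (Fin n) →L[ℝ] EuclideanSpace ℝ (Fin n)).IsInvertible := by
  have ht : x ∈ (localSection Γ x).target :=
    (isLocalHomeomorph_mk Γ M).self_mem_localInverseAt_target
  have hs : Quotient.mk (orbitRel Γ M) x ∈ (localSection Γ x).source :=
    (isLocalHomeomorph_mk Γ M).apply_self_mem_localInverseAt_source
  have hx : localSection Γ x (Quotient.mk (orbitRel Γ M) x) = x :=
    (isLocalHomeomorph_mk Γ M).localInverseAt_apply_self
  have h1 : MDifferentiableAt (𝓡 n) (𝓡 n) (localSection Γ x) (Quotient.mk (orbitRel Γ M) x) :=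
    ((contMDiffOn_localSection hΓ x).contMDiffAt
      ((localSection Γ x).open_source.mem_nhds hs)).mdifferentiableAt (by simp)
  have h2 : MDifferentiableAt (𝓡 n) (𝓡 n) (Quotient.mk (orbitRel Γ M)) x :=
    (contMDiff_mk hΓ x).mdifferentiableAt (by simp)
  have h3 := mfderiv_comp x h1 h2
  have h4 : localSection Γ x ∘ Quotient.mk (orbitRel Γ M) =ᶠ[𝓝 x] id := by
    filter_upwards [(localSection Γ x).open_target.mem_nhds ht] with y hy
    have := (localSection Γ x).right_inv hy
    rwa [localSection_symm] at this
  have h5 : (mfderiv (𝓡 n) (𝓡 n) (localSection Γ x ∘ Quotient.mk (orbitRel Γ M)) x :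
      EuclideanSpace ℝ (Fin n) →L[ℝ] EuclideanSpace ℝ (Fin n))
      = ContinuousLinearMap.id ℝ (EuclideanSpace ℝ (Fin n)) := by
    have := h4.mfderiv_eq (I := 𝓡 n) (I' := 𝓡 n)
    exact this.trans mfderiv_id
  exact isInvertible_of_comp_eq_id (V := EuclideanSpace ℝ (Fin n))
    (B := mfderiv (𝓡 n) (𝓡 n) (localSection Γ x) (Quotient.mk (orbitRel Γ M) x))
    (h3.symm.trans h5)

/-- Differentiate the invariance of the projection under `γ`, which carries `x` to the chosen
representative, and invert the differential of the projection there. -/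
theorem tangentLift_mfderiv {x : M} {γ : Γ}
    (hγ : γ • x = (Quotient.mk (orbitRel Γ M) x).out) (X : TangentSpace (𝓡 n) x) :
    (tangentLift n Γ (Quotient.mk (orbitRel Γ M) x)
      (mfderiv (𝓡 n) (𝓡 n) (Quotient.mk (orbitRel Γ M)) x X) : EuclideanSpace ℝ (Fin n))
      = (mfderiv (𝓡 n) (𝓡 n) (fun y : M => γ • y) x X : EuclideanSpace ℝ (Fin n)) := by
  have h0 : ∀ q : orbitRel.Quotient Γ M, (tangentLift n Γ q :
      EuclideanSpace ℝ (Fin n) →L[ℝ] EuclideanSpace ℝ (Fin n))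
      = (mfderiv (𝓡 n) (𝓡 n) (Quotient.mk (orbitRel Γ M)) q.out :
        EuclideanSpace ℝ (Fin n) →L[ℝ] EuclideanSpace ℝ (Fin n)).inverse := fun q => rfl
  have hmk : Quotient.mk (orbitRel Γ M) = Quotient.mk (orbitRel Γ M) ∘ fun x => γ • x :=
    funext fun y => Quotient.sound (s := orbitRel Γ M) ⟨γ⁻¹, inv_smul_smul γ y⟩
  have h1 : (mfderiv (𝓡 n) (𝓡 n) (Quotient.mk (orbitRel Γ M)) x :
      EuclideanSpace ℝ (Fin n) →L[ℝ] EuclideanSpace ℝ (Fin n)) X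
      = (mfderiv (𝓡 n) (𝓡 n) (Quotient.mk (orbitRel Γ M)) (γ • x) :
      EuclideanSpace ℝ (Fin n) →L[ℝ] EuclideanSpace ℝ (Fin n))
        (mfderiv (𝓡 n) (𝓡 n) (fun y : M => γ • y) x X) := by
    have h2 := mfderiv_comp x ((contMDiff_mk hΓ (γ • x)).mdifferentiableAt (by simp))
      ((hΓ γ x).mdifferentiableAt (by simp))
    rw [← hmk] at h2
    exact congrArg (fun A : EuclideanSpace ℝ (Fin n) →L[ℝ] EuclideanSpace ℝ (Fin n) => A X) h2
  rw [hγ] at h1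
  refine (congrArg (fun A : EuclideanSpace ℝ (Fin n) →L[ℝ] EuclideanSpace ℝ (Fin n) =>
    A (mfderiv (𝓡 n) (𝓡 n) (Quotient.mk (orbitRel Γ M)) x X)) (h0 _)).trans ?_
  refine (congrArg (mfderiv (𝓡 n) (𝓡 n) (Quotient.mk (orbitRel Γ M))
    (Quotient.mk (orbitRel Γ M) x).out : EuclideanSpace ℝ (Fin n) →L[ℝ]
      EuclideanSpace ℝ (Fin n)).inverse h1).trans ?_
  exact (mfderiv_mk_isInvertible hΓ _).inverse_apply_self _

end Base

/-! ### The quotient line bundle and its frames. -/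

section Fibers

variable (ρ : BundleAction n Γ L)

omit [T2Space M] [LocallyCompactSpace M] [ContinuousConstSMul Γ M]
  [ProperlyDiscontinuousSMul Γ M] [IsCancelSMul Γ M] in
theorem eq_of_proj_eq {x : M} {u v : L x} (h : ρ.proj ⟨x, u⟩ = ρ.proj ⟨x, v⟩) : u = v :=
  (ρ.toQuot x).injective (TotalSpace.mk_injective (F := ℂ) (E := ρ.QuotFiber) _ h)

omit [T2Space M] [LocallyCompactSpace M] [ContinuousConstSMul Γ M]
  [ProperlyDiscontinuousSMul Γ M] [IsCancelSMul Γ M] in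
theorem proj_mk_pullSection (σ : ∀ q, ρ.QuotFiber q) (x : M) :
    ρ.proj ⟨x, pullSection ρ.toQuot σ x⟩
      = ⟨Quotient.mk (orbitRel Γ M) x, σ (Quotient.mk (orbitRel Γ M) x)⟩ :=
  congrArg (TotalSpace.mk _) ((ρ.toQuot x).apply_symm_apply _)

-- The two vectors lie over the same point and have the same orbit. Equivariance is the hypothesis
-- on sections under which `Preserves` speaks about the connection.
omit [T2Space M] [LocallyCompactSpace M] [ContinuousConstSMul Γ M]
  [ProperlyDiscontinuousSMul Γ M] in
theorem pullSection_toQuot_smul (σ : ∀ q, ρ.QuotFiber q) (γ : Γ) (x : M) :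
    pullSection ρ.toQuot σ (γ • x) = ρ.act γ x (pullSection ρ.toQuot σ x) := by
  refine ρ.eq_of_proj_eq ?_
  have h := (ρ.proj_eq_iff ⟨x, pullSection ρ.toQuot σ x⟩ _).2 ⟨γ, rfl⟩
  refine Eq.trans ?_ h
  rw [proj_mk_pullSection, proj_mk_pullSection]
  have : Quotient.mk (orbitRel Γ M) (γ • x) = Quotient.mk (orbitRel Γ M) x :=
    Quotient.sound (s := orbitRel Γ M) ⟨γ, rfl⟩
  rw [this]

variable [VectorBundle ℂ ℂ L]

theorem mem_baseSet_quotient {q q' : orbitRel.Quotient Γ M}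
    (h : q' ∈ (trivializationAt ℂ ρ.QuotFiber q).baseSet) :
    q' ∈ (localSection Γ q.out).source ∧
      localSection Γ q.out q' ∈ (trivializationAt ℂ L q.out).baseSet := h

/-- By construction the preferred trivialization of the quotient bundle at `q` is that of `L` at
`q.out`, read through a local section. -/
theorem mk_frame_quotient {q q' : orbitRel.Quotient Γ M}
    (h : q' ∈ (trivializationAt ℂ ρ.QuotFiber q).baseSet) :
    (⟨q', frame ρ.QuotFiber q q'⟩ : TotalSpace ℂ ρ.QuotFiber)
      = ρ.proj ⟨localSection Γ q.out q', frame L q.out (localSection Γ q.out q')⟩ := by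
  refine ((trivializationAt ℂ ρ.QuotFiber q).mk_symm h 1).trans ?_
  refine Eq.trans ?_ (congrArg ρ.proj
    ((trivializationAt ℂ L q.out).mk_symm (ρ.mem_baseSet_quotient h).2 1)).symm
  rfl

/-- Locally, the pullbacks to `M` of the preferred frames of the quotient bundle are translates of
preferred frames. -/
theorem exists_pullSection_frame {q : orbitRel.Quotient Γ M} {x : M}
    (hx : Quotient.mk (orbitRel Γ M) x ∈ (trivializationAt ℂ ρ.QuotFiber q).baseSet) :
    ∃ δ : Γ, δ • x ∈ (trivializationAt ℂ L q.out).baseSet ∧ ∀ᶠ y in 𝓝 x,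
      pullSection ρ.toQuot (frame ρ.QuotFiber q) y
        = pullSection (ρ.act δ) (frame L q.out) y := by
  have hb := ρ.mem_baseSet_quotient hx
  have hs : Quotient.mk (orbitRel Γ M) x ∈ (localSection Γ x).source :=
    (isLocalHomeomorph_mk Γ M).apply_self_mem_localInverseAt_source
  have ht : x ∈ (localSection Γ x).target :=
    (isLocalHomeomorph_mk Γ M).self_mem_localInverseAt_target
  have hc : ContinuousAt (Quotient.mk (orbitRel Γ M)) x := continuous_quotient_mk'.continuousAt
  obtain ⟨δ, hδ⟩ := exists_localSection_smul q.out x hb.1 hs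
  have hδ' : ∀ᶠ y in 𝓝 x, localSection Γ q.out (Quotient.mk (orbitRel Γ M) y) = δ • y := by
    filter_upwards [hc.eventually hδ, (localSection Γ x).open_target.mem_nhds ht] with y h1 h2
    have h3 := (localSection Γ x).right_inv h2
    rw [localSection_symm] at h3
    rw [← h1, h3]
  refine ⟨δ, by rw [← hδ'.self_of_nhds]; exact hb.2, ?_⟩
  filter_upwards [hδ', hc.eventually
    ((trivializationAt ℂ ρ.QuotFiber q).open_baseSet.mem_nhds hx)] with y h1 h2
  refine ρ.eq_of_proj_eq ?_
  rw [proj_mk_pullSection, mk_frame_quotient ρ h2, h1]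
  refine ((ρ.proj_eq_iff _ _).2 ⟨δ, ?_⟩).symm
  exact congrArg (TotalSpace.mk (δ • y)) ((ρ.act δ y).apply_symm_apply _)

theorem conn_castFiber (conn : ConnField n L) (σ : ∀ x : M, L x) {x y : M} (h : x = y)
    (u : EuclideanSpace ℝ (Fin n)) : conn σ y u = castFiber h (conn σ x u) := by
  subst h
  rfl

variable [IsManifold (𝓡 n) ∞ M] [VectorBundle ℝ ℂ L] [ContMDiffVectorBundle ∞ ℂ L (𝓡 n)]

/-- The projection `L → Γ \ L` is a local isometry of Hermitian line bundles with connection. -/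
theorem isBundleLocalIsometry_mk {g : FormField n M} {conn : ConnField n L}
    (hg : ActsByIsometries Γ g) (hρ : ρ.Preserves conn) :
    IsBundleLocalIsometry (Φ := Quotient.mk (orbitRel Γ M)) ρ.toQuot g conn
      (quotMetric Γ g) (ρ.quotConn conn) where
  surjective := Quotient.mk_surjective
  contMDiff := contMDiff_mk fun γ => (hg γ).1
  exists_localInverse := exists_localInverse_mk fun γ => (hg γ).1
  metric x X Y := by
    have hγ := (exists_smul_eq_out Γ x).choose_spec
    -- Metrics at equal points are compared on the model space, which avoids transporting tangent
    -- vectors; the remaining claim is the invariance of `g` under `γ`.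
    have key : ∀ (z : M) (_ : (exists_smul_eq_out Γ x).choose • x = z)
        (u v : EuclideanSpace ℝ (Fin n)),
        (g z : EuclideanSpace ℝ (Fin n) →L[ℝ] EuclideanSpace ℝ (Fin n) →L[ℝ] ℝ) u v
        = (g ((exists_smul_eq_out Γ x).choose • x) :
          EuclideanSpace ℝ (Fin n) →L[ℝ] EuclideanSpace ℝ (Fin n) →L[ℝ] ℝ) u v := by
      rintro _ rfl u v
      rfl
    rw [quotMetric_apply]
    refine (key _ hγ _ _).trans ?_
    rw [← (hg (exists_smul_eq_out Γ x).choose).2 x X Y]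
    refine congrArg₂ (fun u v : EuclideanSpace ℝ (Fin n) =>
      (g ((exists_smul_eq_out Γ x).choose • x) :
        EuclideanSpace ℝ (Fin n) →L[ℝ] EuclideanSpace ℝ (Fin n) →L[ℝ] ℝ) u v) ?_ ?_
    · exact tangentLift_mfderiv (fun γ => (hg γ).1) hγ X
    · exact tangentLift_mfderiv (fun γ => (hg γ).1) hγ Y
  frame_ne_zero q x hx h0 := by
    obtain ⟨δ, hδ, h⟩ := ρ.exists_pullSection_frame hx
    have h1 := h.self_of_nhds
    rw [pullSection, pullSection, h0, map_zero, eq_comm, LinearIsometryEquiv.map_eq_zero_iff] at h1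
    exact QuantumMagnetic.frame_ne_zero hδ h1
  smoothAt_frame q x hx := by
    obtain ⟨δ, hδ, h⟩ := ρ.exists_pullSection_frame hx
    exact (ρ.smoothAt_pullSection_act (hg δ).1 (QuantumMagnetic.smoothAt_frame hδ)).congr h
  conn_frame q x hx X := by
    have hγ := (exists_smul_eq_out Γ x).choose_spec
    have hs : SmoothAt n (pullSection ρ.toQuot (frame ρ.QuotFiber q)) x := by
      obtain ⟨δ, hδ, h⟩ := ρ.exists_pullSection_frame hx
      exact (ρ.smoothAt_pullSection_act (hg δ).1 (QuantumMagnetic.smoothAt_frame hδ)).congr h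
    -- The quotient connection is computed at the chosen representative; invariance under the
    -- element carrying `x` there brings it back to `x`.
    have h1 := hρ (exists_smul_eq_out Γ x).choose _ _
      (ρ.pullSection_toQuot_smul (frame ρ.QuotFiber q) _) x hs.mdiff X
    have h2 := conn_castFiber conn (pullSection ρ.toQuot (frame ρ.QuotFiber q)) hγ
      (tangentLift n Γ (Quotient.mk (orbitRel Γ M) x)
        (mfderiv (𝓡 n) (𝓡 n) (Quotient.mk (orbitRel Γ M)) x X))
    refine h2.trans ?_
    refine congrArg (castFiber hγ) ?_
    refine Eq.trans ?_ h1
    exact congrArg (fun u : EuclideanSpace ℝ (Fin n) =>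
      conn (pullSection ρ.toQuot (frame ρ.QuotFiber q)) ((exists_smul_eq_out Γ x).choose • x) u)
      (tangentLift_mfderiv (fun γ => (hg γ).1) hγ X)

end Fibers

end Quotient

end BundleAction

end GroupAction

/-! ### Intertwining operators -/

section Intertwiner

open Filter Topology

variable {n : ℕ} {k : ℤ}

/-! ### Intertwiners preserve the resolvent set and the eigenspaces. -/

section General

variable {N₁ : Type*} [TopologicalSpace N₁] [ChartedSpace (EuclideanSpace ℝ (Fin n)) N₁]
  {L₁ : N₁ → Type*} [∀ x, NormedAddCommGroup (L₁ x)] [∀ x, InnerProductSpace ℂ (L₁ x)]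
  [TopologicalSpace (TotalSpace ℂ L₁)] [FiberBundle ℂ L₁]
  {N₂ : Type*} [TopologicalSpace N₂] [ChartedSpace (EuclideanSpace ℝ (Fin n)) N₂]
  {L₂ : N₂ → Type*} [∀ x, NormedAddCommGroup (L₂ x)] [∀ x, InnerProductSpace ℂ (L₂ x)]
  [TopologicalSpace (TotalSpace ℂ L₂)] [FiberBundle ℂ L₂]

/-- An `L²`-bounded operator on sections which intertwines the Hamiltonians. -/
structure IsIntertwiner (g₁ : FormField n N₁) (conn₁ : ConnField n L₁) (g₂ : FormField n N₂)
    (conn₂ : ConnField n L₂) (T : PowSection L₁ k →ₗ[ℂ] PowSection L₂ k) : Prop where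
  hamiltonian_mem : ∀ s ∈ smoothSections n L₁ k, hamiltonian g₁ conn₁ s ∈ smoothSections n L₁ k
  map_mem : ∀ s ∈ smoothSections n L₁ k, T s ∈ smoothSections n L₂ k
  map_hamiltonian : ∀ s ∈ smoothSections n L₁ k,
    T (hamiltonian g₁ conn₁ s) = hamiltonian g₂ conn₂ (T s)
  measurable : ∀ w, IsMeasurableSection g₁ w → IsMeasurableSection g₂ (T w)
  bounded : ∃ C : NNReal, ∀ w, IsMeasurableSection g₁ w → l2Norm g₂ (T w) ≤ C * l2Norm g₁ w

namespace IsIntertwiner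

variable {g₁ : FormField n N₁} {conn₁ : ConnField n L₁} {g₂ : FormField n N₂}
  {conn₂ : ConnField n L₂} {T : PowSection L₁ k →ₗ[ℂ] PowSection L₂ k}
  {S : PowSection L₂ k →ₗ[ℂ] PowSection L₁ k}

theorem isL2 (hT : IsIntertwiner g₁ conn₁ g₂ conn₂ T) {u : PowSection L₁ k} (hu : IsL2 g₁ u) :
    IsL2 g₂ (T u) := by
  obtain ⟨C, hC⟩ := hT.bounded
  exact ⟨hT.measurable u hu.aemeasurable,
    (hC u hu.aemeasurable).trans_lt (ENNReal.mul_lt_top ENNReal.coe_lt_top hu.finite)⟩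

theorem tendsto (hT : IsIntertwiner g₁ conn₁ g₂ conn₂ T) {s : ℕ → PowSection L₁ k}
    (hs : ∀ m, IsMeasurableSection g₁ (s m))
    (h : Tendsto (fun m => l2Norm g₁ (s m)) atTop (𝓝 0)) :
    Tendsto (fun m => l2Norm g₂ (T (s m))) atTop (𝓝 0) := by
  obtain ⟨C, hC⟩ := hT.bounded
  have h1 := ENNReal.Tendsto.const_mul (a := (C : ℝ≥0∞)) h (Or.inr ENNReal.coe_ne_top)
  rw [mul_zero] at h1
  exact tendsto_of_tendsto_of_tendsto_of_le_of_le tendsto_const_nhds h1 (fun _ => zero_le)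
    fun m => hC _ (hs m)

/-- Applying `T` to an approximating sequence of smooth sections gives one for the image, by
boundedness; so `T` maps the graph of the closure into the graph of the closure. -/
theorem isHamiltonianPair (hT : IsIntertwiner g₁ conn₁ g₂ conn₂ T) {u h : PowSection L₁ k}
    (hu : IsHamiltonianPair g₁ conn₁ u h) : IsHamiltonianPair g₂ conn₂ (T u) (T h) where
  left := hT.isL2 hu.left
  right := hT.isL2 hu.right
  approx := by
    obtain ⟨s, hs, h1, h2⟩ := hu.approx
    refine ⟨fun m => T (s m), fun m => hT.map_mem _ (hs m), ?_, ?_⟩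
    · have := hT.tendsto (fun m => (isMeasurableSection_of_smooth (hs m)).sub hu.left.aemeasurable)
        h1
      simpa only [map_sub] using this
    · have := hT.tendsto (fun m => (isMeasurableSection_of_smooth
        (hT.hamiltonian_mem _ (hs m))).sub hu.right.aemeasurable) h2
      simpa only [map_sub, hT.map_hamiltonian _ (hs _)] using this

/-- The second resolvent is `T` composed with the first resolvent and with `S`, which explains the
constant `A * (C * B)`. For uniqueness, apply `S` to a second solution, use uniqueness there, and
return by `T S = 1`. -/
theorem resolventSet_subset (hT : IsIntertwiner g₁ conn₁ g₂ conn₂ T)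
    (hS : IsIntertwiner g₂ conn₂ g₁ conn₁ S) (hTS : ∀ w, T (S w) = w) :
    resolventSet g₁ conn₁ k ⊆ resolventSet g₂ conn₂ k := by
  rintro c ⟨C, hC⟩
  obtain ⟨A, hA⟩ := hT.bounded
  obtain ⟨B, hB⟩ := hS.bounded
  refine ⟨A * (C * B), fun h hh => ?_⟩
  obtain ⟨u, hu, hb, huniq⟩ := hC (S h) (hS.isL2 hh)
  refine ⟨T u, ?_, ?_, fun u' hu' => ?_⟩
  · have := hT.isHamiltonianPair hu
    rwa [map_add, map_smul, hTS] at this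
  · rw [ENNReal.coe_mul, ENNReal.coe_mul, mul_assoc, mul_assoc]
    refine (hA u hu.left.aemeasurable).trans ?_
    gcongr
    refine hb.trans ?_
    gcongr
    exact hB h hh.aemeasurable
  · have h1 := hS.isHamiltonianPair hu'
    rw [map_add, map_smul] at h1
    have h2 := hA _ (IsMeasurableSection.sub h1.left.aemeasurable hu.left.aemeasurable)
    rw [huniq _ h1, mul_zero, map_sub, hTS] at h2
    exact le_antisymm h2 zero_le

theorem map_mem_eigenspace (hT : IsIntertwiner g₁ conn₁ g₂ conn₂ T) (c : ℂ) :
    ∀ w ∈ eigenspace g₁ conn₁ k c, T w ∈ eigenspace g₂ conn₂ k c := by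
  intro w hw
  refine Submodule.span_induction (p := fun w _ => T w ∈ eigenspace g₂ conn₂ k c) ?_ ?_ ?_ ?_ hw
  · rintro s ⟨hs, hc⟩
    refine Submodule.subset_span ⟨hT.map_mem s hs, ?_⟩
    rw [← hT.map_hamiltonian s hs, hc, map_smul]
  · rw [map_zero]
    exact Submodule.zero_mem _
  · intro u v _ _ hu hv
    rw [map_add]
    exact Submodule.add_mem _ hu hv
  · intro a u _ hu
    rw [map_smul]
    exact Submodule.smul_mem _ _ hu

end IsIntertwiner

end General

section Rank

universe u v

variable {N₁ : Type u} [TopologicalSpace N₁] [ChartedSpace (EuclideanSpace ℝ (Fin n)) N₁]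
  {L₁ : N₁ → Type v} [∀ x, NormedAddCommGroup (L₁ x)] [∀ x, InnerProductSpace ℂ (L₁ x)]
  [TopologicalSpace (TotalSpace ℂ L₁)] [FiberBundle ℂ L₁]
  {N₂ : Type u} [TopologicalSpace N₂] [ChartedSpace (EuclideanSpace ℝ (Fin n)) N₂]
  {L₂ : N₂ → Type v} [∀ x, NormedAddCommGroup (L₂ x)] [∀ x, InnerProductSpace ℂ (L₂ x)]
  [TopologicalSpace (TotalSpace ℂ L₂)] [FiberBundle ℂ L₂]
  {g₁ : FormField n N₁} {conn₁ : ConnField n L₁} {g₂ : FormField n N₂}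
  {conn₂ : ConnField n L₂} {T : PowSection L₁ k →ₗ[ℂ] PowSection L₂ k}

theorem IsIntertwiner.rank_eigenspace_le (hT : IsIntertwiner g₁ conn₁ g₂ conn₂ T)
    (hi : Function.Injective T) (c : ℂ) :
    Module.rank ℂ (eigenspace g₁ conn₁ k c) ≤ Module.rank ℂ (eigenspace g₂ conn₂ k c) :=
  LinearMap.rank_le_of_injective (T.restrict (hT.map_mem_eigenspace c))
    fun _ _ h => Subtype.ext (hi (congrArg Subtype.val h))

end Rank

/-! ### Intertwiners on the covering manifold and on its quotients. -/

section Cover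

variable {M : Type*} [TopologicalSpace M] [T2Space M] [CompactSpace M]
  [ChartedSpace (EuclideanSpace ℝ (Fin n)) M] [IsManifold (𝓡 n) ∞ M]
  {g : ContMDiffRiemannianMetric (𝓡 n) ∞ (EuclideanSpace ℝ (Fin n))
    (fun x : M => TangentSpace (𝓡 n) x)}
  {L : M → Type*} [∀ x, NormedAddCommGroup (L x)] [∀ x, InnerProductSpace ℂ (L x)]
  [TopologicalSpace (TotalSpace ℂ L)] [FiberBundle ℂ L] [VectorBundle ℂ ℂ L]
  [VectorBundle ℝ ℂ L] [ContMDiffVectorBundle ∞ ℂ L (𝓡 n)]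
  {conn : CovariantDerivative (𝓡 n) ℂ L}

section Pull

variable {N₁ : Type*} [TopologicalSpace N₁] [ChartedSpace (EuclideanSpace ℝ (Fin n)) N₁]
  [IsManifold (𝓡 n) ∞ N₁] [CompactSpace N₁]
  {L₁ : N₁ → Type*} [∀ x, NormedAddCommGroup (L₁ x)] [∀ x, InnerProductSpace ℂ (L₁ x)]
  [TopologicalSpace (TotalSpace ℂ L₁)] [FiberBundle ℂ L₁]
  {N₂ : Type*} [TopologicalSpace N₂] [ChartedSpace (EuclideanSpace ℝ (Fin n)) N₂]
  [IsManifold (𝓡 n) ∞ N₂] [CompactSpace N₂]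
  {L₂ : N₂ → Type*} [∀ x, NormedAddCommGroup (L₂ x)] [∀ x, InnerProductSpace ℂ (L₂ x)]
  [TopologicalSpace (TotalSpace ℂ L₂)] [FiberBundle ℂ L₂]
  {g₁ : FormField n N₁} {conn₁ : ConnField n L₁} {g₂ : FormField n N₂}
  {conn₂ : ConnField n L₂} {Φ₁ : M → N₁} {Ψ₁ : ∀ x, L x ≃ₗᵢ[ℂ] L₁ (Φ₁ x)}
  {Φ₂ : M → N₂} {Ψ₂ : ∀ x, L x ≃ₗᵢ[ℂ] L₂ (Φ₂ x)}

theorem IsBundleLocalIsometry.pullPow_injective {g : FormField n M} {conn : ConnField n L}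
    (h : IsBundleLocalIsometry Ψ₁ g conn g₁ conn₁) : Function.Injective (pullPow Ψ₁ k) := by
  intro s s' hs
  funext y
  obtain ⟨x, rfl⟩ := h.surjective y
  exact LinePow.comap_injective _ (congrFun hs x)

/-- An operator between the sections over two quotients which is covered by an intertwiner
is an intertwiner. -/
theorem IsIntertwiner.of_pullPow {A : PowSection L k →ₗ[ℂ] PowSection L k}
    {T : PowSection L₁ k →ₗ[ℂ] PowSection L₂ k} (hL : IsSmoothHermitian n L)
    (hconn : IsHermitianConnection conn)
    (h₁ : IsBundleLocalIsometry Ψ₁ g.inner conn.toFun g₁ conn₁)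
    (h₂ : IsBundleLocalIsometry Ψ₂ g.inner conn.toFun g₂ conn₂)
    (hA : IsIntertwiner g.inner conn.toFun g.inner conn.toFun A)
    (hT : ∀ s, pullPow Ψ₂ k (T s) = A (pullPow Ψ₁ k s)) : IsIntertwiner g₁ conn₁ g₂ conn₂ T := by
  have hmem : ∀ s ∈ smoothSections n L₁ k, T s ∈ smoothSections n L₂ k := fun s hs => by
    rw [← h₂.pullPow_mem_smoothSections hL, hT]
    exact hA.map_mem _ ((h₁.pullPow_mem_smoothSections hL).2 hs)
  refine ⟨fun s hs => ?_, hmem, fun s hs => ?_, fun w hw => ?_, ?_⟩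
  · rw [← h₁.pullPow_mem_smoothSections hL, h₁.pullPow_hamiltonian hL hconn hs]
    exact hamiltonian_mem_smoothSections hL hconn ((h₁.pullPow_mem_smoothSections hL).2 hs)
  -- Pullback to `M` is injective and commutes with the Hamiltonians, so the identity can be checked
  -- upstairs.
  · refine h₂.pullPow_injective ?_
    rw [hT, h₁.pullPow_hamiltonian hL hconn hs, h₂.pullPow_hamiltonian hL hconn (hmem s hs), hT,
      hA.map_hamiltonian _ ((h₁.pullPow_mem_smoothSections hL).2 hs)]
  · rw [← h₂.isMeasurableSection_pullPow hL, hT]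
    exact hA.measurable _ ((h₁.isMeasurableSection_pullPow hL).2 hw)
  · obtain ⟨C, hC⟩ := hA.bounded
    obtain ⟨C₁, hC₁⟩ := h₁.exists_l2Norm_pullPow_le hL k
    obtain ⟨C₂, hC₂⟩ := h₂.exists_l2Norm_le k
    refine ⟨C₂ * (C * C₁), fun w hw => (hC₂ _).trans ?_⟩
    rw [hT, ENNReal.coe_mul, ENNReal.coe_mul, mul_assoc, mul_assoc]
    gcongr
    refine (hC _ ((h₁.isMeasurableSection_pullPow hL).2 hw)).trans ?_
    gcongr
    exact hC₁ w hw

end Pull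

/-- Elements of the group algebra act by such sums; the triangle inequality gives the bound, and
linearity of the Hamiltonian on smooth sections gives the commutation. -/
theorem isIntertwiner_sum (hL : IsSmoothHermitian n L) (hconn : IsHermitianConnection conn)
    {ι : Type*} (t : Finset ι) (c : ι → ℂ) {A : ι → PowSection L k →ₗ[ℂ] PowSection L k}
    (hA : ∀ i, IsIntertwiner g.inner conn.toFun g.inner conn.toFun (A i)) :
    IsIntertwiner g.inner conn.toFun g.inner conn.toFun (∑ i ∈ t, c i • A i) := by
  have happ : ∀ w, (∑ i ∈ t, c i • A i) w = ∑ i ∈ t, c i • A i w := fun w => by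
    rw [LinearMap.sum_apply]
    rfl
  refine ⟨fun s hs => hamiltonian_mem_smoothSections hL hconn hs, fun s hs => ?_, fun s hs => ?_,
    fun w hw => ?_, ?_⟩
  · rw [happ]
    exact Submodule.sum_mem _ fun i _ => Submodule.smul_mem _ _ ((hA i).map_mem s hs)
  · rw [happ, happ, hamiltonian_sum hL hconn t c fun i => (hA i).map_mem s hs]
    exact Finset.sum_congr rfl fun i _ => by rw [(hA i).map_hamiltonian s hs]
  · rw [happ]
    exact IsMeasurableSection.sum t fun i => ((hA i).measurable w hw).smul (c i)
  · choose C hC using fun i => (hA i).bounded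
    refine ⟨∑ i ∈ t, ‖c i‖₊ * C i, fun w hw => ?_⟩
    rw [happ]
    refine (l2Norm_sum_le hL t fun i => ((hA i).measurable w hw).smul (c i)).trans ?_
    rw [ENNReal.ofNNReal_finsetSum, Finset.sum_mul]
    refine Finset.sum_le_sum fun i _ => ?_
    rw [l2Norm_smul, ENNReal.coe_mul, mul_assoc, enorm_eq_nnnorm]
    gcongr
    exact hC i w hw

end Cover

/-! ### The representation on sections and the transplantation. -/

namespace BundleAction

variable {M : Type*} [TopologicalSpace M] [ChartedSpace (EuclideanSpace ℝ (Fin n)) M]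
  {L : M → Type*} [∀ x, NormedAddCommGroup (L x)] [∀ x, InnerProductSpace ℂ (L x)]
  [TopologicalSpace (TotalSpace ℂ L)] [FiberBundle ℂ L]
  {G : Type*} [Group G] [MulAction G M] (ρ : BundleAction n G L)

/-- A section of a tensor power as a function on the total space of the line bundle. -/
def evalTotal {X : Type*} {F : X → Type*} [∀ x, NormedAddCommGroup (F x)]
    [∀ x, InnerProductSpace ℂ (F x)] (w : PowSection F k) (z : TotalSpace ℂ F) : ℂ :=
  (w z.proj).1 z.2

/-- Viewing sections as functions on the total space makes the group laws usable without transport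
between fibers over equal points. -/
theorem ext_evalTotal {X : Type*} {F : X → Type*} [∀ x, NormedAddCommGroup (F x)]
    [∀ x, InnerProductSpace ℂ (F x)] {w w' : PowSection F k}
    (h : ∀ z, evalTotal w z = evalTotal w' z) : w = w' :=
  funext fun x => Subtype.ext (funext fun v => h ⟨x, v⟩)

theorem evalTotal_pullPow_act (a : G) (w : PowSection L k) (z : TotalSpace ℂ L) :
    evalTotal (pullPow (ρ.act a) k w) z = evalTotal w (ρ.total a z) := rfl

/-- The action of `G` on the sections of `L^{⊗k}`. -/
def sectionRep (k : ℤ) : Representation ℂ G (PowSection L k) where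
  toFun a := pullPow (ρ.act a⁻¹) k
  map_one' := LinearMap.ext fun w => ext_evalTotal fun z => by
    rw [evalTotal_pullPow_act, inv_one, total_one]
    rfl
  map_mul' a b := LinearMap.ext fun w => ext_evalTotal fun z => by
    rw [evalTotal_pullPow_act, mul_inv_rev, total_mul]
    rfl

theorem sectionRep_apply (a : G) (w : PowSection L k) :
    ρ.sectionRep k a w = pullPow (ρ.act a⁻¹) k w := rfl

theorem evalTotal_pullPow_toQuot (s : PowSection ρ.QuotFiber k) (z : TotalSpace ℂ L) :
    evalTotal (pullPow ρ.toQuot k s) z = evalTotal s (ρ.proj z) := rfl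

/-- The section of `(G \ L)^{⊗k}` defined by an invariant section of `L^{⊗k}`. -/
def descend (k : ℤ) : PowSection L k →ₗ[ℂ] PowSection ρ.QuotFiber k where
  toFun w q := w q.out
  map_add' _ _ := rfl
  map_smul' _ _ := rfl

theorem evalTotal_descend (w : PowSection L k) (z : TotalSpace ℂ ρ.QuotFiber) :
    evalTotal (ρ.descend k w) z = evalTotal w (ρ.rep z) := rfl

theorem descend_pullPow [IsCancelSMul G M] (s : PowSection ρ.QuotFiber k) :
    ρ.descend k (pullPow ρ.toQuot k s) = s :=
  ext_evalTotal fun z => by rw [evalTotal_descend, evalTotal_pullPow_toQuot, proj_rep]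

/-- Descending keeps only the values at chosen representatives; invariance recovers the others along
the orbits. -/
theorem pullPow_descend {w : PowSection L k} (hw : ∀ a, ρ.sectionRep k a w = w) :
    pullPow ρ.toQuot k (ρ.descend k w) = w := by
  refine ext_evalTotal fun z => ?_
  rw [evalTotal_pullPow_toQuot, evalTotal_descend, rep_proj, ← evalTotal_pullPow_act]
  have := hw (exists_smul_eq_out G z.proj).choose⁻¹
  rw [sectionRep_apply, inv_inv] at this
  rw [this]

theorem sectionRep_pullPow [IsCancelSMul G M] (a : G) (s : PowSection ρ.QuotFiber k) :
    ρ.sectionRep k a (pullPow ρ.toQuot k s) = pullPow ρ.toQuot k s :=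
  ext_evalTotal fun z => by
    rw [sectionRep_apply, evalTotal_pullPow_act, evalTotal_pullPow_toQuot,
      evalTotal_pullPow_toQuot, ← (ρ.proj_eq_iff z _).2 ⟨a⁻¹, rfl⟩]

/-- A group element acts by pullback along an isometry of the bundle; with the identity as second
covering map and as operator upstairs, `IsIntertwiner.of_pullPow` applies to it. The general case is
a finite combination. -/
theorem isIntertwiner_asAlgebraHom [T2Space M] [CompactSpace M] [IsManifold (𝓡 n) ∞ M]
    [ContinuousConstSMul G M] {g : ContMDiffRiemannianMetric (𝓡 n) ∞ (EuclideanSpace ℝ (Fin n))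
      (fun x : M => TangentSpace (𝓡 n) x)} [VectorBundle ℂ ℂ L]
    [VectorBundle ℝ ℂ L] [ContMDiffVectorBundle ∞ ℂ L (𝓡 n)] (hL : IsSmoothHermitian n L)
    {conn : CovariantDerivative (𝓡 n) ℂ L} (hconn : IsHermitianConnection conn)
    (hg : ActsByIsometries G g.inner) (hρ : ρ.Preserves conn.toFun) (t : MonoidAlgebra ℂ G) :
    IsIntertwiner g.inner conn.toFun g.inner conn.toFun ((ρ.sectionRep k).asAlgebraHom t) := by
  have h : ∀ a, IsIntertwiner g.inner conn.toFun g.inner conn.toFun (ρ.sectionRep k a) :=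
    fun a => IsIntertwiner.of_pullPow (A := LinearMap.id) (T := ρ.sectionRep k a) hL hconn
      (ρ.isBundleLocalIsometry_act hg hρ a⁻¹) (isBundleLocalIsometry_refl g.inner conn.toFun)
      ⟨fun s hs => hamiltonian_mem_smoothSections hL hconn hs, fun _ h => h, fun _ _ => rfl,
        fun _ h => h, 1, fun w _ => by simp⟩ fun _ => rfl
  have := isIntertwiner_sum hL hconn t.coeff.support t.coeff h
  rwa [Representation.asAlgebraHom_def, MonoidAlgebra.lift_apply]

/-- The transplantation of sections between two quotients by almost conjugate subgroups. -/
theorem exists_isIntertwiner_quotient [T2Space M] [CompactSpace M] [IsManifold (𝓡 n) ∞ M]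
    [Finite G] [ContinuousConstSMul G M]
    (g : ContMDiffRiemannianMetric (𝓡 n) ∞ (EuclideanSpace ℝ (Fin n))
      (fun x : M => TangentSpace (𝓡 n) x)) [VectorBundle ℂ ℂ L]
    [VectorBundle ℝ ℂ L] [ContMDiffVectorBundle ∞ ℂ L (𝓡 n)] (hL : IsSmoothHermitian n L)
    {conn : CovariantDerivative (𝓡 n) ℂ L} (hconn : IsHermitianConnection conn)
    (hg : ActsByIsometries G g.inner) (hρ : ρ.Preserves conn.toFun)
    (Γ₁ Γ₂ : Subgroup G) [IsCancelSMul Γ₁ M] [IsCancelSMul Γ₂ M]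
    (hΓ : AlmostConjugate Γ₁ Γ₂) (k : ℤ) :
    ∃ (T : PowSection (ρ.restrict Γ₁).QuotFiber k →ₗ[ℂ] PowSection (ρ.restrict Γ₂).QuotFiber k)
      (S : PowSection (ρ.restrict Γ₂).QuotFiber k →ₗ[ℂ] PowSection (ρ.restrict Γ₁).QuotFiber k),
      IsIntertwiner (quotMetric Γ₁ g.inner) ((ρ.restrict Γ₁).quotConn conn.toFun)
        (quotMetric Γ₂ g.inner) ((ρ.restrict Γ₂).quotConn conn.toFun) T ∧
      IsIntertwiner (quotMetric Γ₂ g.inner) ((ρ.restrict Γ₂).quotConn conn.toFun)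
        (quotMetric Γ₁ g.inner) ((ρ.restrict Γ₁).quotConn conn.toFun) S ∧
      (∀ w, S (T w) = w) ∧ ∀ w, T (S w) = w := by
  obtain ⟨t, s, h⟩ := hΓ.exists_transplantation
  obtain ⟨h₂, h₁, hst, hts⟩ := h (ρ.sectionRep k)
  have hg' : ∀ Γ : Subgroup G, ActsByIsometries Γ g.inner := fun Γ γ => hg γ
  have hρ' : ∀ Γ : Subgroup G, (ρ.restrict Γ).Preserves conn.toFun := fun Γ γ => hρ γ
  have := isManifold_quotient fun γ => (hg' Γ₁ γ).1
  have := isManifold_quotient fun γ => (hg' Γ₂ γ).1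
  have e₁ := (ρ.restrict Γ₁).isBundleLocalIsometry_mk (hg' Γ₁) (hρ' Γ₁)
  have e₂ := (ρ.restrict Γ₂).isBundleLocalIsometry_mk (hg' Γ₂) (hρ' Γ₂)
  have i₁ : ∀ w (γ : Γ₁), ρ.sectionRep k γ (pullPow (ρ.restrict Γ₁).toQuot k w)
      = pullPow (ρ.restrict Γ₁).toQuot k w := fun w γ => (ρ.restrict Γ₁).sectionRep_pullPow γ w
  have i₂ : ∀ w (γ : Γ₂), ρ.sectionRep k γ (pullPow (ρ.restrict Γ₂).toQuot k w)
      = pullPow (ρ.restrict Γ₂).toQuot k w := fun w γ => (ρ.restrict Γ₂).sectionRep_pullPow γ w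
  -- Lift to an invariant section on `M`, apply the element of the group algebra, and descend; its
  -- image is invariant under the other subgroup, so nothing is lost in descending.
  refine ⟨(ρ.restrict Γ₂).descend k ∘ₗ (ρ.sectionRep k).asAlgebraHom t ∘ₗ
      pullPow (ρ.restrict Γ₁).toQuot k,
    (ρ.restrict Γ₁).descend k ∘ₗ (ρ.sectionRep k).asAlgebraHom s ∘ₗ
      pullPow (ρ.restrict Γ₂).toQuot k, ?_, ?_, fun w => ?_, fun w => ?_⟩
  · exact IsIntertwiner.of_pullPow hL hconn e₁ e₂
      (ρ.isIntertwiner_asAlgebraHom hL hconn hg hρ t) fun w =>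
        (ρ.restrict Γ₂).pullPow_descend (h₂ _)
  · exact IsIntertwiner.of_pullPow hL hconn e₂ e₁
      (ρ.isIntertwiner_asAlgebraHom hL hconn hg hρ s) fun w =>
        (ρ.restrict Γ₁).pullPow_descend (h₁ _)
  · simp only [LinearMap.comp_apply]
    rw [(ρ.restrict Γ₂).pullPow_descend (h₂ _), hst _ (i₁ w), descend_pullPow]
  · simp only [LinearMap.comp_apply]
    rw [(ρ.restrict Γ₁).pullPow_descend (h₁ _), hts _ (i₂ w), descend_pullPow]

end BundleAction

end Intertwiner

end QuantumMagnetic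

end

theorem theorem3p4 {n : ℕ} {M : Type*} [TopologicalSpace M] [T2Space M] [CompactSpace M]
    [ChartedSpace (EuclideanSpace ℝ (Fin n)) M] [IsManifold (𝓡 n) ∞ M]
    (g : ContMDiffRiemannianMetric (𝓡 n) ∞ (EuclideanSpace ℝ (Fin n))
      (fun x : M => TangentSpace (𝓡 n) x))
    {L : M → Type*} [∀ x, NormedAddCommGroup (L x)] [∀ x, InnerProductSpace ℂ (L x)]
    [TopologicalSpace (TotalSpace ℂ L)] [FiberBundle ℂ L] [VectorBundle ℂ ℂ L]
    [VectorBundle ℝ ℂ L] [ContMDiffVectorBundle ∞ ℂ L (𝓡 n)] (hL : IsSmoothHermitian n L)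
    (conn : CovariantDerivative (𝓡 n) ℂ L) (hconn : IsHermitianConnection conn)
    {G : Type*} [Group G] [Finite G] [MulAction G M] [ContinuousConstSMul G M]
    (ρ : BundleAction n G L) (hg : ActsByIsometries G g.inner) (hρ : ρ.Preserves conn.toFun)
    (Γ₁ Γ₂ : Subgroup G) [IsCancelSMul Γ₁ M] [IsCancelSMul Γ₂ M]
    (hΓ : AlmostConjugate Γ₁ Γ₂)
    (om₁ : FormField n (orbitRel.Quotient Γ₁ M)) (om₂ : FormField n (orbitRel.Quotient Γ₂ M))
    (hom₁ : HasMagneticCurvature ((ρ.restrict Γ₁).quotConn conn.toFun) om₁)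
    (hom₂ : HasMagneticCurvature ((ρ.restrict Γ₂).quotConn conn.toFun) om₂) :
    QuantumEquivalent
      (BundleAction.quotMetric Γ₁ g.inner) om₁ ((ρ.restrict Γ₁).quotConn conn.toFun)
      (BundleAction.quotMetric Γ₂ g.inner) om₂ ((ρ.restrict Γ₂).quotConn conn.toFun) := by
  refine ⟨hom₁, hom₂, fun k _ => ?_, fun k _ c => ?_⟩
  · obtain ⟨T, S, hT, hS, hST, hTS⟩ :=
      ρ.exists_isIntertwiner_quotient g hL hconn hg hρ Γ₁ Γ₂ hΓ k
    -- The spectrum is the complement of the resolvent set, and each resolvent set contains the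
    -- other.
    exact congrArg compl
      ((hT.resolventSet_subset hS hTS).antisymm (hS.resolventSet_subset hT hST))
  · obtain ⟨T, S, hT, hS, hST, hTS⟩ :=
      ρ.exists_isIntertwiner_quotient g hL hconn hg hρ Γ₁ Γ₂ hΓ k
    exact le_antisymm (hT.rank_eigenspace_le (Function.LeftInverse.injective hST) c)
      (hS.rank_eigenspace_le (Function.LeftInverse.injective hTS) c)
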